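/- **Theorem 2.1 (double supercentralizer theorem).** All algebras and modules are finite-dimensional over $\mathbb C$; algebras are unital and associative, and algebra homomorphisms are unital. A *superalgebra* is a $\mathbb Z/2$-graded algebra $A=A_0\oplus A_1$. An *$A$-module* is a $\mathbb Z/2$-graded vector space $V=V_0\oplus V_1$ with a grading-preserving algebra homomorphism $\rho:A\to\operatorname{End}(V)$; submodules are graded and $\rho(A)$-stable; a module is *simple* if it is nonzero and has no submodules except itself and $0$. $A$ is *semisimple* if its regular module is a sum of simple submodules. For $\alpha\in\mathbb Z/2$ let $\operatorname{Hom}^\alpha_A(V,W)$ be the space of linear maps $f:V\to W$ with $f(V_\beta)\subset W_{\alpha+\beta}$ and $f(av)=(-1)^{\alpha\beta}af(v)$ for all $\beta\in\mathbb Z/2$, $a\in A_\beta$, $v\in V$; put $\operatorname{Hom}^{\cdot}_A=\operatorname{Hom}^0_A\oplus\operatorname{Hom}^1_A$ and $\operatorname{End}^{\cdot}_A(V)=\operatorname{Hom}^{\cdot}_A(V,V)$, a subsuperalgebra of $\operatorname{End}(V)$. Write $V\cong_A W$ if $\operatorname{Hom}^{\cdot}_A(V,W)$ contains an invertible map, and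 $V\mathrel{\dot\cong}_A W$ if $\operatorname{Hom}^0_A(V,W)$ does. The *shift* $\overline V$ is the space $V$ with $\overline V_0=V_1$, $\overline V_1=V_0$ and $a\in A_\alpha$ acting by $(-1)^\alpha\rho(a)$. Let $M(1,0)=\mathbb C$ (in degree $0$) and let $Q(1)$ be the algebra of complex matrices $\begin{pmatrix}c&d\\ d&c\end{pmatrix}$, with the diagonal ones of degree $0$ and the antidiagonal ones of degree $1$. A simple $A$-module $V$ is *of type $M$* (resp. *of type $Q$*) if $\operatorname{End}^{\cdot}_A(V)$ is isomorphic, as a superalgebra, to $M(1,0)$ (resp. $Q(1)$). The *$A$-homogeneous components* of $V$ are the sums, one for each class under $\cong_A$ of simple submodules of $V$, of all simple submodules in that class. A simple module *appears in* $V$ if it is isomorphic ($\cong$) to a submodule of $V$. The supertensor product $A\mathbin{\dot\otimes}B$ of superalgebras is $A\otimes B$ with $(A\otimes B)_\alpha=\bigoplus_{\beta+\gamma=\alpha}A_\beta\otimes B_\gamma$ and $(a\otimes b)(c\otimes d)=(-1)^{\beta\gamma}ac\otimes bd$ for $b\in B_\beta$, $c\in A_\gamma$. The supertensor product $U\mathbin{\dot\otimes}W$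 of an $A$-module $U$ and a $B$-module $W$ is the $A\mathbin{\dot\otimes}B$-module $U\otimes W$, graded in the same way, with $(a\otimes b)(u\otimes w)=(-1)^{\beta\alpha}au\otimes bw$ for $b\in B_\beta$, $u\in U_\alpha$. Let $A$ be a semisimple superalgebra and $V$ an $A$-module with representation $\rho:A\to\operatorname{End}(V)$. Let $V_1,\dots,V_s$ be the $A$-homogeneous components of $V$ (there are finitely many, and $V=V_1\oplus\cdots\oplus V_s$). Put $B=\operatorname{End}^{\cdot}_A(V)$, and let $A\mathbin{\dot\otimes}B$ act on $V$ by $\tilde\rho(a\otimes b)=\rho(a)\circ b$. Then: 1. Each $V_i$ is a simple $A\mathbin{\dot\otimes}B$-submodule of $V$ of type $M$. 2. Let $U_i$ be a simple $A$-module contained in $V_i$ $(1\le i\le s)$. Then there are simple $B$-modules $W_i$ $(1\le i\le s)$ such that: * if $U_i$ is of type $M$, then $W_i$ is of type $M$ and $U_i\mathbin{\dot\otimes}W_i\mathrel{\dot\cong}_{A\dot\otimes B}\overline U_i\mathbin{\dot\otimes}\overline W_i\mathrel{\dot\cong}_{A\dot\otimes B}V_i$; * if $U_i$ is of type $Q$,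 then $W_i$ is of type $Q$ and $U_i\mathbin{\dot\otimes}W_i\mathrel{\dot\cong}_{A\dot\otimes B}V_i\oplus\overline V_i$; * $U_i\not\cong_A U_j$ and $W_i\not\cong_B W_j$ for all $i\ne j$; * every simple $A$-module appearing in $V$ is isomorphic to some $U_i$, every $W_i$ appears in the $B$-module $V$, and $U_i\mapsto W_i$ induces a bijection, independent of the choice of the $U_i$, from the isomorphism classes (for $\cong_A$) of simple $A$-modules appearing in $V$ onto the isomorphism classes (for $\cong_B$) of simple $B$-modules appearing in $V$. 3. $\operatorname{End}^{\cdot}_B(V)=\rho(A)$. -/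

import Mathlib

open scoped TensorProduct

universe u v w

noncomputable section

namespace Super

/-! ### Superspaces

A `ZMod 2`-grading of a complex vector space `V` is a family `G : ZMod 2 → Submodule ℂ V` with
`V = G 0 ⊕ G 1`, expressed as `IsCompl (G 0) (G 1)`. -/

section Grading

variable {V : Type v} [AddCommGroup V] [Module ℂ V] {G : ZMod 2 → Submodule ℂ V}

theorem zmod2_cases (i : ZMod 2) : i = 0 ∨ i = 1 := by
  revert i; decide

/-- The projection of `V = G 0 ⊕ G 1` onto its component of degree `k`. -/
def comp (h : IsCompl (G 0) (G 1)) (k : ZMod 2) : V →ₗ[ℂ] V :=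
  if k = 0 then Submodule.projection _ _ h else Submodule.projection _ _ h.symm

theorem comp_of_mem (h : IsCompl (G 0) (G 1)) (k : ZMod 2) {i : ZMod 2} {x : V} (hx : x ∈ G i) :
    comp h k x = if k = i then x else 0 := by
  rcases zmod2_cases k with rfl | rfl <;> rcases zmod2_cases i with rfl | rfl
  · simpa [comp] using (Submodule.projection_eq_self_iff h x).2 hx
  · simpa [comp] using (Submodule.projection_apply_eq_zero_iff h).2 hx
  · simpa [comp] using (Submodule.projection_apply_eq_zero_iff h.symm).2 hx
  · simpa [comp] using (Submodule.projection_eq_self_iff h.symm x).2 hx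

theorem exists_add (h : IsCompl (G 0) (G 1)) (x : V) : ∃ y ∈ G 0, ∃ z ∈ G 1, y + z = x :=
  Submodule.mem_sup.1 (h.sup_eq_top ▸ Submodule.mem_top)

/-- The parity involution: the identity on `G 0` and minus the identity on `G 1`. -/
def parity (h : IsCompl (G 0) (G 1)) : V →ₗ[ℂ] V := comp h 0 - comp h 1

theorem parity_of_mem (h : IsCompl (G 0) (G 1)) {i : ZMod 2} {x : V} (hx : x ∈ G i) :
    parity h x = (-1 : ℤˣ) ^ i • x := by
  rcases zmod2_cases i with rfl | rfl <;> simp [parity, comp_of_mem h _ hx]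

/-- The grading of a tensor product: the degree `k` part is the sum of all
`(degree i) ⊗ (degree j)` with `i + j = k`. -/
def tensorGr {W : Type w} [AddCommGroup W] [Module ℂ W] (G : ZMod 2 → Submodule ℂ V)
    (H : ZMod 2 → Submodule ℂ W) (k : ZMod 2) : Submodule ℂ (V ⊗[ℂ] W) :=
  ⨆ (i : ZMod 2) (j : ZMod 2) (_ : i + j = k),
    Submodule.map₂ (TensorProduct.mk ℂ V W) (G i) (H j)

theorem tmul_mem_tensorGr {W : Type w} [AddCommGroup W] [Module ℂ W]
    {H : ZMod 2 → Submodule ℂ W} {i j : ZMod 2} {x : V} {y : W} (hx : x ∈ G i) (hy : y ∈ H j) :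
    x ⊗ₜ[ℂ] y ∈ tensorGr G H (i + j) :=
  Submodule.mem_iSup_of_mem i <| Submodule.mem_iSup_of_mem j <| Submodule.mem_iSup_of_mem rfl <|
    Submodule.apply_mem_map₂ _ hx hy

theorem tensorGr_le {W : Type w} [AddCommGroup W] [Module ℂ W]
    {H : ZMod 2 → Submodule ℂ W} {k : ZMod 2} {S : Submodule ℂ (V ⊗[ℂ] W)}
    (hS : ∀ i j x y, i + j = k → x ∈ G i → y ∈ H j → x ⊗ₜ[ℂ] y ∈ S) : tensorGr G H k ≤ S :=
  iSup_le fun i => iSup_le fun j => iSup_le fun e => Submodule.map₂_le.2 fun x hx y hy =>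
    hS i j x y e hx hy

theorem isCompl_tensorGr {W : Type w} [AddCommGroup W] [Module ℂ W]
    {H : ZMod 2 → Submodule ℂ W} (hG : IsCompl (G 0) (G 1)) (hH : IsCompl (H 0) (H 1)) :
    IsCompl (tensorGr G H 0) (tensorGr G H 1) := by
  have key : ∀ k : ZMod 2, ∀ t ∈ tensorGr G H k,
      TensorProduct.map (parity hG) (parity hH) t = (-1 : ℤˣ) ^ k • t := by
    intro k t ht
    have : tensorGr G H k ≤ LinearMap.eqLocus (TensorProduct.map (parity hG) (parity hH))
        ((((-1 : ℤˣ) ^ k : ℤˣ) : ℤ) • LinearMap.id) := by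
      refine tensorGr_le fun i j x y e hx hy => ?_
      rw [LinearMap.mem_eqLocus, TensorProduct.map_tmul, parity_of_mem hG hx, parity_of_mem hH hy]
      subst e
      rcases zmod2_cases i with rfl | rfl <;> rcases zmod2_cases j with rfl | rfl <;>
        simp [TensorProduct.neg_tmul, TensorProduct.tmul_neg,
          show (1 : ZMod 2) + 1 = 0 from rfl]
    have h2 := this ht
    rw [LinearMap.mem_eqLocus] at h2
    rw [h2, Units.smul_def]
    rfl
  constructor
  · rw [Submodule.disjoint_def]
    intro t h0 h1
    have e0 := key 0 t h0
    have e1 := key 1 t h1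
    rw [e0] at e1
    simp only [uzpow_zero, uzpow_one, one_smul, Units.neg_smul] at e1
    have e2 : (2 : ℂ) • t = 0 := by
      rw [two_smul]
      nth_rewrite 1 [e1]
      exact neg_add_cancel t
    exact (smul_eq_zero.1 e2).resolve_left two_ne_zero
  · rw [codisjoint_iff, eq_top_iff, ← TensorProduct.span_tmul_eq_top, Submodule.span_le]
    rintro _ ⟨x, y, rfl⟩
    obtain ⟨x0, hx0, x1, hx1, rfl⟩ := exists_add hG x
    obtain ⟨y0, hy0, y1, hy1, rfl⟩ := exists_add hH y
    have h00 := tmul_mem_tensorGr hx0 hy0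
    have h01 := tmul_mem_tensorGr hx0 hy1
    have h10 := tmul_mem_tensorGr hx1 hy0
    have h11 := tmul_mem_tensorGr hx1 hy1
    simp only [add_zero, zero_add, show (1 : ZMod 2) + 1 = 0 from rfl] at h00 h01 h10 h11
    simp only [TensorProduct.add_tmul, TensorProduct.tmul_add]
    exact add_mem (add_mem (Submodule.mem_sup_left h00) (Submodule.mem_sup_right h10))
      (add_mem (Submodule.mem_sup_right h01) (Submodule.mem_sup_left h11))

end Grading

/-! ### Superalgebras

A superalgebra is a `ℂ`-algebra `A` with a family `𝒜 : ZMod 2 → Submodule ℂ A` and Mathlib's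
`GradedAlgebra 𝒜`. -/

section Algebra

variable {A : Type u} [Ring A] [Algebra ℂ A]

theorem isCompl_gr (𝒜 : ZMod 2 → Submodule ℂ A) [GradedAlgebra 𝒜] : IsCompl (𝒜 0) (𝒜 1) :=
  (DirectSum.isInternal_submodule_iff_isCompl 𝒜 (by decide)
    (by ext i; simpa using zmod2_cases i)).1 (DirectSum.Decomposition.isInternal 𝒜)

/-- A family with `A = 𝒜 0 ⊕ 𝒜 1`, `1 ∈ 𝒜 0` and `𝒜 i * 𝒜 j ⊆ 𝒜 (i + j)` is a superalgebra
structure. -/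
abbrev mkGradedAlgebra (𝒜 : ZMod 2 → Submodule ℂ A) (h : IsCompl (𝒜 0) (𝒜 1)) (h1 : 1 ∈ 𝒜 0)
    (hmul : ∀ i j a b, a ∈ 𝒜 i → b ∈ 𝒜 j → a * b ∈ 𝒜 (i + j)) : GradedAlgebra 𝒜 :=
  letI : SetLike.GradedMonoid 𝒜 := { one_mem := h1, mul_mem := fun i j a b => hmul i j a b }
  { toGradedMonoid := this
    toDecomposition := ((DirectSum.isInternal_submodule_iff_isCompl 𝒜 (by decide)
      (by ext i; simpa using zmod2_cases i)).2 h).chooseDecomposition }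

/-- The parity automorphism `a ↦ (-1)^α a` for `a ∈ A_α`. -/
def parityAut (𝒜 : ZMod 2 → Submodule ℂ A) [GradedAlgebra 𝒜] : A →ₐ[ℂ] A :=
  AlgHom.ofLinearMap (parity (isCompl_gr 𝒜))
    (by rw [parity_of_mem _ (SetLike.GradedOne.one_mem : (1 : A) ∈ 𝒜 0)]; simp)
    (by
      intro x y
      obtain ⟨x0, hx0, x1, hx1, rfl⟩ := exists_add (isCompl_gr 𝒜) x
      obtain ⟨y0, hy0, y1, hy1, rfl⟩ := exists_add (isCompl_gr 𝒜) y
      simp only [add_mul, mul_add, map_add,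
        parity_of_mem _ (SetLike.GradedMul.mul_mem hx0 hy0),
        parity_of_mem _ (SetLike.GradedMul.mul_mem hx0 hy1),
        parity_of_mem _ (SetLike.GradedMul.mul_mem hx1 hy0),
        parity_of_mem _ (SetLike.GradedMul.mul_mem hx1 hy1),
        parity_of_mem _ hx0, parity_of_mem _ hx1, parity_of_mem _ hy0, parity_of_mem _ hy1]
      simp [show (1 : ZMod 2) + 1 = 0 from rfl])

theorem parityAut_of_mem (𝒜 : ZMod 2 → Submodule ℂ A) [GradedAlgebra 𝒜] {i : ZMod 2} {a : A}
    (ha : a ∈ 𝒜 i) : parityAut 𝒜 a = (-1 : ℤˣ) ^ i • a :=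
  parity_of_mem _ ha

/-- Two superalgebras are isomorphic: there is a degree-preserving algebra isomorphism. -/
def SuperalgebraIso {A : Type u} [Ring A] [Algebra ℂ A] (𝒜 : ZMod 2 → Submodule ℂ A)
    {B : Type v} [Ring B] [Algebra ℂ B] (ℬ : ZMod 2 → Submodule ℂ B) : Prop :=
  ∃ e : A ≃ₐ[ℂ] B, ∀ i a, a ∈ 𝒜 i ↔ e a ∈ ℬ i

variable {B : Type v} [Ring B] [Algebra ℂ B]

/-- The grading of the supertensor product `𝒜 ᵍ⊗[ℂ] ℬ` (Mathlib's graded tensor product, whose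
product is `(a ⊗ b)(c ⊗ d) = (-1)^(β γ) ac ⊗ bd` for `b` of degree `β` and `c` of degree `γ`). -/
def superTensorGr (𝒜 : ZMod 2 → Submodule ℂ A) [GradedAlgebra 𝒜]
    (ℬ : ZMod 2 → Submodule ℂ B) [GradedAlgebra ℬ] (k : ZMod 2) : Submodule ℂ (𝒜 ᵍ⊗[ℂ] ℬ) :=
  (tensorGr 𝒜 ℬ k).map (GradedTensorProduct.of ℂ 𝒜 ℬ).toLinearMap

instance instGradedTensor (𝒜 : ZMod 2 → Submodule ℂ A) [GradedAlgebra 𝒜]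
    (ℬ : ZMod 2 → Submodule ℂ B) [GradedAlgebra ℬ] : GradedAlgebra (superTensorGr 𝒜 ℬ) :=
  mkGradedAlgebra _
    ((Submodule.orderIsoMapComap (GradedTensorProduct.of ℂ 𝒜 ℬ)).isCompl
      (isCompl_tensorGr (isCompl_gr 𝒜) (isCompl_gr ℬ)))
    ⟨(1 : A) ⊗ₜ[ℂ] (1 : B), by
      have h := tmul_mem_tensorGr (SetLike.GradedOne.one_mem : (1 : A) ∈ 𝒜 0)
        (SetLike.GradedOne.one_mem : (1 : B) ∈ ℬ 0)
      rwa [add_zero] at h, rfl⟩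
    (by
      rintro k l _ _ ⟨s, hs, rfl⟩ ⟨t, ht, rfl⟩
      let F : (A ⊗[ℂ] B) →ₗ[ℂ] (A ⊗[ℂ] B) →ₗ[ℂ] (𝒜 ᵍ⊗[ℂ] ℬ) :=
        (LinearMap.mul ℂ (𝒜 ᵍ⊗[ℂ] ℬ)).compl₁₂ (GradedTensorProduct.of ℂ 𝒜 ℬ).toLinearMap
          (GradedTensorProduct.of ℂ 𝒜 ℬ).toLinearMap
      change F s t ∈ superTensorGr 𝒜 ℬ (k + l)
      have hs' : tensorGr 𝒜 ℬ k ≤ (superTensorGr 𝒜 ℬ (k + l)).comap (F.flip t) := by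
        refine tensorGr_le fun i j a b e ha hb => ?_
        change F (a ⊗ₜ b) t ∈ superTensorGr 𝒜 ℬ (k + l)
        have ht' : tensorGr 𝒜 ℬ l ≤ (superTensorGr 𝒜 ℬ (k + l)).comap (F (a ⊗ₜ b)) := by
          refine tensorGr_le fun i' j' c d e' hc hd => ?_
          have := GradedTensorProduct.tmul_coe_mul_coe_tmul (R := ℂ) (𝒜 := 𝒜) (ℬ := ℬ)
            a ⟨b, hb⟩ ⟨c, hc⟩ d
          change GradedTensorProduct.tmul ℂ a b * GradedTensorProduct.tmul ℂ c d ∈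
            superTensorGr 𝒜 ℬ (k + l)
          rw [this, Units.smul_def]
          refine zsmul_mem ?_ _
          refine ⟨_, ?_, rfl⟩
          have h := tmul_mem_tensorGr (SetLike.GradedMul.mul_mem ha hc)
            (SetLike.GradedMul.mul_mem hb hd)
          rwa [show i + i' + (j + j') = k + l by rw [← e, ← e']; ring] at h
        exact ht' ht
      exact hs' hs)

end Algebra

/-! ### The superalgebras `M(n,m)` and `Q(n)` -/

/-- The degree of a basis vector of `ℂ^{n|m}`. -/
def basisDegree (n m : ℕ) : Fin n ⊕ Fin m → ZMod 2 := Sum.elim (fun _ => 0) (fun _ => 1)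

/-- The grading of `M(n,m)`, the full matrix algebra of `ℂ^{n|m}`: block diagonal matrices are of
degree `0`, block antidiagonal ones of degree `1`. -/
def matGr (n m : ℕ) (k : ZMod 2) : Submodule ℂ (Matrix (Fin n ⊕ Fin m) (Fin n ⊕ Fin m) ℂ) where
  carrier := {X | ∀ p q, basisDegree n m p ≠ k + basisDegree n m q → X p q = 0}
  zero_mem' := fun _ _ _ => rfl
  add_mem' := fun {X Y} hX hY p q h => by simp [hX p q h, hY p q h]
  smul_mem' := fun c X hX p q h => by simp [hX p q h]

/-- The subalgebra `Q(n)` of `M(n,n)` of all block matrices `(C, D; D, C)`. -/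
def matQ (n : ℕ) : Subalgebra ℂ (Matrix (Fin n ⊕ Fin n) (Fin n ⊕ Fin n) ℂ) where
  carrier := {X | ∃ C D : Matrix (Fin n) (Fin n) ℂ, X = Matrix.fromBlocks C D D C}
  mul_mem' := by
    rintro _ _ ⟨C, D, rfl⟩ ⟨C', D', rfl⟩
    exact ⟨C * C' + D * D', C * D' + D * C', by
      rw [Matrix.fromBlocks_multiply, add_comm (D * C'), add_comm (D * D')]⟩
  add_mem' := by
    rintro _ _ ⟨C, D, rfl⟩ ⟨C', D', rfl⟩
    exact ⟨C + C', D + D', by rw [Matrix.fromBlocks_add]⟩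
  algebraMap_mem' := fun c => ⟨algebraMap ℂ _ c, 0, by
    simp only [Algebra.algebraMap_eq_smul_one, ← Matrix.fromBlocks_one, Matrix.fromBlocks_smul,
      smul_zero]⟩

/-- The grading of `Q(n)`, inherited from `M(n,n)`. -/
def matQGr (n : ℕ) (k : ZMod 2) : Submodule ℂ (matQ n) :=
  (matGr n n k).comap (matQ n).val.toLinearMap

/-! ### Modules over a superalgebra -/

/-- A (finite-dimensional) module over the superalgebra `(A, 𝒜)`: a superspace with a
degree-preserving algebra homomorphism `ρ : A → End(V)`. -/
structure SuperModule {A : Type u} [Ring A] [Algebra ℂ A] (𝒜 : ZMod 2 → Submodule ℂ A)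
    [GradedAlgebra 𝒜] where
  carrier : Type v
  [addCommGroup : AddCommGroup carrier]
  [module : Module ℂ carrier]
  [finite : FiniteDimensional ℂ carrier]
  gr : ZMod 2 → Submodule ℂ carrier
  isCompl : IsCompl (gr 0) (gr 1)
  ρ : A →ₐ[ℂ] Module.End ℂ carrier
  ρ_mem : ∀ i j a x, a ∈ 𝒜 i → x ∈ gr j → ρ a x ∈ gr (i + j)

attribute [instance] SuperModule.addCommGroup SuperModule.module SuperModule.finite

namespace SuperModule

variable {A : Type u} [Ring A] [Algebra ℂ A] {𝒜 : ZMod 2 → Submodule ℂ A} [GradedAlgebra 𝒜]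

/-- `Hom^α_A(V, W)`: linear maps `f` of degree `α` with `f (a x) = (-1)^(α β) a (f x)` for
`a ∈ A_β`. -/
def homGr (V : SuperModule.{u, v} 𝒜) (W : SuperModule.{u, w} 𝒜) (α : ZMod 2) :
    Submodule ℂ (V.carrier →ₗ[ℂ] W.carrier) where
  carrier := {f | (∀ β, ∀ x ∈ V.gr β, f x ∈ W.gr (α + β)) ∧
    ∀ β, ∀ a ∈ 𝒜 β, ∀ x, f (V.ρ a x) = (-1 : ℤˣ) ^ (α * β) • W.ρ a (f x)}
  zero_mem' := ⟨fun _ _ _ => by simp, fun _ _ _ _ => by simp⟩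
  add_mem' := fun {f g} hf hg =>
    ⟨fun β x hx => add_mem (hf.1 β x hx) (hg.1 β x hx),
      fun β a ha x => by simp [hf.2 β a ha x, hg.2 β a ha x]⟩
  smul_mem' := fun c f hf =>
    ⟨fun β x hx => Submodule.smul_mem _ c (hf.1 β x hx),
      fun β a ha x => by
        simp only [LinearMap.smul_apply, hf.2 β a ha x, map_smul]
        rw [smul_comm]⟩

/-- `Hom·_A(V, W) = Hom^0_A(V, W) ⊕ Hom^1_A(V, W)`. -/
def superHom (V : SuperModule.{u, v} 𝒜) (W : SuperModule.{u, w} 𝒜) :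
    Submodule ℂ (V.carrier →ₗ[ℂ] W.carrier) :=
  homGr V W 0 ⊔ homGr V W 1

/-- `V ≅_A W`: there is an invertible element of `Hom·_A(V, W)`. -/
def Iso (V : SuperModule.{u, v} 𝒜) (W : SuperModule.{u, w} 𝒜) : Prop :=
  ∃ f : V.carrier ≃ₗ[ℂ] W.carrier, (f : V.carrier →ₗ[ℂ] W.carrier) ∈ superHom V W

/-- `V` and `W` are strictly isomorphic: there is an invertible element of `Hom^0_A(V, W)`. -/
def StrictIso (V : SuperModule.{u, v} 𝒜) (W : SuperModule.{u, w} 𝒜) : Prop :=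
  ∃ f : V.carrier ≃ₗ[ℂ] W.carrier, (f : V.carrier →ₗ[ℂ] W.carrier) ∈ homGr V W 0

theorem homGr_mul (V : SuperModule.{u, v} 𝒜) {i j : ZMod 2} {f g : Module.End ℂ V.carrier}
    (hf : f ∈ homGr V V i) (hg : g ∈ homGr V V j) : f * g ∈ homGr V V (i + j) := by
  refine ⟨fun β x hx => ?_, fun β a ha x => ?_⟩
  · rw [add_assoc]
    exact hf.1 _ _ (hg.1 _ _ hx)
  · change f (g _) = _ • V.ρ a (f (g x))
    rw [hg.2 β a ha x, Units.smul_def, map_zsmul, ← Units.smul_def, hf.2 β a ha, smul_smul,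
      ← uzpow_add, add_mul, add_comm]

theorem homGr_one (V : SuperModule.{u, v} 𝒜) : (1 : Module.End ℂ V.carrier) ∈ homGr V V 0 :=
  ⟨fun β x hx => by simpa using hx, fun β a ha x => by simp⟩

/-- The supercentralizer `End·_A(V)`, a subalgebra of `End(V)`. -/
def superEnd (V : SuperModule.{u, v} 𝒜) : Subalgebra ℂ (Module.End ℂ V.carrier) :=
  Submodule.toSubalgebra (superHom V V) (Submodule.mem_sup_left V.homGr_one) (by
    intro f g hf hg
    obtain ⟨f0, hf0, f1, hf1, rfl⟩ := Submodule.mem_sup.1 hf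
    obtain ⟨g0, hg0, g1, hg1, rfl⟩ := Submodule.mem_sup.1 hg
    have h00 := V.homGr_mul hf0 hg0
    have h01 := V.homGr_mul hf0 hg1
    have h10 := V.homGr_mul hf1 hg0
    have h11 := V.homGr_mul hf1 hg1
    simp only [add_zero, zero_add, show (1 : ZMod 2) + 1 = 0 from rfl] at h00 h01 h10 h11
    simp only [add_mul, mul_add]
    exact add_mem (add_mem (Submodule.mem_sup_left h00) (Submodule.mem_sup_right h10))
      (add_mem (Submodule.mem_sup_right h01) (Submodule.mem_sup_left h11)))

/-- The grading of `End·_A(V)`, with degree `α` part `Hom^α_A(V, V)`. -/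
def superEndGr (V : SuperModule.{u, v} 𝒜) (α : ZMod 2) : Submodule ℂ V.superEnd :=
  (homGr V V α).comap V.superEnd.val.toLinearMap

instance instGradedEnd (V : SuperModule.{u, v} 𝒜) : GradedAlgebra V.superEndGr :=
  mkGradedAlgebra _
    (by
      constructor
      · rw [Submodule.disjoint_def]
        rintro ⟨f, hf⟩ (h0 : f ∈ homGr V V 0) (h1 : f ∈ homGr V V 1)
        apply Subtype.ext
        refine LinearMap.ext fun x => ?_
        have hh : ∀ β, ∀ y ∈ V.gr β, f y = 0 := by
          intro β y hy
          have a0 := h0.1 β y hy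
          have a1 := h1.1 β y hy
          have d := Submodule.disjoint_def.1 V.isCompl.disjoint (f y)
          rcases zmod2_cases β with rfl | rfl
          · exact d (by simpa using a0) (by simpa using a1)
          · exact d (by simpa [show (1 : ZMod 2) + 1 = 0 from rfl] using a1) (by simpa using a0)
        obtain ⟨y, hy, z, hz, rfl⟩ := exists_add V.isCompl x
        change f (y + z) = 0
        rw [map_add, hh 0 y hy, hh 1 z hz, add_zero]
      · rw [codisjoint_iff, eq_top_iff]
        rintro ⟨f, hf⟩ -
        obtain ⟨f0, hf0, f1, hf1, rfl⟩ := Submodule.mem_sup.1 (show f ∈ superHom V V from hf)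
        exact Submodule.mem_sup.2 ⟨⟨f0, Submodule.mem_sup_left hf0⟩, hf0,
          ⟨f1, Submodule.mem_sup_right hf1⟩, hf1, rfl⟩)
    V.homGr_one (fun _ _ _ _ hf hg => V.homGr_mul hf hg)

/-! #### Submodules, simple and semisimple modules -/

/-- `N` is an `A`-submodule of `V`: a graded subspace stable under `ρ(A)`. -/
structure IsSubmodule (V : SuperModule.{u, v} 𝒜) (N : Submodule ℂ V.carrier) : Prop where
  graded : N ≤ (N ⊓ V.gr 0) ⊔ (N ⊓ V.gr 1)
  stable : ∀ a, ∀ x ∈ N, V.ρ a x ∈ N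

/-- An `A`-submodule, as an `A`-module. -/
def restrict (V : SuperModule.{u, v} 𝒜) (N : Submodule ℂ V.carrier) (hN : V.IsSubmodule N) :
    SuperModule.{u, v} 𝒜 where
  carrier := N
  gr i := (V.gr i).comap N.subtype
  isCompl := by
    constructor
    · rw [Submodule.disjoint_def]
      rintro x h0 h1
      exact Subtype.ext (Submodule.disjoint_def.1 V.isCompl.disjoint x.1 h0 h1)
    · rw [codisjoint_iff, eq_top_iff]
      rintro ⟨x, hx⟩ -
      obtain ⟨y, hy, z, hz, rfl⟩ := Submodule.mem_sup.1 (hN.graded hx)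
      exact Submodule.mem_sup.2 ⟨⟨y, hy.1⟩, hy.2, ⟨z, hz.1⟩, hz.2, rfl⟩
  ρ := AlgHom.ofLinearMap
    { toFun := fun a => (V.ρ a).restrict (hN.stable a)
      map_add' := fun a b => by ext x; simp
      map_smul' := fun c a => by ext x; simp }
    (by ext x; simp)
    (fun a b => by ext x; simp)
  ρ_mem := fun i j a x ha hx => V.ρ_mem i j a x.1 ha hx

/-- `V` is simple: it is nonzero and has no `A`-submodules except itself and `0`. -/
def IsSimple (V : SuperModule.{u, v} 𝒜) : Prop :=
  Nontrivial V.carrier ∧ ∀ N : Submodule ℂ V.carrier, V.IsSubmodule N → N = ⊥ ∨ N = ⊤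

/-- `N` is a simple `A`-submodule of `V`. -/
def IsSimpleSubmodule (V : SuperModule.{u, v} 𝒜) (N : Submodule ℂ V.carrier) : Prop :=
  ∃ hN : V.IsSubmodule N, (V.restrict N hN).IsSimple

/-- `V` is semisimple: it is a sum of simple `A`-submodules. -/
def IsSemisimple (V : SuperModule.{u, v} 𝒜) : Prop :=
  ⨆ (N : Submodule ℂ V.carrier) (_ : V.IsSimpleSubmodule N), N = ⊤

/-- A simple module is of type `M` if its supercentralizer is isomorphic to `M(1,0)`. -/
def IsTypeM (V : SuperModule.{u, v} 𝒜) : Prop :=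
  V.IsSimple ∧ SuperalgebraIso V.superEndGr (matGr 1 0)

/-- A simple module is of type `Q` if its supercentralizer is isomorphic to `Q(1)`. -/
def IsTypeQ (V : SuperModule.{u, v} 𝒜) : Prop :=
  V.IsSimple ∧ SuperalgebraIso V.superEndGr (matQGr 1)

/-- The `A`-homogeneous component of `V` at the submodule `U` (meant for simple `U`): the sum of
all simple `A`-submodules of `V` that are isomorphic to `U`. -/
def homogeneousComponent (V : SuperModule.{u, v} 𝒜) (U : Submodule ℂ V.carrier)
    (hU : V.IsSubmodule U) : Submodule ℂ V.carrier :=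
  ⨆ (N : Submodule ℂ V.carrier) (_ : ∃ hN : V.IsSubmodule N,
    (V.restrict N hN).IsSimple ∧ Iso (V.restrict N hN) (V.restrict U hU)), N

/-- The set of `A`-homogeneous components of `V`. -/
def homogeneousComponents (V : SuperModule.{u, v} 𝒜) : Set (Submodule ℂ V.carrier) :=
  {N | ∃ (U : Submodule ℂ V.carrier) (hU : V.IsSubmodule U),
    (V.restrict U hU).IsSimple ∧ N = V.homogeneousComponent U hU}

/-- `X` is a simple `A`-module appearing in `V`, that is, isomorphic to a submodule of `V`. -/
def SimpleAppears (V : SuperModule.{u, v} 𝒜) (X : SuperModule.{u, v} 𝒜) : Prop :=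
  X.IsSimple ∧ ∃ (N : Submodule ℂ V.carrier) (hN : V.IsSubmodule N), Iso X (V.restrict N hN)

/-- The isomorphism classes (with respect to `≅_A`) of simple `A`-modules appearing in `V`. -/
def IrrIn (V : SuperModule.{u, v} 𝒜) : Type (max u (v + 1)) :=
  Quot fun X Y : {X : SuperModule.{u, v} 𝒜 // V.SimpleAppears X} => Iso X.1 Y.1

/-- The isomorphism class of a simple `A`-module appearing in `V`. -/
def irrClass (V : SuperModule.{u, v} 𝒜) (X : SuperModule.{u, v} 𝒜) (hX : V.SimpleAppears X) :
    V.IrrIn :=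
  Quot.mk _ ⟨X, hX⟩

/-! #### The shift and direct sums -/

/-- The shift of `V`: the same space with the switched grading, and `a ∈ A_α` acting by
`(-1)^α ρ(a)`. -/
def shift (V : SuperModule.{u, v} 𝒜) : SuperModule.{u, v} 𝒜 where
  carrier := V.carrier
  gr i := V.gr (i + 1)
  isCompl := by
    simpa [show (1 : ZMod 2) + 1 = 0 from rfl] using V.isCompl.symm
  ρ := V.ρ.comp (parityAut 𝒜)
  ρ_mem := fun i j a x ha hx => by
    rw [AlgHom.comp_apply, parityAut_of_mem 𝒜 ha, Units.smul_def, map_zsmul, LinearMap.smul_apply,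
      add_assoc]
    exact zsmul_mem (V.ρ_mem i (j + 1) a x ha hx) _

/-- The direct sum `V ⊕ W`. -/
def directSum (V : SuperModule.{u, v} 𝒜) (W : SuperModule.{u, w} 𝒜) :
    SuperModule.{u, max v w} 𝒜 where
  carrier := V.carrier × W.carrier
  gr i := (V.gr i).prod (W.gr i)
  isCompl := by
    constructor
    · rw [Submodule.disjoint_def]
      rintro ⟨x, y⟩ h0 h1
      exact Prod.ext (Submodule.disjoint_def.1 V.isCompl.disjoint x h0.1 h1.1)
        (Submodule.disjoint_def.1 W.isCompl.disjoint y h0.2 h1.2)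
    · rw [codisjoint_iff, Submodule.prod_sup_prod, V.isCompl.sup_eq_top, W.isCompl.sup_eq_top,
        Submodule.prod_top]
  ρ := AlgHom.ofLinearMap
    { toFun := fun a => (V.ρ a).prodMap (W.ρ a)
      map_add' := fun a b => by ext x <;> simp
      map_smul' := fun c a => by ext x <;> simp }
    (by ext x <;> simp)
    (fun a b => by ext x <;> simp)
  ρ_mem := fun i j a x ha hx => ⟨V.ρ_mem i j a x.1 ha hx.1, W.ρ_mem i j a x.2 ha hx.2⟩

/-! #### The supertensor product of modules -/

variable {B : Type w} [Ring B] [Algebra ℂ B] {ℬ : ZMod 2 → Submodule ℂ B} [GradedAlgebra ℬ]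

/-- The action of `a` on `U ⊗ W` by `u ⊗ w ↦ a u ⊗ w`. -/
def leftAction (U : SuperModule.{u, v} 𝒜) (W : SuperModule.{w, v} ℬ) :
    A →ₐ[ℂ] Module.End ℂ (U.carrier ⊗[ℂ] W.carrier) :=
  AlgHom.ofLinearMap
    { toFun := fun a => TensorProduct.map (U.ρ a) LinearMap.id
      map_add' := fun a b => by rw [map_add, TensorProduct.map_add_left]
      map_smul' := fun c a => by rw [map_smul, TensorProduct.map_smul_left]; rfl }
    (TensorProduct.ext' fun x y => by simp)
    (fun a b => TensorProduct.ext' fun x y => by simp)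

theorem leftAction_tmul (U : SuperModule.{u, v} 𝒜) (W : SuperModule.{w, v} ℬ) (a : A)
    (x : U.carrier) (y : W.carrier) : leftAction U W a (x ⊗ₜ y) = U.ρ a x ⊗ₜ y := rfl

theorem hom_ext_gr (U : SuperModule.{u, v} 𝒜) {W : Type v} [AddCommGroup W] [Module ℂ W]
    {X : Type v} [AddCommGroup X] [Module ℂ X] {f g : U.carrier ⊗[ℂ] W →ₗ[ℂ] X}
    (h : ∀ i, ∀ x ∈ U.gr i, ∀ y, f (x ⊗ₜ y) = g (x ⊗ₜ y)) : f = g := by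
  refine TensorProduct.ext' fun x y => ?_
  obtain ⟨x0, hx0, x1, hx1, rfl⟩ := exists_add U.isCompl x
  rw [TensorProduct.add_tmul, map_add, map_add, h 0 x0 hx0, h 1 x1 hx1]

/-- The linear map underlying the action of `b` on `U ⊗ W`: `u ⊗ w ↦ u ⊗ b w` for `u` of degree
`0`, and `u ⊗ w ↦ u ⊗ (-1)^β b w` for `u` of degree `1` and `b` of degree `β`. -/
def rightActionAux (U : SuperModule.{u, v} 𝒜) (W : SuperModule.{w, v} ℬ) :
    B →ₗ[ℂ] Module.End ℂ (U.carrier ⊗[ℂ] W.carrier) where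
  toFun := fun b => TensorProduct.map (comp U.isCompl 0) (W.ρ b) +
    TensorProduct.map (comp U.isCompl 1) (W.ρ (parityAut ℬ b))
  map_add' := fun a b => by
    simp only [map_add, TensorProduct.map_add_right]
    abel
  map_smul' := fun c a => by
    simp only [map_smul, TensorProduct.map_smul_right, smul_add, RingHom.id_apply]

theorem rightActionAux_of_mem (U : SuperModule.{u, v} 𝒜) (W : SuperModule.{w, v} ℬ) (b : B)
    {i : ZMod 2} {x : U.carrier} (hx : x ∈ U.gr i) (y : W.carrier) :
    rightActionAux U W b (x ⊗ₜ y) = x ⊗ₜ (if i = 0 then W.ρ b y else W.ρ (parityAut ℬ b) y) := by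
  rcases zmod2_cases i with rfl | rfl <;> simp [rightActionAux, comp_of_mem _ _ hx]

/-- The action of `b` on `U ⊗ W` by `u ⊗ w ↦ (-1)^(β α) u ⊗ b w` (`b ∈ B_β`, `u ∈ U_α`). -/
def rightAction (U : SuperModule.{u, v} 𝒜) (W : SuperModule.{w, v} ℬ) :
    B →ₐ[ℂ] Module.End ℂ (U.carrier ⊗[ℂ] W.carrier) :=
  AlgHom.ofLinearMap (rightActionAux U W)
    (U.hom_ext_gr fun i x hx y => by
      rw [rightActionAux_of_mem U W _ hx]
      simp)
    (fun a b => U.hom_ext_gr fun i x hx y => by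
      rw [rightActionAux_of_mem U W _ hx, Module.End.mul_apply, rightActionAux_of_mem U W _ hx,
        rightActionAux_of_mem U W _ hx]
      split_ifs <;> simp)

theorem rightAction_tmul (U : SuperModule.{u, v} 𝒜) (W : SuperModule.{w, v} ℬ) {β α : ZMod 2}
    {b : B} (hb : b ∈ ℬ β) {x : U.carrier} (hx : x ∈ U.gr α) (y : W.carrier) :
    rightAction U W b (x ⊗ₜ y) = (-1 : ℤˣ) ^ (β * α) • (x ⊗ₜ W.ρ b y) := by
  change rightActionAux U W b (x ⊗ₜ y) = _
  rw [rightActionAux_of_mem U W _ hx, parityAut_of_mem ℬ hb]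
  rcases zmod2_cases α with rfl | rfl <;> rcases zmod2_cases β with rfl | rfl <;>
    simp [TensorProduct.tmul_neg]

/-- The supertensor product of an `A`-module and a `B`-module, with
`(a ⊗ b)(u ⊗ w) = (-1)^(β α) a u ⊗ b w` for `b ∈ B_β` and `u ∈ U_α`. -/
def superTensor (U : SuperModule.{u, v} 𝒜) (W : SuperModule.{w, v} ℬ) :
    SuperModule.{max u w, v} (superTensorGr 𝒜 ℬ) where
  carrier := U.carrier ⊗[ℂ] W.carrier
  gr := tensorGr U.gr W.gr
  isCompl := isCompl_tensorGr U.isCompl W.isCompl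
  ρ := GradedTensorProduct.lift 𝒜 ℬ (leftAction U W) (rightAction U W) (fun i j a b => by
    refine U.hom_ext_gr fun k x hx y => ?_
    rw [Units.smul_def, LinearMap.smul_apply, ← Units.smul_def, Module.End.mul_apply,
      Module.End.mul_apply, leftAction_tmul, rightAction_tmul U W b.2 hx,
      rightAction_tmul U W b.2 (U.ρ_mem i k a x a.2 hx), Units.smul_def, map_zsmul,
      leftAction_tmul, ← Units.smul_def, smul_smul, ← uzpow_add, mul_add, ← add_assoc]
    simp [CharTwo.add_self_eq_zero])
  ρ_mem := by
    rintro i j _ t ⟨s, hs, rfl⟩ ht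
    let L := GradedTensorProduct.lift 𝒜 ℬ (leftAction U W) (rightAction U W) (fun i j a b => by
      refine U.hom_ext_gr fun k x hx y => ?_
      rw [Units.smul_def, LinearMap.smul_apply, ← Units.smul_def, Module.End.mul_apply,
        Module.End.mul_apply, leftAction_tmul, rightAction_tmul U W b.2 hx,
        rightAction_tmul U W b.2 (U.ρ_mem i k a x a.2 hx), Units.smul_def, map_zsmul,
        leftAction_tmul, ← Units.smul_def, smul_smul, ← uzpow_add, mul_add, ← add_assoc]
      simp [CharTwo.add_self_eq_zero])
    let F : (A ⊗[ℂ] B) →ₗ[ℂ] Module.End ℂ (U.carrier ⊗[ℂ] W.carrier) :=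
      L.toLinearMap ∘ₗ (GradedTensorProduct.of ℂ 𝒜 ℬ).toLinearMap
    change F s t ∈ tensorGr U.gr W.gr (i + j)
    have hs' : tensorGr 𝒜 ℬ i ≤ (tensorGr U.gr W.gr (i + j)).comap (F.flip t) := by
      refine tensorGr_le fun k l a b e ha hb => ?_
      change F (a ⊗ₜ b) t ∈ tensorGr U.gr W.gr (i + j)
      have ht' : tensorGr U.gr W.gr j ≤
          (tensorGr U.gr W.gr (i + j)).comap (F (a ⊗ₜ b)) := by
        refine tensorGr_le fun k' l' x y e' hx hy => ?_
        change leftAction U W a (rightAction U W b (x ⊗ₜ y)) ∈ tensorGr U.gr W.gr (i + j)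
        rw [rightAction_tmul U W hb hx, Units.smul_def, map_zsmul, leftAction_tmul]
        refine zsmul_mem ?_ _
        have h := tmul_mem_tensorGr (U.ρ_mem _ _ a x ha hx) (W.ρ_mem _ _ b y hb hy)
        rwa [show k + k' + (l + l') = i + j by rw [← e, ← e']; ring] at h
      exact ht' ht
    exact hs' hs

theorem superTensor_tmul (U : SuperModule.{u, v} 𝒜) (W : SuperModule.{w, v} ℬ) {β α : ZMod 2}
    (a : A) {b : B} (hb : b ∈ ℬ β) {x : U.carrier} (hx : x ∈ U.gr α) (y : W.carrier) :
    (superTensor U W).ρ (GradedTensorProduct.tmul ℂ a b) (x ⊗ₜ[ℂ] y : U.carrier ⊗[ℂ] W.carrier) =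
      (-1 : ℤˣ) ^ (β * α) • (U.ρ a x ⊗ₜ[ℂ] W.ρ b y : U.carrier ⊗[ℂ] W.carrier) := by
  change leftAction U W a (rightAction U W b (x ⊗ₜ y)) = _
  rw [rightAction_tmul U W hb hx, Units.smul_def, map_zsmul, leftAction_tmul, ← Units.smul_def]

/-! #### The regular module, and `V` as a module over `B = End·_A(V)` and over `A ⊗ B` -/

/-- The regular `A`-module. -/
def regular (𝒜 : ZMod 2 → Submodule ℂ A) [GradedAlgebra 𝒜] [FiniteDimensional ℂ A] :
    SuperModule.{u, u} 𝒜 where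
  carrier := A
  gr := 𝒜
  isCompl := isCompl_gr 𝒜
  ρ := Algebra.lmul ℂ A
  ρ_mem := fun _ _ _ _ ha hx => SetLike.GradedMul.mul_mem ha hx

/-- `V` as a module over `B = End·_A(V)`, acting tautologically. -/
def overEnd (V : SuperModule.{u, v} 𝒜) : SuperModule.{v, v} V.superEndGr where
  carrier := V.carrier
  gr := V.gr
  isCompl := V.isCompl
  ρ := V.superEnd.val
  ρ_mem := fun _ _ _ _ hf hx => hf.1 _ _ hx

/-- `V` as a module over the supertensor product of `A` and `B = End·_A(V)`, with
`a ⊗ b` acting as `ρ(a) ∘ b`. -/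
def overTensorEnd (V : SuperModule.{u, v} 𝒜) :
    SuperModule.{max u v, v} (superTensorGr 𝒜 V.superEndGr) where
  carrier := V.carrier
  gr := V.gr
  isCompl := V.isCompl
  ρ := GradedTensorProduct.lift 𝒜 V.superEndGr V.ρ V.superEnd.val (fun i j a b => by
    refine LinearMap.ext fun x => ?_
    have h : b.1.1 (V.ρ a x) = (-1 : ℤˣ) ^ (j * i) • V.ρ a (b.1.1 x) := b.2.2 i a a.2 x
    change V.ρ a (b.1.1 x) = _
    rw [Units.smul_def, LinearMap.smul_apply, ← Units.smul_def]
    change _ = (-1 : ℤˣ) ^ (j * i) • b.1.1 (V.ρ a x)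
    rw [h, smul_smul, Int.units_mul_self, one_smul])
  ρ_mem := by
    rintro i j _ t ⟨s, hs, rfl⟩ ht
    let F : (A ⊗[ℂ] V.superEnd) →ₗ[ℂ] Module.End ℂ V.carrier :=
      LinearMap.mul' ℂ _ ∘ₗ TensorProduct.map V.ρ.toLinearMap V.superEnd.val.toLinearMap
    change F s t ∈ V.gr (i + j)
    have hs' : tensorGr 𝒜 V.superEndGr i ≤ (V.gr (i + j)).comap (F.flip t) := by
      refine tensorGr_le fun k l a b e ha hb => ?_
      change V.ρ a (b.1 t) ∈ V.gr (i + j)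
      rw [← e, add_assoc]
      exact V.ρ_mem _ _ _ _ ha (hb.1 _ _ ht)
    exact hs' hs

theorem overTensorEnd_tmul (V : SuperModule.{u, v} 𝒜) (a : A) (b : V.superEnd) :
    V.overTensorEnd.ρ (GradedTensorProduct.tmul ℂ a b) = V.ρ a ∘ₗ b.1 := rfl

end SuperModule

/-- A superalgebra is semisimple if its regular module is semisimple. -/
def IsSemisimpleSuperalgebra {A : Type u} [Ring A] [Algebra ℂ A] [FiniteDimensional ℂ A]
    (𝒜 : ZMod 2 → Submodule ℂ A) [GradedAlgebra 𝒜] : Prop :=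
  (SuperModule.regular 𝒜).IsSemisimple

end Super

end

universe x

noncomputable section

namespace Super

/-! ### Gradings seen through the parity involution. -/

section Grading

variable {V : Type v} [AddCommGroup V] [Module ℂ V] {G : ZMod 2 → Submodule ℂ V}
  {W : Type w} [AddCommGroup W] [Module ℂ W] {H : ZMod 2 → Submodule ℂ W}

/-! Semisimplicity of `A` is used once: a homogeneous vector of $V$ is the image of $1$ under a
homogeneous map from the regular module, and such maps send simple submodules to zero or to simple
ones, so $V$ is a sum of simple submodules. Everything after that is Schur's lemma and splitting.
The main tool is `IsSemisimple.exists_extension`: if $s:X\to V$ is nonzero with $X$ simple, every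
homogeneous $f:X\to Y$ is $b\circ s$ for some homogeneous $b:V\to Y$. Taking $Y=V$, the algebra $B$
moves any copy of $X$ in $V$ onto any other.

Fix a simple $X$ appearing in $V$ and let $C$ be the sum of the images of all homogeneous maps $X\to
V$; this is a homogeneous component. By transitivity $C$ is simple over $A\mathbin{\dot\otimes}B$
and $W=\operatorname{Hom}^{\cdot}_A(X,V)$ is simple over $B$. An odd endomorphism $h$ of $C$ over
$A\mathbin{\dot\otimes}B$ would itself be the action of an odd element of $B$, so it would
anticommute with itself; then $h^2=0$ and $h=0$. Hence $C$ has type $M$.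

Evaluation $X\otimes W\to V$ has image $C$. To control its kernel, the double supercentralizer
property is applied to $X$ over $A\mathbin{\dot\otimes}\operatorname{End}^{\cdot}_A(X)$, where the
supercentralizer is $\mathbb C$: so $A$ and $\operatorname{End}^{\cdot}_A(X)$ together generate all
linear maps of $X$ (`IsSimple.range_overTensorEnd`). Consequently a tensor that evaluates to zero
after every endomorphism of $X$ is zero (`IsSimple.eq_zero_of_evalMap`). In type $M$ evaluation is
thus injective. In type $Q$, with odd involution $j$, the pair formed by evaluation and evaluation
after $j\otimes 1$ is injective into $C\oplus\overline C$, and it is onto because $C$ has no odd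
endomorphism (`prod_surjective`).

Different simple $X$, $Y$ give different $\operatorname{Hom}$ modules because the idempotent $s\circ
r\in B$ projecting onto a copy of $X$ fixes $s\in\operatorname{Hom}^{\cdot}_A(X,V)$ and kills
$\operatorname{Hom}^{\cdot}_A(Y,V)$. All simple $B$-modules in $V$ arise because evaluations at
vectors of the various $X$ cover $V$.

For $\operatorname{End}^{\cdot}_B(V)=\rho(A)$, let $\delta$ be the parity of $V$ and $c$ an ordinary
endomorphism commuting with $A$. Then $2c=(c+\delta c\delta)+(c\delta-\delta c)\delta$, where the
brackets are an even and an odd element of $B$. So whatever supercommutes with $B$ commutes with the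
ordinary commutant of $A$, and Jacobson density applies, $V$ being semisimple also without its
grading. -/

theorem one_add_one_zmod2 : (1 : ZMod 2) + 1 = 0 := rfl

theorem map_sign (f : V →ₗ[ℂ] W) (s : ℤˣ) (x : V) : f (s • x) = s • f x := by
  rw [Units.smul_def, map_zsmul, ← Units.smul_def]

theorem sign_smul_mem {N : Submodule ℂ V} (s : ℤˣ) {x : V} (hx : x ∈ N) : s • x ∈ N := by
  rw [Units.smul_def]
  exact zsmul_mem hx _

theorem eq_zero_of_eq_neg {x : V} (h : x = -x) : x = 0 := by
  have : (2 : ℂ) • x = 0 := by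
    rw [two_smul]
    nth_rewrite 1 [h]
    exact neg_add_cancel x
  exact (smul_eq_zero.1 this).resolve_left two_ne_zero

theorem eq_zero_of_mem_of_mem_add_one (h : IsCompl (G 0) (G 1)) {k : ZMod 2} {x : V}
    (h0 : x ∈ G k) (h1 : x ∈ G (k + 1)) : x = 0 := by
  rcases zmod2_cases k with rfl | rfl
  · exact Submodule.disjoint_def.1 h.disjoint x h0 (by simpa using h1)
  · exact Submodule.disjoint_def.1 h.disjoint x (by simpa [one_add_one_zmod2] using h1) h0

theorem comp_mem (h : IsCompl (G 0) (G 1)) (k : ZMod 2) (x : V) : comp h k x ∈ G k := by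
  obtain ⟨y, hy, z, hz, rfl⟩ := exists_add h x
  rw [map_add, comp_of_mem h k hy, comp_of_mem h k hz]
  rcases zmod2_cases k with rfl | rfl <;> simpa

theorem comp_zero_add_comp_one (h : IsCompl (G 0) (G 1)) (x : V) :
    comp h 0 x + comp h 1 x = x := by
  obtain ⟨y, hy, z, hz, rfl⟩ := exists_add h x
  simp [comp_of_mem h _ hy, comp_of_mem h _ hz]

theorem parity_apply (h : IsCompl (G 0) (G 1)) (x : V) :
    parity h x = comp h 0 x - comp h 1 x := rfl

@[simp]
theorem parity_parity (h : IsCompl (G 0) (G 1)) (x : V) : parity h (parity h x) = x := by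
  obtain ⟨y, hy, z, hz, rfl⟩ := exists_add h x
  simp [parity_of_mem h hy, parity_of_mem h hz]

theorem parity_mem (h : IsCompl (G 0) (G 1)) {k : ZMod 2} {x : V} (hx : x ∈ G k) :
    parity h x ∈ G k := by
  rw [parity_of_mem h hx]
  exact sign_smul_mem _ hx

/-- Linear maps that agree on homogeneous vectors are equal. -/
theorem ext_homogeneous (h : IsCompl (G 0) (G 1)) {f g : V →ₗ[ℂ] W}
    (hfg : ∀ k, ∀ x ∈ G k, f x = g x) : f = g := by
  refine LinearMap.ext fun x => ?_
  obtain ⟨y, hy, z, hz, rfl⟩ := exists_add h x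
  rw [map_add, map_add, hfg 0 y hy, hfg 1 z hz]

/-- A linear map commuting or anticommuting with the parity is homogeneous. -/
theorem mem_gr_iff_parity (h : IsCompl (G 0) (G 1)) {k : ZMod 2} {x : V} :
    x ∈ G k ↔ parity h x = (-1 : ℤˣ) ^ k • x := by
  refine ⟨parity_of_mem h, fun hx => ?_⟩
  obtain ⟨y, hy, z, hz, rfl⟩ := exists_add h x
  rw [map_add, parity_of_mem h hy, parity_of_mem h hz] at hx
  rcases zmod2_cases k with rfl | rfl
  · have : z = 0 := eq_zero_of_eq_neg (by simpa using hx.symm)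
    simpa [this] using hy
  · have : y = 0 := eq_zero_of_eq_neg (by simpa using hx)
    simpa [this] using hz

/-- A graded subspace contains the homogeneous components of its elements. -/
theorem comp_mem_of_graded (h : IsCompl (G 0) (G 1)) {N : Submodule ℂ V}
    (hN : N ≤ (N ⊓ G 0) ⊔ (N ⊓ G 1)) (k : ZMod 2) {x : V} (hx : x ∈ N) : comp h k x ∈ N := by
  obtain ⟨y, hy, z, hz, rfl⟩ := Submodule.mem_sup.1 (hN hx)
  rw [map_add, comp_of_mem h _ hy.2, comp_of_mem h _ hz.2]
  rcases zmod2_cases k with rfl | rfl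
  · simpa using hy.1
  · simpa using hz.1

/-- The homogeneous components of $x$ are $(x\pm\delta x)/2$, where $\delta$ is the parity. This
turns gradedness of a subspace into stability under one linear map, which passes easily to sums,
intersections, images and preimages. -/
theorem graded_of_parity_mem (h : IsCompl (G 0) (G 1)) {N : Submodule ℂ V}
    (hN : ∀ x ∈ N, parity h x ∈ N) : N ≤ (N ⊓ G 0) ⊔ (N ⊓ G 1) := by
  intro x hx
  have e := comp_zero_add_comp_one h x
  have hp := hN x hx
  have e0 : comp h 0 x = (2⁻¹ : ℂ) • (x + parity h x) := by
    rw [parity_apply]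
    nth_rewrite 2 [← e]
    module
  have e1 : comp h 1 x = (2⁻¹ : ℂ) • (x - parity h x) := by
    rw [parity_apply]
    nth_rewrite 2 [← e]
    module
  refine Submodule.mem_sup.2 ⟨_, ⟨?_, comp_mem h 0 x⟩, _, ⟨?_, comp_mem h 1 x⟩, e⟩
  · rw [e0]
    exact N.smul_mem _ (add_mem hx hp)
  · rw [e1]
    exact N.smul_mem _ (sub_mem hx hp)

end Grading

namespace SuperModule

variable {A : Type u} [Ring A] [Algebra ℂ A] {𝒜 : ZMod 2 → Submodule ℂ A} [GradedAlgebra 𝒜]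

/-! ### Homogeneous homomorphisms and graded submodules. -/

section Calculus

variable {X : SuperModule.{u, v} 𝒜} {Y : SuperModule.{u, w} 𝒜} {Z : SuperModule.{u, x} 𝒜}

theorem ρ_parity (X : SuperModule.{u, v} 𝒜) (a : A) (x : X.carrier) :
    parity X.isCompl (X.ρ a x) = X.ρ (parityAut 𝒜 a) (parity X.isCompl x) := by
  obtain ⟨b, hb, c, hc, rfl⟩ := exists_add (isCompl_gr 𝒜) a
  obtain ⟨y, hy, z, hz, rfl⟩ := exists_add X.isCompl x
  simp only [map_add, LinearMap.add_apply, parityAut_of_mem 𝒜 hb, parityAut_of_mem 𝒜 hc,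
    parity_of_mem _ hy, parity_of_mem _ hz, parity_of_mem _ (X.ρ_mem _ _ _ _ hb hy),
    parity_of_mem _ (X.ρ_mem _ _ _ _ hb hz), parity_of_mem _ (X.ρ_mem _ _ _ _ hc hy),
    parity_of_mem _ (X.ρ_mem _ _ _ _ hc hz)]
  simp [one_add_one_zmod2]

theorem homGr_comp {i j : ZMod 2} {f : X.carrier →ₗ[ℂ] Y.carrier}
    {g : Y.carrier →ₗ[ℂ] Z.carrier} (hg : g ∈ homGr Y Z i) (hf : f ∈ homGr X Y j) :
    g ∘ₗ f ∈ homGr X Z (i + j) := by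
  refine ⟨fun β x hx => ?_, fun β a ha x => ?_⟩
  · rw [add_assoc]
    exact hg.1 _ _ (hf.1 _ _ hx)
  · rw [LinearMap.comp_apply, hf.2 β a ha x, map_sign, hg.2 β a ha, smul_smul, ← uzpow_add,
      add_mul, add_comm]
    rfl

theorem homGr_parity {i : ZMod 2} {f : X.carrier →ₗ[ℂ] Y.carrier} (hf : f ∈ homGr X Y i)
    (x : X.carrier) :
    f (parity X.isCompl x) = (-1 : ℤˣ) ^ i • parity Y.isCompl (f x) := by
  obtain ⟨y, hy, z, hz, rfl⟩ := exists_add X.isCompl x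
  simp only [map_add, parity_of_mem _ hy, parity_of_mem _ hz, parity_of_mem _ (hf.1 _ _ hy),
    parity_of_mem _ (hf.1 _ _ hz)]
  rcases zmod2_cases i with rfl | rfl <;> simp [one_add_one_zmod2]

theorem homGr_symm {i : ZMod 2} {f : X.carrier ≃ₗ[ℂ] Y.carrier}
    (hf : (f : X.carrier →ₗ[ℂ] Y.carrier) ∈ homGr X Y i) :
    (f.symm : Y.carrier →ₗ[ℂ] X.carrier) ∈ homGr Y X i := by
  refine ⟨fun β y hy => ?_, fun β a ha y => ?_⟩
  · obtain ⟨x, rfl⟩ := f.surjective y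
    have h : f (parity X.isCompl x) = _ := homGr_parity hf x
    rw [LinearEquiv.coe_coe, parity_of_mem _ hy, smul_smul, ← uzpow_add] at h
    simp only [LinearEquiv.coe_coe, LinearEquiv.symm_apply_apply]
    rw [mem_gr_iff_parity X.isCompl]
    exact f.injective (h.trans (map_sign (f : X.carrier →ₗ[ℂ] Y.carrier) _ x).symm)
  · obtain ⟨x, rfl⟩ := f.surjective y
    apply f.injective
    have h : f (X.ρ a x) = (-1 : ℤˣ) ^ (i * β) • Y.ρ a (f x) := hf.2 β a ha x
    have h2 := map_sign (f : X.carrier →ₗ[ℂ] Y.carrier) ((-1 : ℤˣ) ^ (i * β)) (X.ρ a x)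
    simp only [LinearEquiv.coe_coe, LinearEquiv.symm_apply_apply, LinearEquiv.apply_symm_apply]
      at h2 ⊢
    rw [h2, h, smul_smul, Int.units_mul_self, one_smul]

/-- The sign rule is stated for homogeneous $a$ only. Absorbing the sign into the parity
automorphism gives an identity for every $a$ at once, which is what stability of images and
preimages requires. -/
theorem homGr_ρ {i : ZMod 2} {f : X.carrier →ₗ[ℂ] Y.carrier} (hf : f ∈ homGr X Y i) (a : A)
    (x : X.carrier) :
    f (X.ρ a x) = Y.ρ (if i = 0 then a else parityAut 𝒜 a) (f x) := by
  obtain ⟨b, hb, c, hc, rfl⟩ := exists_add (isCompl_gr 𝒜) a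
  rcases zmod2_cases i with rfl | rfl <;>
    simp [hf.2 _ b hb, hf.2 _ c hc, parityAut_of_mem 𝒜 hb, parityAut_of_mem 𝒜 hc]

theorem homGr_ρ' {i : ZMod 2} {f : X.carrier →ₗ[ℂ] Y.carrier} (hf : f ∈ homGr X Y i) (a : A)
    (x : X.carrier) :
    Y.ρ a (f x) = f (X.ρ (if i = 0 then a else parityAut 𝒜 a) x) := by
  obtain ⟨b, hb, c, hc, rfl⟩ := exists_add (isCompl_gr 𝒜) a
  rcases zmod2_cases i with rfl | rfl <;>
    simp [hf.2 _ b hb, hf.2 _ c hc, parityAut_of_mem 𝒜 hb, parityAut_of_mem 𝒜 hc]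

theorem IsSubmodule.comp_mem {N : Submodule ℂ X.carrier} (hN : X.IsSubmodule N) (k : ZMod 2)
    {x : X.carrier} (hx : x ∈ N) : comp X.isCompl k x ∈ N :=
  comp_mem_of_graded X.isCompl hN.graded k hx

theorem IsSubmodule.parity_mem {N : Submodule ℂ X.carrier} (hN : X.IsSubmodule N)
    {x : X.carrier} (hx : x ∈ N) : parity X.isCompl x ∈ N :=
  sub_mem (hN.comp_mem 0 hx) (hN.comp_mem 1 hx)

theorem isSubmodule_of_parity {N : Submodule ℂ X.carrier}
    (h1 : ∀ x ∈ N, parity X.isCompl x ∈ N) (h2 : ∀ a, ∀ x ∈ N, X.ρ a x ∈ N) : X.IsSubmodule N :=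
  ⟨graded_of_parity_mem X.isCompl h1, h2⟩

theorem IsSubmodule.exists_homogeneous {N : Submodule ℂ X.carrier} (hN : X.IsSubmodule N)
    (h : N ≠ ⊥) : ∃ k, ∃ x ∈ N, x ∈ X.gr k ∧ x ≠ 0 := by
  obtain ⟨x, hx, h0⟩ := N.ne_bot_iff.1 h
  have e := comp_zero_add_comp_one X.isCompl x
  by_cases h1 : comp X.isCompl 0 x = 0
  · refine ⟨1, _, hN.comp_mem 1 hx, Super.comp_mem _ _ _, fun h2 => h0 ?_⟩
    rw [← e, h1, h2, add_zero]
  · exact ⟨0, _, hN.comp_mem 0 hx, Super.comp_mem _ _ _, h1⟩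

theorem isSubmodule_bot (X : SuperModule.{u, v} 𝒜) : X.IsSubmodule ⊥ :=
  ⟨bot_le, fun a x hx => by simp_all⟩

theorem isSubmodule_top (X : SuperModule.{u, v} 𝒜) : X.IsSubmodule ⊤ :=
  ⟨by simp [X.isCompl.sup_eq_top], fun _ _ _ => Submodule.mem_top⟩

theorem IsSubmodule.inf {M N : Submodule ℂ X.carrier} (hM : X.IsSubmodule M)
    (hN : X.IsSubmodule N) : X.IsSubmodule (M ⊓ N) :=
  isSubmodule_of_parity (fun _ hx => ⟨hM.parity_mem hx.1, hN.parity_mem hx.2⟩)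
    (fun a _ hx => ⟨hM.stable a _ hx.1, hN.stable a _ hx.2⟩)

theorem isSubmodule_iSup {ι : Sort*} {N : ι → Submodule ℂ X.carrier}
    (hN : ∀ i, X.IsSubmodule (N i)) : X.IsSubmodule (⨆ i, N i) := by
  have key : ∀ f : X.carrier →ₗ[ℂ] X.carrier, (∀ i, ∀ x ∈ N i, f x ∈ N i) →
      ∀ x ∈ ⨆ i, N i, f x ∈ ⨆ i, N i := by
    intro f hf x hx
    have : ⨆ i, N i ≤ (⨆ i, N i).comap f :=
      iSup_le fun i x hx => le_iSup N i (hf i x hx)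
    exact this hx
  exact isSubmodule_of_parity (key _ fun i x hx => (hN i).parity_mem hx)
    fun a => key _ fun i x hx => (hN i).stable a x hx

theorem IsSubmodule.sup {M N : Submodule ℂ X.carrier} (hM : X.IsSubmodule M)
    (hN : X.IsSubmodule N) : X.IsSubmodule (M ⊔ N) := by
  rw [sup_eq_iSup]
  exact isSubmodule_iSup fun b => by cases b <;> assumption

theorem IsSubmodule.map {i : ZMod 2} {f : X.carrier →ₗ[ℂ] Y.carrier} (hf : f ∈ homGr X Y i)
    {N : Submodule ℂ X.carrier} (hN : X.IsSubmodule N) : Y.IsSubmodule (N.map f) := by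
  refine isSubmodule_of_parity ?_ ?_
  · rintro _ ⟨x, hx, rfl⟩
    refine ⟨(-1 : ℤˣ) ^ i • parity X.isCompl x, sign_smul_mem _ (hN.parity_mem hx), ?_⟩
    rw [map_sign, homGr_parity hf, smul_smul, Int.units_mul_self, one_smul]
  · rintro a _ ⟨x, hx, rfl⟩
    exact ⟨_, hN.stable _ x hx, (homGr_ρ' hf a x).symm⟩

theorem IsSubmodule.comap {i : ZMod 2} {f : X.carrier →ₗ[ℂ] Y.carrier} (hf : f ∈ homGr X Y i)
    {N : Submodule ℂ Y.carrier} (hN : Y.IsSubmodule N) : X.IsSubmodule (N.comap f) := by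
  refine isSubmodule_of_parity (fun x hx => ?_) (fun a x hx => ?_)
  · rw [Submodule.mem_comap, homGr_parity hf]
    exact sign_smul_mem _ (hN.parity_mem hx)
  · rw [Submodule.mem_comap, homGr_ρ hf]
    exact hN.stable _ _ hx

theorem isSubmodule_range {i : ZMod 2} {f : X.carrier →ₗ[ℂ] Y.carrier} (hf : f ∈ homGr X Y i) :
    Y.IsSubmodule (LinearMap.range f) := by
  rw [LinearMap.range_eq_map]
  exact X.isSubmodule_top.map hf

theorem isSubmodule_ker {i : ZMod 2} {f : X.carrier →ₗ[ℂ] Y.carrier} (hf : f ∈ homGr X Y i) :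
    X.IsSubmodule (LinearMap.ker f) := by
  rw [← Submodule.comap_bot]
  exact Y.isSubmodule_bot.comap hf

theorem subtype_mem_homGr {N : Submodule ℂ X.carrier} (hN : X.IsSubmodule N) :
    (N.subtype : (X.restrict N hN).carrier →ₗ[ℂ] X.carrier) ∈ homGr (X.restrict N hN) X 0 :=
  ⟨fun β x hx => by rw [zero_add]; exact hx, fun β a ha x => by simp; rfl⟩

theorem codRestrict_mem_homGr {N : Submodule ℂ Y.carrier} (hN : Y.IsSubmodule N) {i : ZMod 2}
    {f : X.carrier →ₗ[ℂ] Y.carrier} (hf : f ∈ homGr X Y i) (h : ∀ x, f x ∈ N) :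
    (f.codRestrict N h : X.carrier →ₗ[ℂ] (Y.restrict N hN).carrier) ∈
      homGr X (Y.restrict N hN) i := by
  refine ⟨fun β x hx => hf.1 β x hx, fun β a ha x => Subtype.ext ?_⟩
  have := hf.2 β a ha x
  refine this.trans ?_
  rw [Units.smul_def, Units.smul_def]
  rfl

theorem mem_homGr_of_codRestrict {N : Submodule ℂ Y.carrier} (hN : Y.IsSubmodule N) {i : ZMod 2}
    {f : X.carrier →ₗ[ℂ] (Y.restrict N hN).carrier}
    (hf : N.subtype ∘ₗ f ∈ homGr X Y i) : f ∈ homGr X (Y.restrict N hN) i :=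
  codRestrict_mem_homGr hN hf fun x => (f x).2

end Calculus

/-! ### Schur's lemma, complements and semisimplicity. -/

section Schur

variable {X : SuperModule.{u, v} 𝒜} {Y : SuperModule.{u, w} 𝒜} {Z : SuperModule.{u, x} 𝒜}

theorem injective_of_isSimple (hX : X.IsSimple) {i : ZMod 2} {f : X.carrier →ₗ[ℂ] Y.carrier}
    (hf : f ∈ homGr X Y i) (h0 : f ≠ 0) : Function.Injective f := by
  rcases hX.2 _ (isSubmodule_ker hf) with h | h
  · exact LinearMap.ker_eq_bot.1 h
  · exact absurd (LinearMap.ker_eq_top.1 h) h0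

theorem surjective_of_isSimple (hY : Y.IsSimple) {i : ZMod 2} {f : X.carrier →ₗ[ℂ] Y.carrier}
    (hf : f ∈ homGr X Y i) (h0 : f ≠ 0) : Function.Surjective f := by
  rcases hY.2 _ (isSubmodule_range hf) with h | h
  · exact absurd (LinearMap.range_eq_bot.1 h) h0
  · exact LinearMap.range_eq_top.1 h

/-- There is an invertible homogeneous homomorphism. -/
def HomogeneousIso (X : SuperModule.{u, v} 𝒜) (Y : SuperModule.{u, w} 𝒜) : Prop :=
  ∃ i, ∃ f : X.carrier ≃ₗ[ℂ] Y.carrier, (f : X.carrier →ₗ[ℂ] Y.carrier) ∈ homGr X Y i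

theorem HomogeneousIso.iso (h : HomogeneousIso X Y) : Iso X Y := by
  obtain ⟨i, f, hf⟩ := h
  rcases zmod2_cases i with rfl | rfl
  · exact ⟨f, Submodule.mem_sup_left hf⟩
  · exact ⟨f, Submodule.mem_sup_right hf⟩

theorem HomogeneousIso.refl (X : SuperModule.{u, v} 𝒜) : HomogeneousIso X X :=
  ⟨0, LinearEquiv.refl _ _, X.homGr_one⟩

theorem HomogeneousIso.symm (h : HomogeneousIso X Y) : HomogeneousIso Y X := by
  obtain ⟨i, f, hf⟩ := h
  exact ⟨i, f.symm, homGr_symm hf⟩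

theorem HomogeneousIso.trans (h : HomogeneousIso X Y) (h' : HomogeneousIso Y Z) :
    HomogeneousIso X Z := by
  obtain ⟨i, f, hf⟩ := h
  obtain ⟨j, g, hg⟩ := h'
  exact ⟨j + i, f.trans g, homGr_comp hg hf⟩

theorem StrictIso.symm (h : StrictIso X Y) : StrictIso Y X := by
  obtain ⟨f, hf⟩ := h
  exact ⟨f.symm, homGr_symm hf⟩

theorem StrictIso.trans (h : StrictIso X Y) (h' : StrictIso Y Z) : StrictIso X Z := by
  obtain ⟨f, hf⟩ := h
  obtain ⟨g, hg⟩ := h'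
  exact ⟨f.trans g, by simpa using homGr_comp hg hf⟩

/-- Schur's lemma: nonzero homogeneous homomorphisms of simple modules are invertible. -/
theorem homogeneousIso_of_ne_zero (hX : X.IsSimple) (hY : Y.IsSimple) {i : ZMod 2}
    {f : X.carrier →ₗ[ℂ] Y.carrier} (hf : f ∈ homGr X Y i) (h0 : f ≠ 0) : HomogeneousIso X Y :=
  ⟨i, LinearEquiv.ofBijective f ⟨injective_of_isSimple hX hf h0, surjective_of_isSimple hY hf h0⟩,
    hf⟩

/-- One of the two homogeneous components of an invertible map is nonzero, hence injective by Schur,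
hence bijective since the given map already forces equal dimensions. From here on only homogeneous
isomorphisms are handled. -/
theorem Iso.homogeneousIso (h : Iso X Y) (hX : X.IsSimple) : HomogeneousIso X Y := by
  obtain ⟨f, hf⟩ := h
  obtain ⟨f0, hf0, f1, hf1, e⟩ := Submodule.mem_sup.1 hf
  have key : ∀ i, ∀ g ∈ homGr X Y i, g ≠ 0 → HomogeneousIso X Y := by
    intro i g hg h0
    have hi := injective_of_isSimple hX hg h0
    exact ⟨i, LinearEquiv.ofBijective g
      ⟨hi, (LinearMap.injective_iff_surjective_of_finrank_eq_finrank f.finrank_eq).1 hi⟩, hg⟩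
  by_cases h0 : f0 = 0
  · by_cases h1 : f1 = 0
    · rw [h0, h1, add_zero] at e
      have := hX.1
      obtain ⟨x, hx⟩ := exists_ne (0 : X.carrier)
      refine absurd (f.injective ?_) hx
      rw [map_zero]
      exact (LinearMap.congr_fun e x).symm
    · exact key _ f1 hf1 h1
  · exact key _ f0 hf0 h0

theorem HomogeneousIso.isSimple (h : HomogeneousIso X Y) (hX : X.IsSimple) : Y.IsSimple := by
  obtain ⟨i, f, hf⟩ := h
  refine ⟨f.toEquiv.nontrivial_congr.1 hX.1, fun N hN => ?_⟩
  have e : (N.comap (f : X.carrier →ₗ[ℂ] Y.carrier)).map (f : X.carrier →ₗ[ℂ] Y.carrier) = N :=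
    Submodule.map_comap_eq_of_surjective f.surjective N
  rcases hX.2 _ (hN.comap hf) with h | h
  · left
    rw [← e, h, Submodule.map_bot]
  · right
    rw [← e, h, Submodule.map_top]
    exact LinearMap.range_eq_top.2 f.surjective

theorem isSimpleSubmodule_iff {N : Submodule ℂ X.carrier} : X.IsSimpleSubmodule N ↔
    X.IsSubmodule N ∧ N ≠ ⊥ ∧ ∀ T ≤ N, X.IsSubmodule T → T = ⊥ ∨ T = N := by
  constructor
  · rintro ⟨hN, h1, h2⟩
    refine ⟨hN, (Submodule.nontrivial_iff_ne_bot (p := N)).1 h1, fun T hT hT' => ?_⟩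
    have e : (T.comap N.subtype).map N.subtype = T := by
      rw [Submodule.map_comap_subtype, inf_eq_right.2 hT]
    rcases h2 _ (hT'.comap (subtype_mem_homGr hN)) with h | h
    · left
      rw [← e]
      exact (congrArg _ h).trans (Submodule.map_bot _)
    · right
      rw [← e]
      exact (congrArg _ h).trans (Submodule.map_subtype_top N)
  · rintro ⟨hN, h1, h2⟩
    refine ⟨hN, (Submodule.nontrivial_iff_ne_bot (p := N)).2 h1, fun T hT => ?_⟩
    rcases h2 _ (Submodule.map_subtype_le N T) (hT.map (subtype_mem_homGr hN)) with h | h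
    · left
      exact Submodule.map_injective_of_injective N.subtype_injective (h.trans (Submodule.map_bot _).symm)
    · right
      refine eq_top_iff.2 fun x _ => ?_
      obtain ⟨y, hy, e⟩ := (h.ge x.2 : x.1 ∈ T.map N.subtype)
      rwa [← Subtype.ext e]

/-- Every nonzero submodule contains a simple one. -/
theorem IsSubmodule.exists_simple {N : Submodule ℂ X.carrier} (hN : X.IsSubmodule N)
    (h0 : N ≠ ⊥) : ∃ S ≤ N, X.IsSimpleSubmodule S := by
  obtain ⟨S, ⟨⟨hS, hS0⟩, hSN⟩, hmin⟩ := wellFounded_lt.has_min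
    {S : Submodule ℂ X.carrier | (X.IsSubmodule S ∧ S ≠ ⊥) ∧ S ≤ N} ⟨N, ⟨hN, h0⟩, le_rfl⟩
  refine ⟨S, hSN, isSimpleSubmodule_iff.2 ⟨hS, hS0, fun T hT hT' => ?_⟩⟩
  by_contra! h
  exact hmin T ⟨⟨hT', h.1⟩, hT.trans hSN⟩ (lt_of_le_of_ne hT h.2)

/-- Choose $M$ maximal among the submodules disjoint from $N$. A simple submodule outside $N+M$
would meet it in $0$ and could be added to $M$. -/
theorem IsSemisimple.exists_isCompl (hX : X.IsSemisimple) {N : Submodule ℂ X.carrier}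
    (hN : X.IsSubmodule N) : ∃ M, X.IsSubmodule M ∧ IsCompl N M := by
  obtain ⟨M, ⟨hM, hd⟩, hmax⟩ := wellFounded_gt.has_min
    {M : Submodule ℂ X.carrier | X.IsSubmodule M ∧ Disjoint N M} ⟨⊥, X.isSubmodule_bot, disjoint_bot_right⟩
  refine ⟨M, hM, hd, codisjoint_iff.2 (top_le_iff.1 ?_)⟩
  rw [← show _ = ⊤ from hX]
  refine iSup₂_le fun S hS => ?_
  by_contra hSN
  obtain ⟨hS1, hS0, hS2⟩ := isSimpleSubmodule_iff.1 hS
  have hd2 : Disjoint (N ⊔ M) S := by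
    rw [disjoint_iff]
    refine (hS2 _ inf_le_right ((hN.sup hM).inf hS1)).resolve_right fun h => hSN ?_
    exact inf_eq_right.1 h
  refine hmax (M ⊔ S) ⟨hM.sup hS1, hd.disjoint_sup_right_of_disjoint_sup_left hd2⟩ ?_
  refine lt_of_le_of_ne le_sup_left fun h => hSN ?_
  rw [h]
  exact le_sup_right.trans le_sup_right

/-- In a semisimple module, injective homogeneous homomorphisms split. -/
theorem IsSemisimple.exists_retraction (hY : Y.IsSemisimple) {i : ZMod 2}
    {s : X.carrier →ₗ[ℂ] Y.carrier} (hs : s ∈ homGr X Y i) (hi : Function.Injective s) :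
    ∃ r ∈ homGr Y X i, r ∘ₗ s = LinearMap.id := by
  have hN := isSubmodule_range hs
  obtain ⟨M, hM, hc⟩ := hY.exists_isCompl hN
  have hp : (Submodule.projectionOnto _ _ hc : Y.carrier →ₗ[ℂ] (Y.restrict _ hN).carrier) ∈
      homGr Y (Y.restrict _ hN) 0 := by
    -- A projection commutes with every map preserving both summands; taking that map to be the
    -- parity or `Y.ρ a` shows that the projection is even and $A$-linear.
    have key : ∀ f g : Y.carrier →ₗ[ℂ] Y.carrier,
        (∀ x ∈ LinearMap.range s, f x ∈ LinearMap.range s ∧ f x = g x) → (∀ x ∈ M, f x ∈ M) →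
        ∀ y, Submodule.projection _ _ hc (f y) = g (Submodule.projection _ _ hc y) := by
      intro f g h1 h2 y
      obtain ⟨n, hn, m, hm, rfl⟩ := Submodule.mem_sup.1
        (hc.sup_eq_top ▸ Submodule.mem_top : y ∈ LinearMap.range s ⊔ M)
      rw [map_add, map_add, map_add, Submodule.projection_apply_of_mem_left hc (h1 n hn).1,
        Submodule.projection_apply_of_mem_left hc hn,
        (Submodule.projection_apply_eq_zero_iff hc).2 hm,
        (Submodule.projection_apply_eq_zero_iff hc).2 (h2 m hm), (h1 n hn).2, add_zero, add_zero]
    refine mem_homGr_of_codRestrict hN ⟨fun β y hy => ?_, fun β a ha y => ?_⟩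
    · rw [zero_add, mem_gr_iff_parity Y.isCompl]
      have h := key (parity Y.isCompl) (parity Y.isCompl)
        (fun x hx => ⟨hN.parity_mem hx, rfl⟩) (fun x hx => hM.parity_mem hx) y
      rw [parity_of_mem _ hy, map_sign] at h
      exact h.symm
    · rw [zero_mul, uzpow_zero, one_smul]
      exact key (Y.ρ a) (Y.ρ a) (fun x hx => ⟨hN.stable a x hx, rfl⟩)
        (fun x hx => hM.stable a x hx) y
  let e' : X.carrier ≃ₗ[ℂ] (Y.restrict _ hN).carrier := LinearEquiv.ofInjective s hi
  have he : (e' :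
      X.carrier →ₗ[ℂ] (Y.restrict _ hN).carrier) ∈ homGr X (Y.restrict _ hN) i :=
    mem_homGr_of_codRestrict hN hs
  refine ⟨_, by simpa using homGr_comp (homGr_symm he) hp, ?_⟩
  refine LinearMap.ext fun x => ?_
  have e : Submodule.projectionOnto _ _ hc (s x) = LinearEquiv.ofInjective s hi x :=
    Submodule.projectionOnto_apply_left hc (LinearEquiv.ofInjective s hi x)
  change (LinearEquiv.ofInjective s hi).symm (Submodule.projectionOnto _ _ hc (s x)) = x
  rw [e, LinearEquiv.symm_apply_apply]

theorem isSemisimple_of_isSimple (hX : X.IsSimple) : X.IsSemisimple := by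
  have := hX.1
  refine top_le_iff.1 (le_iSup₂_of_le ⊤ (isSimpleSubmodule_iff.2
    ⟨X.isSubmodule_top, top_ne_bot, fun T _ hT => hX.2 T hT⟩) le_rfl)

theorem IsSimpleSubmodule.map {i : ZMod 2} {f : X.carrier →ₗ[ℂ] Y.carrier} (hf : f ∈ homGr X Y i)
    {S : Submodule ℂ X.carrier} (hS : X.IsSimpleSubmodule S) :
    S.map f = ⊥ ∨ Y.IsSimpleSubmodule (S.map f) := by
  obtain ⟨hS1, hS0, hS2⟩ := isSimpleSubmodule_iff.1 hS
  refine or_iff_not_imp_left.2 fun h0 =>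
    isSimpleSubmodule_iff.2 ⟨hS1.map hf, h0, fun T hT hT' => ?_⟩
  have e : (S ⊓ T.comap f).map f = T := by
    refine le_antisymm ?_ fun y hy => ?_
    · rintro _ ⟨x, hx, rfl⟩
      exact hx.2
    · obtain ⟨x, hx, rfl⟩ := hT hy
      exact ⟨x, ⟨hx, hy⟩, rfl⟩
  rcases hS2 _ inf_le_left (hS1.inf (hT'.comap hf)) with h | h
  · left
    rw [← e, h, Submodule.map_bot]
  · right
    rw [h] at e
    exact e.symm

theorem IsSemisimple.map_mem (hX : X.IsSemisimple) {i : ZMod 2}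
    {f : X.carrier →ₗ[ℂ] Y.carrier} (hf : f ∈ homGr X Y i) (x : X.carrier) :
    f x ∈ ⨆ (N : Submodule ℂ Y.carrier) (_ : Y.IsSimpleSubmodule N), N := by
  have h1 : ⨆ (N : Submodule ℂ X.carrier) (_ : X.IsSimpleSubmodule N), N ≤
      (⨆ (N : Submodule ℂ Y.carrier) (_ : Y.IsSimpleSubmodule N), N).comap f := by
    refine iSup₂_le fun S hS => ?_
    rw [← Submodule.map_le_iff_le_comap]
    rcases hS.map hf with h | h
    · rw [h]
      exact bot_le
    · exact le_iSup₂_of_le _ h le_rfl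
  rw [show _ = ⊤ from hX] at h1
  exact h1 trivial

end Schur

/-- Every module over a semisimple superalgebra is semisimple. -/
theorem isSemisimple_of_isSemisimpleSuperalgebra [FiniteDimensional ℂ A]
    (hA : IsSemisimpleSuperalgebra 𝒜) (V : SuperModule.{u, v} 𝒜) : V.IsSemisimple := by
  have key : ∀ k, ∀ x ∈ V.gr k,
      x ∈ ⨆ (N : Submodule ℂ V.carrier) (_ : V.IsSimpleSubmodule N), N := by
    intro k x hx
    -- For odd $x$ the map $a\mapsto ax$ violates the sign rule in degree $1$; the correct odd map
    -- is $a\mapsto(-1)^\alpha ax$. In both cases $1\mapsto x$.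
    let f : A →ₗ[ℂ] V.carrier := LinearMap.applyₗ x ∘ₗ V.ρ.toLinearMap ∘ₗ
      (if k = 0 then LinearMap.id else (parityAut 𝒜).toLinearMap)
    have hf0 : ∀ a, f a = V.ρ (if k = 0 then a else parityAut 𝒜 a) x := by
      intro a
      dsimp only [f]
      split_ifs <;> rfl
    have hdeg : ∀ β, ∀ a ∈ 𝒜 β, f a ∈ V.gr (k + β) := by
      intro β a ha
      rw [hf0, add_comm]
      refine V.ρ_mem _ _ _ _ ?_ hx
      split_ifs
      · exact ha
      · rw [parityAut_of_mem 𝒜 ha]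
        exact sign_smul_mem _ ha
    have hmul : ∀ β, ∀ a ∈ 𝒜 β, ∀ b, f (a * b) = (-1 : ℤˣ) ^ (k * β) • V.ρ a (f b) := by
      intro β a ha b
      rw [hf0, hf0]
      rcases zmod2_cases k with rfl | rfl
      · simp
      · simp [parityAut_of_mem 𝒜 ha, Units.smul_def]
    have hf : f ∈ homGr (regular 𝒜) V k := ⟨hdeg, hmul⟩
    have h1 : f 1 ∈ _ := hA.map_mem hf (1 : A)
    rw [hf0] at h1
    simpa using h1
  refine eq_top_iff.2 fun x _ => ?_
  obtain ⟨y, hy, z, hz, rfl⟩ := exists_add V.isCompl x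
  exact add_mem (key 0 y hy) (key 1 z hz)

/-! ### Endomorphisms of simple modules and the types $M$ and $Q$. -/

section Types

variable {X : SuperModule.{u, v} 𝒜}

/-- Subtracting an eigenvalue from an even endomorphism leaves an even endomorphism with nonzero
kernel, which Schur forces to vanish. -/
theorem exists_eq_smul_one (hX : X.IsSimple) {f : Module.End ℂ X.carrier}
    (hf : f ∈ homGr X X 0) : ∃ c : ℂ, f = c • 1 := by
  have := hX.1
  obtain ⟨c, hc⟩ := Module.End.exists_eigenvalue f
  obtain ⟨x, hx⟩ := hc.exists_hasEigenvector
  refine ⟨c, ?_⟩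
  by_contra h
  have h1 : f - c • (1 : Module.End ℂ X.carrier) ∈ homGr X X 0 :=
    sub_mem hf (Submodule.smul_mem _ c X.homGr_one)
  refine hx.2 (injective_of_isSimple hX h1 (sub_ne_zero.2 h) ?_)
  simp [hx.apply_eq_smul]

theorem eq_zero_of_mem_homGr_zero_one {f : Module.End ℂ X.carrier} (h0 : f ∈ homGr X X 0)
    (h1 : f ∈ homGr X X 1) : f = 0 := by
  refine ext_homogeneous X.isCompl fun k x hx => ?_
  refine eq_zero_of_mem_of_mem_add_one X.isCompl (k := k) ?_ ?_
  · simpa using h0.1 k x hx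
  · simpa [add_comm] using h1.1 k x hx

/-- Without odd endomorphisms the supercentralizer is $\mathbb C$, concentrated in degree $0$, and
so is $M(1,0)$; the isomorphism passes through $\mathbb C$. -/
theorem isTypeM_of_homGr_one (hX : X.IsSimple) (h : ∀ f ∈ homGr X X 1, f = 0) : X.IsTypeM := by
  refine ⟨hX, ?_⟩
  have := hX.1
  have hs : ∀ f ∈ X.superEnd, f ∈ homGr X X 0 := by
    intro f hf
    obtain ⟨f0, hf0, f1, hf1, rfl⟩ := Submodule.mem_sup.1 (show f ∈ superHom X X from hf)
    rwa [h f1 hf1, add_zero]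
  have hB : Function.Bijective (Algebra.ofId ℂ X.superEnd) := by
    refine ⟨(algebraMap ℂ X.superEnd).injective, ?_⟩
    rintro ⟨f, hf⟩
    obtain ⟨c, rfl⟩ := exists_eq_smul_one hX (hs f hf)
    exact ⟨c, Subtype.ext (Algebra.algebraMap_eq_smul_one c)⟩
  have hM : Function.Bijective
      (Algebra.ofId ℂ (Matrix (Fin 1 ⊕ Fin 0) (Fin 1 ⊕ Fin 0) ℂ)) := by
    refine ⟨(algebraMap ℂ (Matrix (Fin 1 ⊕ Fin 0) (Fin 1 ⊕ Fin 0) ℂ)).injective, fun Y => ?_⟩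
    refine ⟨Y (Sum.inl 0) (Sum.inl 0), ?_⟩
    ext p q
    rcases p with p | p
    · rcases q with q | q
      · obtain rfl := Subsingleton.elim p 0
        obtain rfl := Subsingleton.elim q 0
        simp [Algebra.ofId_apply, Matrix.algebraMap_matrix_apply]
      · exact q.elim0
    · exact p.elim0
  let e := (AlgEquiv.ofBijective _ hB).symm.trans (AlgEquiv.ofBijective _ hM)
  have hdeg : ∀ p : Fin 1 ⊕ Fin 0, basisDegree 1 0 p = 0 := by
    rintro (p | p)
    · rfl
    · exact p.elim0
  refine ⟨e, fun i a => ?_⟩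
  rcases zmod2_cases i with rfl | rfl
  · refine iff_of_true (hs a.1 a.2) fun p q hpq => absurd ?_ hpq
    rw [hdeg, hdeg, add_zero]
  · constructor
    · intro ha
      have : a = 0 := Subtype.ext (h a.1 ha)
      rw [this, map_zero]
      exact zero_mem _
    · intro ha
      have : e a = 0 := by
        ext p q
        refine ha p q ?_
        rw [hdeg, hdeg]
        decide
      rw [(map_eq_zero_iff e e.injective).1 this]
      exact zero_mem _

theorem IsTypeM.eq_zero (hX : X.IsTypeM) {f : Module.End ℂ X.carrier} (hf : f ∈ homGr X X 1) :
    f = 0 := by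
  obtain ⟨-, e, he⟩ := hX
  have h1 : (⟨f, Submodule.mem_sup_right hf⟩ : X.superEnd) ∈ X.superEndGr 1 := hf
  have h2 := (he 1 _).1 h1
  have h3 : e ⟨f, Submodule.mem_sup_right hf⟩ = 0 := by
    ext p q
    refine h2 p q ?_
    rcases p with p | p
    · rcases q with q | q
      · simp [basisDegree]
      · exact q.elim0
    · exact p.elim0
  exact congrArg Subtype.val ((map_eq_zero_iff e e.injective).1 h3)

/-- An odd endomorphism of a simple module can be rescaled to an involution. -/
theorem exists_odd_mul_self_eq_one (hX : X.IsSimple) {f : Module.End ℂ X.carrier}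
    (hf : f ∈ homGr X X 1) (h0 : f ≠ 0) : ∃ j ∈ homGr X X 1, j * j = 1 := by
  have h2 := X.homGr_mul hf hf
  rw [one_add_one_zmod2] at h2
  obtain ⟨c, hc⟩ := exists_eq_smul_one hX h2
  have hc0 : c ≠ 0 := by
    rintro rfl
    have := hX.1
    obtain ⟨x, hx⟩ := exists_ne (0 : X.carrier)
    have hi := injective_of_isSimple hX hf h0
    refine hx (hi (hi ?_))
    have := LinearMap.congr_fun hc x
    simpa using this
  -- Here $f^2=c\ne0$; with $d^2=c^{-1}$ the multiple $df$ squares to $1$.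
  obtain ⟨d, hd⟩ := IsAlgClosed.exists_pow_nat_eq c⁻¹ (n := 2) (by norm_num)
  refine ⟨d • f, Submodule.smul_mem _ d hf, ?_⟩
  rw [smul_mul_smul_comm, hc, smul_smul, ← pow_two, hd, inv_mul_cancel₀ hc0, one_smul]

/-- The product $fj$ is even, hence a scalar; multiplying by $j$ on the right recovers $f$. -/
theorem exists_eq_smul_of_mem_homGr_one (hX : X.IsSimple) {j f : Module.End ℂ X.carrier}
    (hj : j ∈ homGr X X 1) (hjj : j * j = 1) (hf : f ∈ homGr X X 1) : ∃ c : ℂ, f = c • j := by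
  have h2 := X.homGr_mul hf hj
  rw [one_add_one_zmod2] at h2
  obtain ⟨c, hc⟩ := exists_eq_smul_one hX h2
  refine ⟨c, ?_⟩
  have := congrArg (· * j) hc
  simpa [mul_assoc, hjj] using this

theorem mem_matQGr_one_iff (M : matQ 1) :
    (M ∈ matQGr 1 0 ↔ M.1 (Sum.inl 0) (Sum.inr 0) = 0) ∧
      (M ∈ matQGr 1 1 ↔ M.1 (Sum.inl 0) (Sum.inl 0) = 0) := by
  obtain ⟨M, C, D, rfl⟩ := M
  have hmem : ∀ k, (⟨Matrix.fromBlocks C D D C, C, D, rfl⟩ : matQ 1) ∈ matQGr 1 k ↔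
      ∀ p q, basisDegree 1 1 p ≠ k + basisDegree 1 1 q →
        Matrix.fromBlocks C D D C p q = 0 := fun k => Iff.rfl
  rw [hmem, hmem]
  constructor
  · refine ⟨fun h => h _ _ (by simp [basisDegree]), fun h => ?_⟩
    rintro (p | p) (q | q) hpq <;> obtain rfl := Subsingleton.elim p 0 <;>
      obtain rfl := Subsingleton.elim q 0 <;> simp_all [basisDegree]
  · refine ⟨fun h => h _ _ (by simp [basisDegree]), fun h => ?_⟩
    rintro (p | p) (q | q) hpq <;> obtain rfl := Subsingleton.elim p 0 <;>
      obtain rfl := Subsingleton.elim q 0 <;> simp_all [basisDegree, one_add_one_zmod2]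

theorem matQ_one_ext {M N : matQ 1} (h0 : M.1 (Sum.inl 0) (Sum.inl 0) = N.1 (Sum.inl 0) (Sum.inl 0))
    (h1 : M.1 (Sum.inl 0) (Sum.inr 0) = N.1 (Sum.inl 0) (Sum.inr 0)) : M = N := by
  obtain ⟨M, C, D, rfl⟩ := M
  obtain ⟨N, C', D', rfl⟩ := N
  apply Subtype.ext
  ext p q
  rcases p with p | p <;> rcases q with q | q <;> obtain rfl := Subsingleton.elim p 0 <;>
      obtain rfl := Subsingleton.elim q 0 <;> simp_all

/-- The algebra homomorphism from `Q(1)` determined by an odd involution. -/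
def matQLift {j : Module.End ℂ X.carrier} (hj : j ∈ homGr X X 1) (hjj : j * j = 1) :
    matQ 1 →ₐ[ℂ] X.superEnd :=
  AlgHom.ofLinearMap
    { toFun := fun M => M.1 (Sum.inl 0) (Sum.inl 0) • 1 +
        M.1 (Sum.inl 0) (Sum.inr 0) • ⟨j, Submodule.mem_sup_right hj⟩
      map_add' := fun M N => by
        simp only [Subalgebra.coe_add, Matrix.add_apply]
        module
      map_smul' := fun c M => by
        simp only [Subalgebra.coe_smul, Matrix.smul_apply, RingHom.id_apply, smul_eq_mul]
        module }
    (by simp)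
    (by
      rintro ⟨_, C, D, rfl⟩ ⟨_, C', D', rfl⟩
      apply Subtype.ext
      simp [Matrix.mul_apply, mul_add, add_mul, hjj, smul_smul]
      module)

/-- A nonzero odd endomorphism rescales to an involution $j$, and then the supercentralizer is
$\mathbb C1\oplus\mathbb Cj$ with $j^2=1$, which is $Q(1)$ with $j$ as the antidiagonal unit. -/
theorem isTypeQ_of_homGr_one (hX : X.IsSimple) {f : Module.End ℂ X.carrier}
    (hf : f ∈ homGr X X 1) (h0 : f ≠ 0) : X.IsTypeQ := by
  refine ⟨hX, ?_⟩
  have := hX.1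
  obtain ⟨j, hj, hjj⟩ := exists_odd_mul_self_eq_one hX hf h0
  have hj0 : j ≠ 0 := by
    rintro rfl
    simp at hjj
  have hval : ∀ M, (matQLift hj hjj M).1 =
      M.1 (Sum.inl 0) (Sum.inl 0) • 1 + M.1 (Sum.inl 0) (Sum.inr 0) • j := fun M => rfl
  have h0' : ∀ M, (matQLift hj hjj M).1 ∈ homGr X X 0 ↔ M.1 (Sum.inl 0) (Sum.inr 0) = 0 := by
    intro M
    rw [hval]
    constructor
    · intro h
      have h1 := (Submodule.add_mem_iff_right _ (Submodule.smul_mem _ _ X.homGr_one)).1 h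
      exact (smul_eq_zero.1 (eq_zero_of_mem_homGr_zero_one h1
        (Submodule.smul_mem _ _ hj))).resolve_right hj0
    · intro h
      rw [h, zero_smul, add_zero]
      exact Submodule.smul_mem _ _ X.homGr_one
  have h1' : ∀ M, (matQLift hj hjj M).1 ∈ homGr X X 1 ↔ M.1 (Sum.inl 0) (Sum.inl 0) = 0 := by
    intro M
    rw [hval]
    constructor
    · intro h
      have h1 := (Submodule.add_mem_iff_left _ (Submodule.smul_mem _ _ hj)).1 h
      exact (smul_eq_zero.1 (eq_zero_of_mem_homGr_zero_one
        (Submodule.smul_mem _ _ X.homGr_one) h1)).resolve_right one_ne_zero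
    · intro h
      rw [h, zero_smul, zero_add]
      exact Submodule.smul_mem _ _ hj
  have hB : Function.Bijective (matQLift hj hjj) := by
    constructor
    · refine (injective_iff_map_eq_zero _).2 fun M hM => matQ_one_ext ?_ ?_
      · refine (h1' M).1 ?_
        rw [hM]
        exact zero_mem _
      · refine (h0' M).1 ?_
        rw [hM]
        exact zero_mem _
    · rintro ⟨g, hg⟩
      obtain ⟨g0, hg0, g1, hg1, rfl⟩ := Submodule.mem_sup.1 (show g ∈ superHom X X from hg)
      obtain ⟨c, hc⟩ := exists_eq_smul_one hX hg0
      obtain ⟨d, hd⟩ := exists_eq_smul_of_mem_homGr_one hX hj hjj hg1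
      refine ⟨⟨_, Matrix.of fun _ _ => c, Matrix.of fun _ _ => d, rfl⟩, Subtype.ext ?_⟩
      rw [hval]
      simp [hc, hd]
  refine ⟨(AlgEquiv.ofBijective _ hB).symm, fun i a => ?_⟩
  obtain ⟨M, rfl⟩ := hB.2 a
  have e : (AlgEquiv.ofBijective _ hB).symm (matQLift hj hjj M) = M :=
    (AlgEquiv.ofBijective _ hB).symm_apply_apply M
  rw [e]
  rcases zmod2_cases i with rfl | rfl
  · exact (h0' M).trans (mem_matQGr_one_iff M).1.symm
  · exact (h1' M).trans (mem_matQGr_one_iff M).2.symm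

theorem IsTypeQ.exists_odd (hX : X.IsTypeQ) : ∃ j ∈ homGr X X 1, j * j = 1 := by
  obtain ⟨hX, e, he⟩ := hX
  let J : matQ 1 := ⟨_, 0, 1, rfl⟩
  have hJ : J ∈ matQGr 1 1 := (mem_matQGr_one_iff J).2.2 (by simp [J])
  have h1 : e.symm J ∈ X.superEndGr 1 := (he 1 _).2 (by simpa using hJ)
  refine exists_odd_mul_self_eq_one hX h1 fun h => ?_
  have h2 : J = 0 := (map_eq_zero_iff e.symm e.symm.injective).1 (Subtype.ext h)
  have h3 : J.1 (Sum.inl 0) (Sum.inr 0) = 0 := by rw [h2]; rfl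
  simp [J] at h3

end Types

/-! ### The double supercentralizer property. -/

section DoubleCentralizer

variable {V : SuperModule.{u, v} 𝒜}

/-- The parity as a symmetry of the lattice of ungraded submodules. -/
def parityOrderIso (V : SuperModule.{u, v} 𝒜) :
    Submodule V.ρ.range V.carrier ≃o Submodule V.ρ.range V.carrier :=
  let F : Submodule V.ρ.range V.carrier → Submodule V.ρ.range V.carrier := fun N =>
    { carrier := {x | parity V.isCompl x ∈ N}
      zero_mem' := by simp
      add_mem' := fun {x y} hx hy => by
        change parity V.isCompl (x + y) ∈ N
        rw [map_add]
        exact add_mem hx hy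
      smul_mem' := by
        rintro ⟨_, a, rfl⟩ x hx
        change parity V.isCompl (V.ρ a x) ∈ N
        rw [ρ_parity]
        exact N.smul_mem ⟨_, parityAut 𝒜 a, rfl⟩ hx }
  have hF : ∀ N, F (F N) = N := fun N => by
    ext x
    change parity V.isCompl (parity V.isCompl x) ∈ N ↔ _
    rw [parity_parity]
  { toFun := F
    invFun := F
    left_inv := hF
    right_inv := hF
    map_rel_iff' := by
      have hmono : ∀ M N, M ≤ N → F M ≤ F N := fun M N h x hx => h hx
      intro M N
      refine ⟨fun h => ?_, hmono M N⟩
      have := hmono _ _ h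
      rwa [Equiv.coe_fn_mk, hF, hF] at this }

theorem mem_parityOrderIso {N : Submodule V.ρ.range V.carrier} {x : V.carrier} :
    x ∈ parityOrderIso V N ↔ parity V.isCompl x ∈ N := Iff.rfl

/-- A semisimple supermodule is semisimple as an ungraded module. -/
theorem IsSemisimple.isSemisimpleModule (hV : V.IsSemisimple) :
    IsSemisimpleModule V.ρ.range V.carrier := by
  have : IsArtinian V.ρ.range V.carrier := isArtinian_of_tower ℂ inferInstance
  set s : Submodule V.ρ.range V.carrier := sSup {m | IsAtom m} with hs
  -- A lattice automorphism permutes the atoms, so the ungraded socle is stable under the parity and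
  -- is therefore a graded submodule.
  have hpar : parityOrderIso V s = s := by
    rw [hs, OrderIso.map_sSup]
    refine le_antisymm (iSup₂_le fun m hm => ?_) (sSup_le fun m hm => ?_)
    · exact le_sSup (show _ ∈ {m | IsAtom m} from (OrderIso.isAtom_iff _ m).2 hm)
    have h := (OrderIso.isAtom_iff (parityOrderIso V).symm m).2 hm
    refine le_iSup₂_of_le ((parityOrderIso V).symm m) h ?_
    rw [OrderIso.apply_symm_apply]
  have hsub : V.IsSubmodule (s.restrictScalars ℂ) := by
    refine isSubmodule_of_parity (fun x hx => ?_) (fun a x hx => ?_)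
    · have h : x ∈ s := hx
      rwa [← hpar, mem_parityOrderIso] at h
    · exact s.smul_mem (⟨V.ρ a, a, rfl⟩ : V.ρ.range) hx
  obtain ⟨M, hM, hc⟩ := hV.exists_isCompl hsub
  let M' : Submodule V.ρ.range V.carrier :=
    { M with
      smul_mem' := by
        rintro ⟨_, a, rfl⟩ x hx
        exact hM.stable a x hx }
  -- A nonzero complement of the socle would contain an ungraded simple submodule, which already
  -- lies in the socle.
  have hM' : M' = ⊥ := by
    by_contra h
    obtain ⟨a, ha, haM⟩ := (eq_bot_or_exists_atom_le M').resolve_left h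
    refine ha.1 ((Submodule.eq_bot_iff _).2 fun x hx => ?_)
    exact Submodule.disjoint_def.1 hc.disjoint x
      ((le_sSup (show a ∈ {m | IsAtom m} from ha) : a ≤ s) hx) (haM hx)
  refine .of_sSup_simples_eq_top ?_
  simp_rw [isSimpleModule_iff_isAtom]
  rw [← hs]
  refine eq_top_iff.2 fun x _ => ?_
  obtain ⟨y, hy, z, hz, rfl⟩ := Submodule.mem_sup.1
    (hc.sup_eq_top ▸ Submodule.mem_top : x ∈ s.restrictScalars ℂ ⊔ M)
  have hz' : z ∈ M' := hz
  rw [hM', Submodule.mem_bot] at hz'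
  rwa [hz', add_zero]

/-- The sign $(-1)^{\alpha\beta}$ is symmetric in the two degrees, so $b$ supercommuting with
$\rho(a)$ is the same as $\rho(a)$ supercommuting with $b$. -/
theorem ρ_mem_homGr_overEnd {i : ZMod 2} {a : A} (ha : a ∈ 𝒜 i) :
    V.ρ a ∈ homGr V.overEnd V.overEnd i := by
  refine ⟨fun β x hx => V.ρ_mem _ _ _ _ ha hx, fun β b hb x => ?_⟩
  have h : b.1 (V.ρ a x) = _ := hb.2 i a ha x
  change V.ρ a (b.1 x) = (-1 : ℤˣ) ^ (i * β) • b.1 (V.ρ a x)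
  rw [h]
  change V.ρ a (b.1 x) = (-1 : ℤˣ) ^ (i * β) • (-1 : ℤˣ) ^ (β * i) • V.ρ a (b.1 x)
  rw [smul_smul, mul_comm β i, Int.units_mul_self, one_smul]

/-- The graded statement is reduced to ordinary Jacobson density: supercommuting with the
supercentralizer implies commuting with the ungraded commutant. -/
theorem IsSemisimple.mem_range_of_mem_homGr (hV : V.IsSemisimple) {γ : ZMod 2}
    {g : Module.End ℂ V.carrier} (hg : g ∈ homGr V.overEnd V.overEnd γ) : g ∈ V.ρ.range := by
  classical
  have := hV.isSemisimpleModule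
  have hgb : ∀ β, ∀ b ∈ homGr V V β, ∀ x, g (b x) = (-1 : ℤˣ) ^ (γ * β) • b (g x) := by
    intro β b hb x
    have hb' : b ∈ V.superEnd := by
      rcases zmod2_cases β with rfl | rfl
      · exact Submodule.mem_sup_left hb
      · exact Submodule.mem_sup_right hb
    exact hg.2 β ⟨b, hb'⟩ hb x
  have hgp : ∀ x, g (parity V.isCompl x) = (-1 : ℤˣ) ^ γ • parity V.isCompl (g x) :=
    fun x => homGr_parity hg x
  have hcomm : ∀ (c : Module.End V.ρ.range V.carrier) (x : V.carrier), g (c x) = c (g x) := by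
    intro c
    let c' : Module.End ℂ V.carrier := c.restrictScalars ℂ
    have hcρ : ∀ a x, c' (V.ρ a x) = V.ρ a (c' x) := fun a x =>
      c.map_smul (⟨V.ρ a, a, rfl⟩ : V.ρ.range) x
    let δ := parity V.isCompl
    have hδδ : ∀ x, δ (δ x) = x := parity_parity _
    have hδρ : ∀ a x, δ (V.ρ a x) = V.ρ (parityAut 𝒜 a) (δ x) := V.ρ_parity
    have hσ : ∀ a, parityAut 𝒜 (parityAut 𝒜 a) = a := parity_parity _
    -- The commutant element $c$ need not be homogeneous. Its even part $c+\delta c\delta$ (up to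
    -- the factor $2$) and the combination $c\delta-\delta c$ do lie in the supercentralizer, in
    -- degrees $0$ and $1$; the right multiplication by $\delta$ converts commuting with $A$ into
    -- supercommuting.
    have h0 : c' + δ ∘ₗ c' ∘ₗ δ ∈ homGr V V 0 := by
      refine ⟨fun β x hx => ?_, fun β a ha x => ?_⟩
      · rw [mem_gr_iff_parity V.isCompl]
        change δ (c' x + δ (c' (δ x))) = (-1 : ℤˣ) ^ (0 + β) • (c' x + δ (c' (δ x)))
        rw [map_add, hδδ, show δ x = _ from parity_of_mem _ hx]
        rcases zmod2_cases β with rfl | rfl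
        · simp [add_comm]
        · simp [add_comm]
      · change c' (V.ρ a x) + δ (c' (δ (V.ρ a x))) = _ • V.ρ a (c' x + δ (c' (δ x)))
        simp [hδρ, hcρ, hσ]
    have h1 : c' ∘ₗ δ - δ ∘ₗ c' ∈ homGr V V 1 := by
      refine ⟨fun β x hx => ?_, fun β a ha x => ?_⟩
      · rw [mem_gr_iff_parity V.isCompl]
        change δ (c' (δ x) - δ (c' x)) = (-1 : ℤˣ) ^ (1 + β) • (c' (δ x) - δ (c' x))
        rw [map_sub, hδδ, show δ x = _ from parity_of_mem _ hx]
        rcases zmod2_cases β with rfl | rfl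
        · simp
        · simp only [one_add_one_zmod2, uzpow_one, uzpow_zero, one_smul, Units.neg_smul, map_neg]
          abel
      · change c' (δ (V.ρ a x)) - δ (c' (V.ρ a x)) = _ • V.ρ a (c' (δ x) - δ (c' x))
        rw [hδρ, hcρ, hcρ, hδρ, parityAut_of_mem 𝒜 ha]
        rcases zmod2_cases β with rfl | rfl <;> simp
        abel
    intro x
    -- The odd relation is used at $\delta x$; moving $g$ past $\delta$ costs $(-1)^\gamma$, which
    -- cancels the sign of the relation. Adding the two relations leaves $2gc=2cg$.
    have e0 : g (c' x + δ (c' (δ x))) = _ := hgb 0 _ h0 x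
    have e1 : g (c' (δ (δ x)) - δ (c' (δ x))) = _ := hgb 1 _ h1 (δ x)
    change _ = _ • (c' (δ (g (δ x))) - δ (c' (g (δ x)))) at e1
    change _ = _ • (c' (g x) + δ (c' (δ (g x)))) at e0
    rw [hδδ, show g (δ x) = _ from hgp x, map_sub] at e1
    rw [map_add] at e0
    change g (c' x) = c' (g x)
    have h2 : (2 : ℂ) • g (c' x) = (2 : ℂ) • c' (g x) := by
      have e2 := congrArg₂ (· + ·) e0 e1
      have hp : ∀ y, parity V.isCompl y = δ y := fun _ => rfl
      rcases zmod2_cases γ with rfl | rfl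
      · simp only [hp, hδδ, zero_mul, uzpow_zero, one_smul] at e2
        rw [two_smul, two_smul]
        linear_combination (norm := module) e2
      · simp only [hp, hδδ, map_neg, mul_zero, mul_one, uzpow_zero, uzpow_one, one_smul,
          Units.neg_smul] at e2
        rw [two_smul, two_smul]
        linear_combination (norm := module) e2
    exact smul_right_injective _ (two_ne_zero' ℂ) h2
  let f : Module.End (Module.End V.ρ.range V.carrier) V.carrier :=
    { toFun := g
      map_add' := g.map_add
      map_smul' := hcomm }
  let b := Module.finBasis ℂ V.carrier
  -- Density yields agreement on a finite set only; a basis of the finite-dimensional space makes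
  -- that equality.
  obtain ⟨r, hr⟩ := jacobson_density f (Finset.univ.image b)
  have : g = r.1 := b.ext fun i => hr _ (Finset.mem_image_of_mem _ (Finset.mem_univ i))
  rw [this]
  exact r.2

/-- The double supercentralizer property. -/
theorem IsSemisimple.superEnd_overEnd (hV : V.IsSemisimple) :
    V.overEnd.superEnd = V.ρ.range := by
  apply le_antisymm
  · intro g hg
    obtain ⟨g0, hg0, g1, hg1, rfl⟩ :=
      Submodule.mem_sup.1 (show g ∈ superHom V.overEnd V.overEnd from hg)
    exact V.ρ.range.add_mem (hV.mem_range_of_mem_homGr hg0) (hV.mem_range_of_mem_homGr hg1)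
  · rintro _ ⟨a, rfl⟩
    obtain ⟨b, hb, c, hc, rfl⟩ := exists_add (isCompl_gr 𝒜) a
    have h : V.ρ b + V.ρ c ∈ superHom V.overEnd V.overEnd :=
      (superHom V.overEnd V.overEnd).add_mem (Submodule.mem_sup_left (ρ_mem_homGr_overEnd hb))
        (Submodule.mem_sup_right (ρ_mem_homGr_overEnd hc))
    rwa [← map_add] at h

end DoubleCentralizer

/-! ### Checking module conditions over a supertensor product on its factors. -/

section TensorAction

variable {B : Type w} [Ring B] [Algebra ℂ B] {ℬ : ZMod 2 → Submodule ℂ B} [GradedAlgebra ℬ]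

theorem tmul_one_mem_superTensorGr {i : ZMod 2} {a : A} (ha : a ∈ 𝒜 i) :
    GradedTensorProduct.tmul ℂ a (1 : B) ∈ superTensorGr 𝒜 ℬ i := by
  refine ⟨a ⊗ₜ 1, ?_, rfl⟩
  simpa using tmul_mem_tensorGr ha (SetLike.GradedOne.one_mem : (1 : B) ∈ ℬ 0)

theorem one_tmul_mem_superTensorGr {i : ZMod 2} {b : B} (hb : b ∈ ℬ i) :
    GradedTensorProduct.tmul ℂ (1 : A) b ∈ superTensorGr 𝒜 ℬ i := by
  refine ⟨1 ⊗ₜ b, ?_, rfl⟩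
  simpa using tmul_mem_tensorGr (SetLike.GradedOne.one_mem : (1 : A) ∈ 𝒜 0) hb

theorem ρ_tmul {T : SuperModule.{max u w, v} (superTensorGr 𝒜 ℬ)} (a : A) (b : B)
    (x : T.carrier) : T.ρ (GradedTensorProduct.tmul ℂ a b) x =
      T.ρ (GradedTensorProduct.tmul ℂ a 1) (T.ρ (GradedTensorProduct.tmul ℂ 1 b) x) := by
  rw [← Module.End.mul_apply, ← map_mul, GradedTensorProduct.tmul_one_mul_one_tmul]

/-- Homogeneity over a supertensor product can be checked on the two factors. -/
theorem mem_homGr_of_factors {T : SuperModule.{max u w, v} (superTensorGr 𝒜 ℬ)}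
    {S : SuperModule.{max u w, x} (superTensorGr 𝒜 ℬ)} {α : ZMod 2}
    {f : T.carrier →ₗ[ℂ] S.carrier} (hdeg : ∀ β, ∀ x ∈ T.gr β, f x ∈ S.gr (α + β))
    (hl : ∀ i, ∀ a ∈ 𝒜 i, ∀ x, f (T.ρ (GradedTensorProduct.tmul ℂ a 1) x) =
      (-1 : ℤˣ) ^ (α * i) • S.ρ (GradedTensorProduct.tmul ℂ a 1) (f x))
    (hr : ∀ i, ∀ b ∈ ℬ i, ∀ x, f (T.ρ (GradedTensorProduct.tmul ℂ 1 b) x) =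
      (-1 : ℤˣ) ^ (α * i) • S.ρ (GradedTensorProduct.tmul ℂ 1 b) (f x)) :
    f ∈ homGr T S α := by
  refine ⟨hdeg, ?_⟩
  rintro β _ ⟨s, hs, rfl⟩ x
  let F : (A ⊗[ℂ] B) →ₗ[ℂ] S.carrier :=
    f ∘ₗ LinearMap.applyₗ x ∘ₗ T.ρ.toLinearMap ∘ₗ (GradedTensorProduct.of ℂ 𝒜 ℬ).toLinearMap
  let G : (A ⊗[ℂ] B) →ₗ[ℂ] S.carrier := (((-1 : ℤˣ) ^ (α * β) : ℤˣ) : ℤ) •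
    LinearMap.applyₗ (f x) ∘ₗ S.ρ.toLinearMap ∘ₗ (GradedTensorProduct.of ℂ 𝒜 ℬ).toLinearMap
  have h : tensorGr 𝒜 ℬ β ≤ LinearMap.eqLocus F G := by
    refine tensorGr_le fun i j a b e ha hb => ?_
    change f (T.ρ (GradedTensorProduct.tmul ℂ a b) x) =
      (((-1 : ℤˣ) ^ (α * β) : ℤˣ) : ℤ) • S.ρ (GradedTensorProduct.tmul ℂ a b) (f x)
    rw [ρ_tmul, hl i a ha, hr j b hb, map_sign, ρ_tmul (T := S) a b, smul_smul, ← uzpow_add, ← mul_add, e,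
      Units.smul_def]
  exact h hs

/-- Stability over a supertensor product can be checked on the two factors. -/
theorem isSubmodule_of_factors {T : SuperModule.{max u w, v} (superTensorGr 𝒜 ℬ)}
    {N : Submodule ℂ T.carrier} (hgr : N ≤ (N ⊓ T.gr 0) ⊔ (N ⊓ T.gr 1))
    (hl : ∀ a, ∀ x ∈ N, T.ρ (GradedTensorProduct.tmul ℂ a 1) x ∈ N)
    (hr : ∀ b, ∀ x ∈ N, T.ρ (GradedTensorProduct.tmul ℂ 1 b) x ∈ N) : T.IsSubmodule N := by
  refine ⟨hgr, fun t x hx => ?_⟩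
  let F : (A ⊗[ℂ] B) →ₗ[ℂ] T.carrier :=
    LinearMap.applyₗ x ∘ₗ T.ρ.toLinearMap ∘ₗ (GradedTensorProduct.of ℂ 𝒜 ℬ).toLinearMap
  have h : ∀ s : A ⊗[ℂ] B, F s ∈ N := by
    intro s
    induction s using TensorProduct.induction_on with
    | zero => rw [map_zero]; exact zero_mem _
    | add s t hs ht => rw [map_add]; exact add_mem hs ht
    | tmul a b =>
      change T.ρ (GradedTensorProduct.tmul ℂ a b) x ∈ N
      rw [ρ_tmul]
      exact hl _ _ (hr _ _ hx)
  exact h t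

theorem superTensor_left (U : SuperModule.{u, v} 𝒜) (W : SuperModule.{w, v} ℬ) (a : A)
    (t : U.carrier ⊗[ℂ] W.carrier) :
    (superTensor U W).ρ (GradedTensorProduct.tmul ℂ a 1) t = leftAction U W a t := by
  change leftAction U W a (rightAction U W 1 t) = _
  rw [map_one]
  rfl

theorem superTensor_right (U : SuperModule.{u, v} 𝒜) (W : SuperModule.{w, v} ℬ) (b : B)
    (t : U.carrier ⊗[ℂ] W.carrier) :
    (superTensor U W).ρ (GradedTensorProduct.tmul ℂ 1 b) t = rightAction U W b t := by
  change leftAction U W 1 (rightAction U W b t) = _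
  rw [map_one]
  rfl

theorem overTensorEnd_left (V : SuperModule.{u, v} 𝒜) (a : A) (x : V.carrier) :
    V.overTensorEnd.ρ (GradedTensorProduct.tmul ℂ a 1) x = V.ρ a x := rfl

theorem overTensorEnd_right (V : SuperModule.{u, v} 𝒜) (b : V.superEnd) (x : V.carrier) :
    V.overTensorEnd.ρ (GradedTensorProduct.tmul ℂ 1 b) x = b.1 x := by
  rw [overTensorEnd_tmul, map_one]
  rfl

theorem isSubmodule_overTensorEnd_iff {V : SuperModule.{u, v} 𝒜} {N : Submodule ℂ V.carrier} :
    V.overTensorEnd.IsSubmodule N ↔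
      V.IsSubmodule N ∧ ∀ i, ∀ b ∈ homGr V V i, ∀ x ∈ N, b x ∈ N := by
  constructor
  · intro h
    refine ⟨⟨h.graded, fun a x hx => h.stable (GradedTensorProduct.tmul ℂ a 1) x hx⟩,
      fun i b hb x hx => ?_⟩
    have hb' : b ∈ V.superEnd := by
      rcases zmod2_cases i with rfl | rfl
      · exact Submodule.mem_sup_left hb
      · exact Submodule.mem_sup_right hb
    have h1 := h.stable (GradedTensorProduct.tmul ℂ 1 ⟨b, hb'⟩) x hx
    rwa [overTensorEnd_right] at h1
  · rintro ⟨h1, h2⟩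
    refine isSubmodule_of_factors (T := V.overTensorEnd) h1.graded h1.stable fun b x hx => ?_
    refine (congrArg (· ∈ N) (overTensorEnd_right V b x)).mpr ?_
    obtain ⟨b, hb⟩ := b
    obtain ⟨f0, hf0, f1, hf1, rfl⟩ := Submodule.mem_sup.1 (show b ∈ superHom V V from hb)
    exact add_mem (h2 0 f0 hf0 x hx) (h2 1 f1 hf1 x hx)

end TensorAction

/-! ### Isotypic submodules, simple of type $M$ over $A\mathbin{\dot\otimes}B$. -/

section Isotypic

variable {V : SuperModule.{u, v} 𝒜} {X : SuperModule.{u, w} 𝒜}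

/-- A simple submodule of a sum of images of simple modules is isomorphic to one of them. -/
theorem IsSemisimple.exists_homogeneousIso_of_le_iSup (hV : V.IsSemisimple) {ι : Sort*}
    {X : ι → SuperModule.{u, w} 𝒜} (hX : ∀ i, (X i).IsSimple) {d : ι → ZMod 2}
    {f : ∀ i, (X i).carrier →ₗ[ℂ] V.carrier} (hf : ∀ i, f i ∈ homGr (X i) V (d i))
    {S : Submodule ℂ V.carrier} (hS : V.IsSubmodule S) (hS' : (V.restrict S hS).IsSimple)
    (hle : S ≤ ⨆ i, LinearMap.range (f i)) : ∃ i, HomogeneousIso (X i) (V.restrict S hS) := by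
  -- With $p$ a retraction of $V$ onto $S$, Schur makes every $p\circ f_i$ vanish if no $X_i$ is
  -- isomorphic to $S$; then $p$ kills $S$, where it is the identity.
  obtain ⟨p, hp, hps⟩ := hV.exists_retraction (subtype_mem_homGr hS) S.subtype_injective
  by_contra! h
  have h0 : ∀ i, p ∘ₗ f i = 0 := fun i => by
    by_contra h0
    exact h i (homogeneousIso_of_ne_zero (hX i) hS' (homGr_comp hp (hf i)) h0)
  have h1 : (⨆ i, LinearMap.range (f i)) ≤ LinearMap.ker p := by
    refine iSup_le fun i => ?_
    rintro _ ⟨x, rfl⟩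
    exact LinearMap.congr_fun (h0 i) x
  have := hS'.1
  obtain ⟨y, hy⟩ := exists_ne (0 : (V.restrict S hS).carrier)
  refine hy ((LinearMap.congr_fun hps y).symm.trans ?_)
  exact h1 (hle y.2)

/-- The sum of the images of all homogeneous homomorphisms from `X` to `V`. -/
def isotypic (V : SuperModule.{u, v} 𝒜) (X : SuperModule.{u, w} 𝒜) : Submodule ℂ V.carrier :=
  ⨆ f : {f : X.carrier →ₗ[ℂ] V.carrier // ∃ i, f ∈ homGr X V i}, LinearMap.range f.1

theorem range_le_isotypic {i : ZMod 2} {f : X.carrier →ₗ[ℂ] V.carrier} (hf : f ∈ homGr X V i) :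
    LinearMap.range f ≤ isotypic V X :=
  le_iSup (fun f : {f : X.carrier →ₗ[ℂ] V.carrier // ∃ i, f ∈ homGr X V i} =>
    LinearMap.range f.1) ⟨f, i, hf⟩

theorem isotypic_le {N : Submodule ℂ V.carrier}
    (h : ∀ i, ∀ f ∈ homGr X V i, LinearMap.range f ≤ N) : isotypic V X ≤ N :=
  iSup_le fun f => h _ f.1 f.2.choose_spec

theorem isSubmodule_isotypic : V.IsSubmodule (isotypic V X) :=
  isSubmodule_iSup fun f => isSubmodule_range f.2.choose_spec

theorem apply_mem_isotypic {Y : SuperModule.{u, x} 𝒜} {i : ZMod 2}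
    {b : V.carrier →ₗ[ℂ] Y.carrier} (hb : b ∈ homGr V Y i) {x : V.carrier}
    (hx : x ∈ isotypic V X) : b x ∈ isotypic Y X := by
  have h : isotypic V X ≤ (isotypic Y X).comap b := by
    refine isotypic_le fun j f hf => ?_
    rintro _ ⟨y, rfl⟩
    exact range_le_isotypic (homGr_comp hb hf) ⟨y, rfl⟩
  exact h hx

theorem isSubmodule_overTensorEnd_isotypic : V.overTensorEnd.IsSubmodule (isotypic V X) :=
  isSubmodule_overTensorEnd_iff.2
    ⟨isSubmodule_isotypic, fun _ _ hb _ hx => apply_mem_isotypic hb hx⟩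

theorem HomogeneousIso.isotypic_le {Y : SuperModule.{u, x} 𝒜} (h : HomogeneousIso X Y) :
    isotypic V Y ≤ isotypic V X := by
  obtain ⟨i, e, he⟩ := h
  refine SuperModule.isotypic_le fun j f hf => ?_
  rintro _ ⟨y, rfl⟩
  refine range_le_isotypic (homGr_comp hf he) ⟨e.symm y, ?_⟩
  simp

theorem HomogeneousIso.isotypic_eq {Y : SuperModule.{u, x} 𝒜} (h : HomogeneousIso X Y) :
    isotypic V X = isotypic V Y :=
  le_antisymm h.symm.isotypic_le h.isotypic_le

theorem IsSemisimple.homogeneousIso_of_le_isotypic (hV : V.IsSemisimple) (hX : X.IsSimple)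
    {S : Submodule ℂ V.carrier} (hS : V.IsSubmodule S) (hS' : (V.restrict S hS).IsSimple)
    (hle : S ≤ isotypic V X) : HomogeneousIso X (V.restrict S hS) := by
  obtain ⟨-, h⟩ := hV.exists_homogeneousIso_of_le_iSup
    (ι := {f : X.carrier →ₗ[ℂ] V.carrier // ∃ i, f ∈ homGr X V i}) (X := fun _ => X)
    (fun _ => hX) (fun f => f.2.choose_spec) hS hS' hle
  exact h

theorem le_isotypic_of_homogeneousIso {S : Submodule ℂ V.carrier} (hS : V.IsSubmodule S)
    (h : HomogeneousIso X (V.restrict S hS)) : S ≤ isotypic V X := by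
  obtain ⟨i, e, he⟩ := h
  intro y hy
  refine range_le_isotypic (homGr_comp (subtype_mem_homGr hS) he) ⟨e.symm ⟨y, hy⟩, ?_⟩
  exact congrArg Subtype.val (e.apply_symm_apply ⟨y, hy⟩)

/-- A nonzero homogeneous map from a simple $U$ is injective, so its image is one of the simple
submodules being summed. Describing the component by maps instead of submodules frees it from the
choice of a copy of $U$ inside $V$. -/
theorem homogeneousComponent_eq_isotypic {U : Submodule ℂ V.carrier} (hU : V.IsSubmodule U)
    (hU' : (V.restrict U hU).IsSimple) :
    V.homogeneousComponent U hU = isotypic V (V.restrict U hU) := by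
  apply le_antisymm
  · refine iSup₂_le fun N hN => ?_
    obtain ⟨hN, hN', h⟩ := hN
    exact le_isotypic_of_homogeneousIso hN (h.homogeneousIso hN').symm
  · refine isotypic_le fun i f hf => ?_
    by_cases h0 : f = 0
    · rw [h0, LinearMap.range_zero]
      exact bot_le
    · have hr := isSubmodule_range hf
      have hi := injective_of_isSimple hU' hf h0
      let e : (V.restrict U hU).carrier ≃ₗ[ℂ] (V.restrict _ hr).carrier :=
        LinearEquiv.ofInjective f hi
      have he : HomogeneousIso (V.restrict U hU) (V.restrict _ hr) :=
        ⟨i, e, mem_homGr_of_codRestrict hr hf⟩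
      exact le_iSup₂_of_le (LinearMap.range f) ⟨hr, he.isSimple hU', he.symm.iso⟩ le_rfl

/-- Homogeneous homomorphisms extend along nonzero maps from a simple module. -/
theorem IsSemisimple.exists_extension {Y : SuperModule.{u, x} 𝒜} (hV : V.IsSemisimple)
    (hX : X.IsSimple) {i j : ZMod 2} {s : X.carrier →ₗ[ℂ] V.carrier} (hs : s ∈ homGr X V i)
    (h0 : s ≠ 0) {f : X.carrier →ₗ[ℂ] Y.carrier} (hf : f ∈ homGr X Y j) :
    ∃ b ∈ homGr V Y (j + i), b ∘ₗ s = f := by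
  obtain ⟨r, hr, hrs⟩ := hV.exists_retraction hs (injective_of_isSimple hX hs h0)
  refine ⟨f ∘ₗ r, homGr_comp hf hr, ?_⟩
  rw [LinearMap.comp_assoc, hrs, LinearMap.comp_id]

/-- A nonzero submodule over $A\mathbin{\dot\otimes}B$ contains a copy of $X$, and $B$ carries this
copy onto every other image of $X$. -/
theorem IsSemisimple.isSimple_isotypic (hV : V.IsSemisimple) (hX : X.IsSimple) {i : ZMod 2}
    {s : X.carrier →ₗ[ℂ] V.carrier} (hs : s ∈ homGr X V i) (h0 : s ≠ 0)
    (hC : V.overTensorEnd.IsSubmodule (isotypic V X)) :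
    (V.overTensorEnd.restrict (isotypic V X) hC).IsSimple := by
  suffices h : V.overTensorEnd.IsSimpleSubmodule (isotypic V X) from h.2
  refine isSimpleSubmodule_iff.2 ⟨hC, fun h => h0 (LinearMap.range_eq_bot.1 ?_), ?_⟩
  · exact eq_bot_iff.2 (h ▸ range_le_isotypic hs)
  · intro T hT hT'
    refine or_iff_not_imp_left.2 fun hT0 => le_antisymm hT ?_
    obtain ⟨hT1, hT2⟩ := isSubmodule_overTensorEnd_iff.1 hT'
    obtain ⟨S, hST, hS, hS'⟩ := hT1.exists_simple hT0
    obtain ⟨j, e, he⟩ := hV.homogeneousIso_of_le_isotypic hX hS hS' (hST.trans hT)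
    refine isotypic_le fun k f hf => ?_
    have hse := homGr_comp (subtype_mem_homGr hS) he
    obtain ⟨b, hb, hbf⟩ := hV.exists_extension hX hse (fun h => by
      obtain ⟨x, hx⟩ := (fun h => @exists_ne _ h (0 : X.carrier)) hX.1
      exact hx (e.injective (Subtype.ext (by
        rw [map_zero]
        exact LinearMap.congr_fun h x)))) hf
    rintro _ ⟨x, rfl⟩
    rw [← hbf]
    exact hT2 _ b hb _ (hST (e x).2)

/-- A simple submodule of `V` over `A ⊗ End(V)` has no odd endomorphisms. -/
theorem IsSemisimple.isTypeM_restrict_overTensorEnd (hV : V.IsSemisimple)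
    {C : Submodule ℂ V.carrier} (hC : V.overTensorEnd.IsSubmodule C)
    (hs : (V.overTensorEnd.restrict C hC).IsSimple) :
    (V.overTensorEnd.restrict C hC).IsTypeM := by
  refine isTypeM_of_homGr_one hs fun h hh => ?_
  by_contra h0
  have hC1 := (isSubmodule_overTensorEnd_iff.1 hC).1
  have hh1 : (h : C →ₗ[ℂ] C) ∈ homGr (V.restrict C hC1) (V.restrict C hC1) 1 :=
    ⟨hh.1, fun β a ha x => hh.2 β _ (tmul_one_mem_superTensorGr ha) x⟩
  obtain ⟨p, hp, hps⟩ := hV.exists_retraction (subtype_mem_homGr hC1) C.subtype_injective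
  -- Through a retraction onto $C$, the odd map $h$ extends to an odd element of the
  -- supercentralizer of $V$, which therefore acts on $C$ as $h$.
  have hb := homGr_comp (subtype_mem_homGr hC1) (homGr_comp hh1 hp)
  simp only [zero_add, add_zero] at hb
  have hsq : ∀ x : (V.overTensorEnd.restrict C hC).carrier, h (h x) = 0 := by
    intro x
    have hact : ∀ y : (V.overTensorEnd.restrict C hC).carrier,
        (V.overTensorEnd.restrict C hC).ρ (GradedTensorProduct.tmul ℂ 1
          (⟨_, Submodule.mem_sup_right hb⟩ : V.superEnd)) y = h y := by
      intro y
      apply Subtype.ext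
      refine (overTensorEnd_right V _ y.1).trans ?_
      exact congrArg (fun z => (h z).1) (LinearMap.congr_fun hps y)
    -- Since $h$ supercommutes with the action of that element, it anticommutes with itself, so
    -- $h^2=-h^2$.
    have h1 := hh.2 1 _ (one_tmul_mem_superTensorGr (𝒜 := 𝒜)
      (show (⟨_, Submodule.mem_sup_right hb⟩ : V.superEnd) ∈ V.superEndGr 1 from hb)) x
    rw [hact, hact, mul_one, uzpow_one, Units.neg_smul, one_smul] at h1
    exact eq_zero_of_eq_neg h1
  have hi := injective_of_isSimple hs hh h0
  have := hs.1
  obtain ⟨x, hx⟩ := exists_ne (0 : (V.overTensorEnd.restrict C hC).carrier)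
  refine hx (hi (hi ?_))
  rw [hsq, map_zero, map_zero]

end Isotypic

end SuperModule

/-- Every linear map between superspaces is a sum of an even and an odd one. -/
theorem exists_even_add_odd {V : Type v} [AddCommGroup V] [Module ℂ V] {G : ZMod 2 → Submodule ℂ V}
    (hG : IsCompl (G 0) (G 1)) (g : Module.End ℂ V) :
    ∃ g0 g1 : Module.End ℂ V, (∀ k, ∀ x ∈ G k, g0 x ∈ G (0 + k)) ∧
      (∀ k, ∀ x ∈ G k, g1 x ∈ G (1 + k)) ∧ g0 + g1 = g := by
  refine ⟨comp hG 0 ∘ₗ g ∘ₗ comp hG 0 + comp hG 1 ∘ₗ g ∘ₗ comp hG 1,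
    comp hG 0 ∘ₗ g ∘ₗ comp hG 1 + comp hG 1 ∘ₗ g ∘ₗ comp hG 0, fun k x hx => ?_,
    fun k x hx => ?_, ext_homogeneous hG fun k x hx => ?_⟩
  · rcases zmod2_cases k with rfl | rfl
    · simpa [comp_of_mem hG _ hx] using comp_mem hG 0 _
    · simpa [comp_of_mem hG _ hx] using comp_mem hG 1 _
  · rcases zmod2_cases k with rfl | rfl
    · simpa [comp_of_mem hG _ hx] using comp_mem hG 1 _
    · simpa [comp_of_mem hG _ hx, one_add_one_zmod2] using comp_mem hG 0 _
  · have h := comp_zero_add_comp_one hG (g x)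
    rcases zmod2_cases k with rfl | rfl
    · simpa [comp_of_mem hG _ hx] using h
    · simpa [comp_of_mem hG _ hx, add_comm] using h

/-- Linear maps on a tensor product that agree on tensors of homogeneous vectors are equal. -/
theorem tensor_ext_homogeneous {V : Type v} [AddCommGroup V] [Module ℂ V]
    {G : ZMod 2 → Submodule ℂ V} {W : Type w} [AddCommGroup W] [Module ℂ W]
    {H : ZMod 2 → Submodule ℂ W} {X : Type x} [AddCommGroup X] [Module ℂ X]
    (hG : IsCompl (G 0) (G 1)) (hH : IsCompl (H 0) (H 1)) {f g : V ⊗[ℂ] W →ₗ[ℂ] X}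
    (hfg : ∀ i, ∀ y ∈ G i, ∀ j, ∀ z ∈ H j, f (y ⊗ₜ z) = g (y ⊗ₜ z)) : f = g :=
  TensorProduct.ext (ext_homogeneous hG fun i y hy =>
    ext_homogeneous hH fun j z hz => hfg i y hy j z hz)

namespace SuperModule

variable {A : Type u} [Ring A] [Algebra ℂ A] {𝒜 : ZMod 2 → Submodule ℂ A} [GradedAlgebra 𝒜]

/-! ### Homogeneous maps out of supertensor products. -/

section Tensor

variable {B : Type w} [Ring B] [Algebra ℂ B] {ℬ : ZMod 2 → Submodule ℂ B} [GradedAlgebra ℬ]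
  {U : SuperModule.{u, v} 𝒜} {W : SuperModule.{w, v} ℬ}

theorem mem_homGr_superTensor {T : SuperModule.{max u w, x} (superTensorGr 𝒜 ℬ)} {γ : ZMod 2}
    {f : U.carrier ⊗[ℂ] W.carrier →ₗ[ℂ] T.carrier}
    (hdeg : ∀ i, ∀ y ∈ U.gr i, ∀ j, ∀ z ∈ W.gr j, f (y ⊗ₜ z) ∈ T.gr (γ + (i + j)))
    (hl : ∀ α, ∀ a ∈ 𝒜 α, ∀ i, ∀ y ∈ U.gr i, ∀ j, ∀ z ∈ W.gr j, f (U.ρ a y ⊗ₜ z) =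
      (-1 : ℤˣ) ^ (γ * α) • T.ρ (GradedTensorProduct.tmul ℂ a 1) (f (y ⊗ₜ z)))
    (hr : ∀ β, ∀ b ∈ ℬ β, ∀ i, ∀ y ∈ U.gr i, ∀ j, ∀ z ∈ W.gr j,
      (-1 : ℤˣ) ^ (β * i) • f (y ⊗ₜ W.ρ b z) =
        (-1 : ℤˣ) ^ (γ * β) • T.ρ (GradedTensorProduct.tmul ℂ 1 b) (f (y ⊗ₜ z))) :
    f ∈ homGr (superTensor U W) T γ := by
  refine mem_homGr_of_factors (fun k t ht => ?_) (fun α a ha t => ?_) (fun β b hb t => ?_)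
  · have h : tensorGr U.gr W.gr k ≤ (T.gr (γ + k)).comap f :=
      tensorGr_le fun i j y z e hy hz => by
        subst e
        exact hdeg i y hy j z hz
    exact h ht
  · have h : f ∘ₗ leftAction U W a = (((-1 : ℤˣ) ^ (γ * α) : ℤˣ) : ℤ) •
        T.ρ (GradedTensorProduct.tmul ℂ a 1) ∘ₗ f :=
      tensor_ext_homogeneous U.isCompl W.isCompl fun i y hy j z hz => by
        rw [LinearMap.comp_apply, leftAction_tmul, hl α a ha i y hy j z hz, Units.smul_def]
        rfl
    refine (congrArg f (superTensor_left U W a t)).trans ((LinearMap.congr_fun h t).trans ?_)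
    rw [Units.smul_def]
    rfl
  · have h : f ∘ₗ rightAction U W b = (((-1 : ℤˣ) ^ (γ * β) : ℤˣ) : ℤ) •
        T.ρ (GradedTensorProduct.tmul ℂ 1 b) ∘ₗ f :=
      tensor_ext_homogeneous U.isCompl W.isCompl fun i y hy j z hz => by
        rw [LinearMap.comp_apply, rightAction_tmul U W hb hy, map_sign, hr β b hb i y hy j z hz,
          Units.smul_def]
        rfl
    refine (congrArg f (superTensor_right U W b t)).trans ((LinearMap.congr_fun h t).trans ?_)
    rw [Units.smul_def]
    rfl

theorem mem_homGr_superTensor_superTensor {U' : SuperModule.{u, x} 𝒜} {W' : SuperModule.{w, x} ℬ}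
    {γ : ZMod 2} {f : U.carrier ⊗[ℂ] W.carrier →ₗ[ℂ] U'.carrier ⊗[ℂ] W'.carrier}
    (hdeg : ∀ i, ∀ y ∈ U.gr i, ∀ j, ∀ z ∈ W.gr j,
      f (y ⊗ₜ z) ∈ tensorGr U'.gr W'.gr (γ + (i + j)))
    (hl : ∀ α, ∀ a ∈ 𝒜 α, ∀ i, ∀ y ∈ U.gr i, ∀ j, ∀ z ∈ W.gr j, f (U.ρ a y ⊗ₜ z) =
      (-1 : ℤˣ) ^ (γ * α) • leftAction U' W' a (f (y ⊗ₜ z)))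
    (hr : ∀ β, ∀ b ∈ ℬ β, ∀ i, ∀ y ∈ U.gr i, ∀ j, ∀ z ∈ W.gr j,
      (-1 : ℤˣ) ^ (β * i) • f (y ⊗ₜ W.ρ b z) =
        (-1 : ℤˣ) ^ (γ * β) • rightAction U' W' b (f (y ⊗ₜ z))) :
    f ∈ homGr (superTensor U W) (superTensor U' W') γ :=
  mem_homGr_superTensor hdeg
    (fun α a ha i y hy j z hz => (hl α a ha i y hy j z hz).trans
      (congrArg _ (superTensor_left U' W' a _).symm))
    (fun β b hb i y hy j z hz => (hr β b hb i y hy j z hz).trans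
      (congrArg _ (superTensor_right U' W' b _).symm))

theorem sign_smul_tmul (s : ℤˣ) (y : U.carrier) (z : W.carrier) :
    (s • y) ⊗ₜ[ℂ] z = s • (y ⊗ₜ[ℂ] z) := by
  rw [Units.smul_def, Units.smul_def]
  exact map_zsmul ((TensorProduct.mk ℂ U.carrier W.carrier).flip z) (s : ℤ) y

theorem tmul_sign_smul (s : ℤˣ) (y : U.carrier) (z : W.carrier) :
    y ⊗ₜ[ℂ] (s • z) = s • (y ⊗ₜ[ℂ] z) :=
  map_sign (TensorProduct.mk ℂ U.carrier W.carrier y) s z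

theorem rTensor_mem_homGr {γ : ZMod 2} {j : Module.End ℂ U.carrier} (hj : j ∈ homGr U U γ) :
    LinearMap.rTensor W.carrier j ∈ homGr (superTensor U W) (superTensor U W) γ := by
  refine mem_homGr_superTensor_superTensor (fun i y hy k z hz => ?_)
    (fun α a ha i y hy k z hz => ?_) (fun β b hb i y hy k z hz => ?_)
  · rw [← add_assoc]
    exact tmul_mem_tensorGr (hj.1 i y hy) hz
  · rw [LinearMap.rTensor_tmul, LinearMap.rTensor_tmul, leftAction_tmul, hj.2 α a ha,
      sign_smul_tmul]
  · rw [LinearMap.rTensor_tmul, LinearMap.rTensor_tmul, rightAction_tmul U W hb (hj.1 i y hy),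
      smul_smul, ← uzpow_add, mul_add, ← add_assoc, mul_comm γ β, CharTwo.add_self_eq_zero,
      zero_add]

/-- An odd map on the second factor has to pass the first, at the cost of $(-1)^i$ on $U_i$; the
parity of $U$ records this sign. It transports odd endomorphisms of $W$ to
$U\mathbin{\dot\otimes}W$. -/
theorem map_parity_mem_homGr {S : Module.End ℂ W.carrier} (hS : S ∈ homGr W W 1) :
    (TensorProduct.map (parity U.isCompl) S :
      U.carrier ⊗[ℂ] W.carrier →ₗ[ℂ] U.carrier ⊗[ℂ] W.carrier) ∈
      homGr (superTensor U W) (superTensor U W) 1 := by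
  refine mem_homGr_superTensor_superTensor (fun i y hy k z hz => ?_)
    (fun α a ha i y hy k z hz => ?_) (fun β b hb i y hy k z hz => ?_)
  · rw [add_left_comm]
    exact tmul_mem_tensorGr (parity_mem U.isCompl hy) (hS.1 k z hz)
  · rw [TensorProduct.map_tmul, TensorProduct.map_tmul, leftAction_tmul, ρ_parity,
      parityAut_of_mem 𝒜 ha, one_mul, Units.smul_def, map_zsmul,
      LinearMap.smul_apply, ← Units.smul_def, sign_smul_tmul]
  · rw [TensorProduct.map_tmul, TensorProduct.map_tmul,
      rightAction_tmul U W hb (parity_mem U.isCompl hy), hS.2 β b hb, tmul_sign_smul, smul_smul,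
      smul_smul, mul_comm]

/-- Shifting both factors of a supertensor product gives a strictly isomorphic module. -/
theorem strictIso_superTensor_shift (U : SuperModule.{u, v} 𝒜) (W : SuperModule.{w, v} ℬ) :
    StrictIso (superTensor U.shift W.shift) (superTensor U W) := by
  -- The identity has the right degree but not the right signs. The parity on the first factor
  -- absorbs both the twist of the $A$-action and the change of degree of $u$ in the sign of the
  -- $B$-action.
  let δ : U.carrier ≃ₗ[ℂ] U.carrier :=
    LinearEquiv.ofInvolutive (parity U.isCompl) (parity_parity U.isCompl)
  let f : U.carrier ⊗[ℂ] W.carrier →ₗ[ℂ] U.carrier ⊗[ℂ] W.carrier :=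
    (TensorProduct.congr δ (LinearEquiv.refl ℂ W.carrier)).toLinearMap
  have hf : ∀ (y : U.carrier) (z : W.carrier), f (y ⊗ₜ z) = parity U.isCompl y ⊗ₜ z :=
    fun _ _ => rfl
  have hdeg : ∀ i, ∀ y ∈ U.gr (i + 1), ∀ j, ∀ z ∈ W.gr (j + 1),
      f (y ⊗ₜ z) ∈ tensorGr U.gr W.gr (0 + (i + j)) := by
    intro i y hy k z hz
    have h := tmul_mem_tensorGr (parity_mem U.isCompl hy) hz
    rwa [show i + 1 + (k + 1) = 0 + (i + k) by
      rw [add_add_add_comm, one_add_one_zmod2, add_zero, zero_add]] at h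
  have hl : ∀ α, ∀ a ∈ 𝒜 α, ∀ i, ∀ y ∈ U.gr (i + 1), ∀ j, ∀ z ∈ W.gr (j + 1),
      f (U.ρ (parityAut 𝒜 a) y ⊗ₜ z) =
        (-1 : ℤˣ) ^ (0 * α) • leftAction U W a (f (y ⊗ₜ z)) := by
    intro α a ha i y hy k z hz
    have h : parityAut 𝒜 (parityAut 𝒜 a) = a := parity_parity _ a
    rw [hf, hf, leftAction_tmul, ρ_parity, h, zero_mul, uzpow_zero, one_smul]
  have hr : ∀ β, ∀ b ∈ ℬ β, ∀ i, ∀ y ∈ U.gr (i + 1), ∀ j, ∀ z ∈ W.gr (j + 1),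
      (-1 : ℤˣ) ^ (β * i) • f (y ⊗ₜ W.ρ (parityAut ℬ b) z) =
        (-1 : ℤˣ) ^ (0 * β) • rightAction U W b (f (y ⊗ₜ z)) := by
    intro β b hb i y hy k z hz
    have h : W.ρ (parityAut ℬ b) z = (-1 : ℤˣ) ^ β • W.ρ b z := by
      rw [parityAut_of_mem ℬ hb, Units.smul_def, map_zsmul, LinearMap.smul_apply, Units.smul_def]
    rw [hf, hf, rightAction_tmul U W hb (parity_mem U.isCompl hy), h, tmul_sign_smul, smul_smul,
      smul_smul, ← uzpow_add, ← uzpow_add, zero_mul, zero_add, mul_add, mul_one]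
  exact ⟨TensorProduct.congr δ (LinearEquiv.refl ℂ W.carrier),
    mem_homGr_superTensor_superTensor (U := U.shift) (W := W.shift) hdeg hl hr⟩

end Tensor

/-! ### Joint surjectivity of an even and an odd map. -/

section Pair

variable {T : SuperModule.{u, v} 𝒜} {D : SuperModule.{u, w} 𝒜}

/-- An odd homomorphism to $D$ is an even one to the shift of $D$: the shift supplies exactly the
missing degree and sign. -/
theorem prod_mem_homGr {f g : T.carrier →ₗ[ℂ] D.carrier} (hf : f ∈ homGr T D 0)
    (hg : g ∈ homGr T D 1) :
    (f.prod g : T.carrier →ₗ[ℂ] D.carrier × D.carrier) ∈ homGr T (directSum D D.shift) 0 := by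
  refine ⟨fun β x hx => ⟨hf.1 β x hx, ?_⟩, fun β a ha x => ?_⟩
  · have h := hg.1 β x hx
    change g x ∈ D.gr (0 + β + 1)
    rwa [zero_add, add_comm]
  · rw [zero_mul, uzpow_zero, one_smul]
    refine Prod.ext ?_ ?_
    · refine (hf.2 β a ha x).trans ?_
      rw [zero_mul, uzpow_zero, one_smul]
      rfl
    · refine (hg.2 β a ha x).trans ?_
      change _ = D.ρ (parityAut 𝒜 a) (g x)
      rw [parityAut_of_mem 𝒜 ha, one_mul, Units.smul_def, Units.smul_def, map_zsmul,
        LinearMap.smul_apply]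

/-- An even and an odd nonzero map to a simple module without odd endomorphisms are jointly
surjective. -/
theorem prod_surjective (hD : D.IsSimple) (hD1 : ∀ h ∈ homGr D D 1, h = 0)
    {f g : T.carrier →ₗ[ℂ] D.carrier} (hf : f ∈ homGr T D 0) (hg : g ∈ homGr T D 1)
    (hf0 : f ≠ 0) (hg0 : g ≠ 0) : Function.Surjective (f.prod g) := by
  have hfs := surjective_of_isSimple hD hf hf0
  -- The submodule $g(\ker f)$ of the simple $D$ is $0$ or $D$. If it is $0$, then $g$ factors
  -- through $f$ as a nonzero odd endomorphism of $D$, which is excluded; if it is $D$, elements of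
  -- $\ker f$ correct the second coordinate freely.
  rcases hD.2 _ ((isSubmodule_ker hf).map hg) with h | h
  · exfalso
    have hk : ∀ t, f t = 0 → g t = 0 := fun t ht => by
      have : g t ∈ (LinearMap.ker f).map g := ⟨t, ht, rfl⟩
      rwa [h] at this
    -- The section $s$ is merely linear. Because $g$ vanishes on $\ker f$, the composite $g\circ s$
    -- does not depend on it and inherits degree and sign rule from $f$ and $g$.
    obtain ⟨s, hs⟩ := LinearMap.exists_rightInverse_of_surjective f (LinearMap.range_eq_top.2 hfs)
    have hfg : ∀ t, (g ∘ₗ s) (f t) = g t := fun t => by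
      refine sub_eq_zero.1 ?_
      rw [LinearMap.comp_apply, ← map_sub]
      refine hk _ ?_
      rw [map_sub, sub_eq_zero]
      exact LinearMap.congr_fun hs (f t)
    have hgs : g ∘ₗ s ∈ homGr D D 1 := by
      refine ⟨fun β y hy => ?_, fun β a ha y => ?_⟩
      · obtain ⟨t, rfl⟩ := hfs y
        -- As $f$ is even, a preimage of a vector of degree $\beta$ may be replaced by its component
        -- of degree $\beta$.
        have e : f (comp T.isCompl β t) = f t := by
          obtain ⟨t0, ht0, t1, ht1, rfl⟩ := exists_add T.isCompl t
          have h0 := hf.1 0 t0 ht0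
          have h1 := hf.1 1 t1 ht1
          rw [zero_add] at h0 h1
          have h2 := comp_of_mem D.isCompl β hy
          rw [if_pos rfl, map_add, map_add, comp_of_mem D.isCompl β h0,
            comp_of_mem D.isCompl β h1] at h2
          rw [map_add, comp_of_mem T.isCompl β ht0, comp_of_mem T.isCompl β ht1, map_add,
            map_add, ← h2]
          congr 1 <;> split_ifs <;> simp
        rw [← e, hfg]
        exact hg.1 β _ (Super.comp_mem T.isCompl β t)
      · obtain ⟨t, rfl⟩ := hfs y
        have h1 := hf.2 β a ha t
        rw [zero_mul, uzpow_zero, one_smul] at h1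
        rw [← h1, hfg, hfg, hg.2 β a ha]
    refine hg0 (LinearMap.ext fun t => ?_)
    rw [← hfg, hD1 _ hgs]
    rfl
  · rintro ⟨y, z⟩
    obtain ⟨t, rfl⟩ := hfs y
    have hz : z - g t ∈ (LinearMap.ker f).map g := by
      rw [h]
      trivial
    obtain ⟨k, hk, hkz⟩ := hz
    refine ⟨t + k, Prod.ext ?_ ?_⟩
    · change f (t + k) = f t
      rw [map_add, LinearMap.mem_ker.1 hk, add_zero]
    · change g (t + k) = z
      rw [map_add, hkz, add_sub_cancel]

end Pair

/-! ### All linear maps of a simple module come from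
$A\mathbin{\dot\otimes}\operatorname{End}^{\cdot}_A(X)$. -/

section FullEndomorphisms

variable {X : SuperModule.{u, v} 𝒜}

theorem IsSimple.overTensorEnd (hX : X.IsSimple) : X.overTensorEnd.IsSimple :=
  ⟨hX.1, fun N hN => hX.2 N (isSubmodule_overTensorEnd_iff.1 hN).1⟩

theorem mem_homGr_of_mem_homGr_overTensorEnd {i : ZMod 2} {h : Module.End ℂ X.carrier}
    (hh : h ∈ homGr X.overTensorEnd X.overTensorEnd i) : h ∈ homGr X X i :=
  ⟨hh.1, fun β _ ha x => hh.2 β _ (tmul_one_mem_superTensorGr ha) x⟩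

/-- Such an $h$ is itself an element of the supercentralizer that it must supercommute with, so
$h^2=-h^2$ and Schur gives $h=0$. -/
theorem odd_eq_zero_of_isSimple (hX : X.IsSimple) {h : Module.End ℂ X.carrier}
    (hh : h ∈ homGr X.overTensorEnd X.overTensorEnd 1) : h = 0 := by
  by_contra h0
  have hb := mem_homGr_of_mem_homGr_overTensorEnd hh
  have hsq : ∀ x, h (h x) = 0 := by
    intro x
    have h1 := hh.2 1 _ (one_tmul_mem_superTensorGr (𝒜 := 𝒜)
      (show (⟨_, Submodule.mem_sup_right hb⟩ : X.superEnd) ∈ X.superEndGr 1 from hb)) x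
    rw [overTensorEnd_right, mul_one, uzpow_one, Units.neg_smul, one_smul] at h1
    have h2 : h (h x) = -h (h x) :=
      h1.trans (congrArg (- ·) (overTensorEnd_right X _ (h x)))
    exact eq_zero_of_eq_neg h2
  have hi := injective_of_isSimple hX hb h0
  have := hX.1
  obtain ⟨x, hx⟩ := exists_ne (0 : X.carrier)
  refine hx (hi (hi ?_))
  rw [hsq, map_zero, map_zero]

/-- A simple module is absolutely simple over the supertensor product with its
supercentralizer. -/
theorem IsSimple.range_overTensorEnd (hX : X.IsSimple) :
    X.overTensorEnd.ρ.range = (⊤ : Subalgebra ℂ (Module.End ℂ X.carrier)) := by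
  refine eq_top_iff.2 fun g _ => ?_
  have hT := hX.overTensorEnd
  rw [← (isSemisimple_of_isSimple hT).superEnd_overEnd]
  -- The supercentralizer over $A\mathbin{\dot\otimes}\operatorname{End}^{\cdot}_A(X)$ consists of
  -- scalars, so every homogeneous linear map supercommutes with it. The double supercentralizer
  -- property then puts it in the image of the action.
  have key : ∀ γ, ∀ g : Module.End ℂ X.carrier, (∀ k, ∀ x ∈ X.gr k, g x ∈ X.gr (γ + k)) →
      g ∈ homGr X.overTensorEnd.overEnd X.overTensorEnd.overEnd γ := by
    refine fun γ g hg => ⟨hg, ?_⟩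
    rintro β ⟨b, hb⟩ (hbβ : b ∈ homGr X.overTensorEnd X.overTensorEnd β) x
    change g (b x) = (-1 : ℤˣ) ^ (γ * β) • b (g x)
    rcases zmod2_cases β with rfl | rfl
    · obtain ⟨c, rfl⟩ := exists_eq_smul_one hT hbβ
      rw [mul_zero, uzpow_zero, one_smul]
      exact g.map_smul c x
    · rw [odd_eq_zero_of_isSimple hX hbβ]
      exact (map_zero g).trans (smul_zero _).symm
  obtain ⟨g0, g1, h0, h1, rfl⟩ := exists_even_add_odd X.isCompl g
  exact (superHom X.overTensorEnd.overEnd X.overTensorEnd.overEnd).add_mem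
    (Submodule.mem_sup_left (key 0 g0 h0)) (Submodule.mem_sup_right (key 1 g1 h1))

end FullEndomorphisms

theorem superHom_comp {X : SuperModule.{u, v} 𝒜} {Y : SuperModule.{u, w} 𝒜}
    {Z : SuperModule.{u, x} 𝒜} {f : X.carrier →ₗ[ℂ] Y.carrier} {g : Y.carrier →ₗ[ℂ] Z.carrier}
    (hg : g ∈ superHom Y Z) (hf : f ∈ superHom X Y) : g ∘ₗ f ∈ superHom X Z := by
  obtain ⟨f0, hf0, f1, hf1, rfl⟩ := Submodule.mem_sup.1 hf
  obtain ⟨g0, hg0, g1, hg1, rfl⟩ := Submodule.mem_sup.1 hg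
  have h00 := homGr_comp hg0 hf0
  have h01 := homGr_comp hg0 hf1
  have h10 := homGr_comp hg1 hf0
  have h11 := homGr_comp hg1 hf1
  simp only [add_zero, zero_add, one_add_one_zmod2] at h00 h01 h10 h11
  simp only [LinearMap.add_comp, LinearMap.comp_add]
  exact add_mem (add_mem (Submodule.mem_sup_left h00) (Submodule.mem_sup_right h10))
    (add_mem (Submodule.mem_sup_right h01) (Submodule.mem_sup_left h11))

theorem mem_superHom_of_mem_homGr {X : SuperModule.{u, v} 𝒜} {Y : SuperModule.{u, w} 𝒜}
    {i : ZMod 2} {f : X.carrier →ₗ[ℂ] Y.carrier} (hf : f ∈ homGr X Y i) : f ∈ superHom X Y := by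
  rcases zmod2_cases i with rfl | rfl
  · exact Submodule.mem_sup_left hf
  · exact Submodule.mem_sup_right hf

/-! ### The $B$-module $\operatorname{Hom}^{\cdot}_A(X,V)$ and evaluation. -/

section HomModule

variable {X V : SuperModule.{u, v} 𝒜}

/-- The space `Hom·_A(X, V)` as a module over `End·_A(V)`, acting by composition. -/
def homModule (X V : SuperModule.{u, v} 𝒜) : SuperModule.{v, v} V.superEndGr where
  carrier := superHom X V
  gr i := (homGr X V i).comap (superHom X V).subtype
  isCompl := by
    constructor
    · rw [Submodule.disjoint_def]
      rintro ⟨f, hf⟩ (h0 : f ∈ homGr X V 0) (h1 : f ∈ homGr X V 1)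
      refine Subtype.ext (ext_homogeneous X.isCompl fun k x hx =>
        eq_zero_of_mem_of_mem_add_one V.isCompl (k := k) ?_ ?_)
      · simpa using h0.1 k x hx
      · simpa [add_comm] using h1.1 k x hx
    · rw [codisjoint_iff, eq_top_iff]
      rintro ⟨f, hf⟩ -
      obtain ⟨f0, hf0, f1, hf1, rfl⟩ := Submodule.mem_sup.1 hf
      exact Submodule.mem_sup.2 ⟨⟨f0, Submodule.mem_sup_left hf0⟩, hf0,
        ⟨f1, Submodule.mem_sup_right hf1⟩, hf1, rfl⟩
  ρ := AlgHom.ofLinearMap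
    { toFun := fun b =>
        { toFun := fun f => ⟨b.1 ∘ₗ f.1, superHom_comp b.2 f.2⟩
          map_add' := fun f g => Subtype.ext (LinearMap.comp_add _ _ _)
          map_smul' := fun c f => Subtype.ext (LinearMap.comp_smul _ _ _) }
      map_add' := fun b c => rfl
      map_smul' := fun c b => rfl }
    rfl (fun b c => rfl)
  ρ_mem := fun _ _ _ _ hb hf => homGr_comp hb hf

/-- A homogeneous homomorphism as an element of `homModule`. -/
def homModule.mk {i : ZMod 2} {f : X.carrier →ₗ[ℂ] V.carrier} (hf : f ∈ homGr X V i) :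
    (homModule X V).carrier :=
  ⟨f, mem_superHom_of_mem_homGr hf⟩

theorem homModule.mk_mem {i : ZMod 2} {f : X.carrier →ₗ[ℂ] V.carrier} (hf : f ∈ homGr X V i) :
    homModule.mk hf ∈ (homModule X V).gr i := hf

/-- The homomorphism underlying an element of `homModule`. -/
def homModule.val (X V : SuperModule.{u, v} 𝒜) : (homModule X V).carrier →ₗ[ℂ] X.carrier →ₗ[ℂ] V.carrier :=
  (superHom X V).subtype

theorem homModule.val_injective : Function.Injective (homModule.val X V) :=
  Subtype.val_injective

theorem homModule.val_mem {i : ZMod 2} {f : (homModule X V).carrier}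
    (hf : f ∈ (homModule X V).gr i) : homModule.val X V f ∈ homGr X V i := hf

theorem homModule.val_ρ (b : V.superEnd) (f : (homModule X V).carrier) :
    homModule.val X V ((homModule X V).ρ b f) = b.1 ∘ₗ homModule.val X V f := rfl

theorem homModule.val_mk {i : ZMod 2} {f : X.carrier →ₗ[ℂ] V.carrier} (hf : f ∈ homGr X V i) :
    homModule.val X V (homModule.mk hf) = f := rfl

/-- By the extension property, any nonzero homogeneous $f:X\to V$ is carried to any other
homogeneous map by some $b\in B$. -/
theorem IsSemisimple.isSimple_homModule (hV : V.IsSemisimple) (hX : X.IsSimple) {i : ZMod 2}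
    {s : X.carrier →ₗ[ℂ] V.carrier} (hs : s ∈ homGr X V i) (h0 : s ≠ 0) :
    (homModule X V).IsSimple := by
  refine ⟨⟨homModule.mk hs, 0, fun h => h0 ?_⟩, fun N hN => ?_⟩
  · exact (congrArg (homModule.val X V) h).trans (map_zero _)
  refine or_iff_not_imp_left.2 fun hN0 => ?_
  obtain ⟨k, f, hfN, hf, hf0⟩ := hN.exists_homogeneous hN0
  have hf0' : homModule.val X V f ≠ 0 := fun h =>
    hf0 (homModule.val_injective (h.trans (map_zero _).symm))
  have key : ∀ j, ∀ g ∈ (homModule X V).gr j, g ∈ N := by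
    intro j g hg
    obtain ⟨b, hb, hbf⟩ := hV.exists_extension hX (homModule.val_mem hf) hf0'
      (homModule.val_mem hg)
    have h := hN.stable ⟨b, mem_superHom_of_mem_homGr hb⟩ f hfN
    have e : (homModule X V).ρ ⟨b, mem_superHom_of_mem_homGr hb⟩ f = g :=
      homModule.val_injective hbf
    rwa [e] at h
  refine eq_top_iff.2 fun g _ => ?_
  obtain ⟨g0, hg0, g1, hg1, rfl⟩ := exists_add (homModule X V).isCompl g
  exact add_mem (key 0 g0 hg0) (key 1 g1 hg1)

/-- The `A`-linear map attached to a super homomorphism: `f ↦ ((-1)^(α β) f(x))` on vectors of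
degree `β` for `f` of degree `α`. -/
def untwist (X V : SuperModule.{u, v} 𝒜) :
    (homModule X V).carrier →ₗ[ℂ] X.carrier →ₗ[ℂ] V.carrier :=
  homModule.val X V ∘ₗ comp (homModule X V).isCompl 0 +
    (parity X.isCompl).lcomp ℂ V.carrier ∘ₗ homModule.val X V ∘ₗ comp (homModule X V).isCompl 1

theorem untwist_apply {i k : ZMod 2} {f : (homModule X V).carrier}
    (hf : f ∈ (homModule X V).gr i) {x : X.carrier} (hx : x ∈ X.gr k) :
    untwist X V f x = (-1 : ℤˣ) ^ (i * k) • homModule.val X V f x := by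
  simp only [untwist, LinearMap.add_apply, LinearMap.comp_apply, comp_of_mem _ _ hf]
  rcases zmod2_cases i with rfl | rfl
  · simp
  · simp [parity_of_mem _ hx]

/-- On a homogeneous vector the even and the odd part of $f$ take values in different degrees, so
they cannot cancel each other. -/
theorem untwist_injective : Function.Injective (untwist X V) := by
  refine (injective_iff_map_eq_zero _).2 fun f hf => ?_
  obtain ⟨f0, h0, f1, h1, rfl⟩ := exists_add (homModule X V).isCompl f
  have key : ∀ k, ∀ x ∈ X.gr k, homModule.val X V f0 x = 0 ∧ homModule.val X V f1 x = 0 := by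
    intro k x hx
    have h := LinearMap.congr_fun hf x
    rw [map_add, LinearMap.add_apply, untwist_apply h0 hx, untwist_apply h1 hx, zero_mul,
      uzpow_zero, one_smul, one_mul, LinearMap.zero_apply] at h
    have m0 := (homModule.val_mem h0).1 k x hx
    have m1 := (homModule.val_mem h1).1 k x hx
    rw [zero_add] at m0
    rw [add_comm] at m1
    have e : homModule.val X V f0 x = 0 := by
      refine eq_zero_of_mem_of_mem_add_one V.isCompl m0 ?_
      rw [eq_neg_of_add_eq_zero_left h]
      exact neg_mem (sign_smul_mem _ m1)
    refine ⟨e, ?_⟩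
    rw [e, zero_add] at h
    rcases zmod2_cases k with rfl | rfl <;> simpa using h
  have e0 : f0 = 0 := homModule.val_injective
    ((ext_homogeneous X.isCompl fun k x hx => (key k x hx).1).trans (map_zero _).symm)
  have e1 : f1 = 0 := homModule.val_injective
    ((ext_homogeneous X.isCompl fun k x hx => (key k x hx).2).trans (map_zero _).symm)
  rw [e0, e1, add_zero]

/-- The evaluation map `X ⊗ Hom·_A(X, V) → V`, `x ⊗ f ↦ (-1)^(α β) f(x)`. -/
def evalMap (X V : SuperModule.{u, v} 𝒜) :
    X.carrier ⊗[ℂ] (homModule X V).carrier →ₗ[ℂ] V.carrier :=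
  TensorProduct.lift (untwist X V).flip

theorem evalMap_tmul (x : X.carrier) (f : (homModule X V).carrier) :
    evalMap X V (x ⊗ₜ f) = untwist X V f x := rfl

theorem evalMap_tmul_of_mem {i k : ZMod 2} {f : (homModule X V).carrier}
    (hf : f ∈ (homModule X V).gr i) {x : X.carrier} (hx : x ∈ X.gr k) :
    evalMap X V (x ⊗ₜ f) = (-1 : ℤˣ) ^ (i * k) • homModule.val X V f x :=
  untwist_apply hf hx

/-- The sign in the evaluation compensates the sign rule of $f$, so that evaluation is honestly
$A$-linear in its first factor. -/
theorem evalMap_leftAction (a : A) (t : X.carrier ⊗[ℂ] (homModule X V).carrier) :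
    evalMap X V (leftAction X (homModule X V) a t) = V.ρ a (evalMap X V t) := by
  have h : evalMap X V ∘ₗ leftAction X (homModule X V) a = V.ρ a ∘ₗ evalMap X V := by
    refine tensor_ext_homogeneous X.isCompl (homModule X V).isCompl fun i y hy j f hf => ?_
    obtain ⟨b, hb, c, hc, rfl⟩ := exists_add (isCompl_gr 𝒜) a
    have key : ∀ α, ∀ a ∈ 𝒜 α, evalMap X V (X.ρ a y ⊗ₜ f) = V.ρ a (evalMap X V (y ⊗ₜ f)) := by
      intro α a ha
      rw [evalMap_tmul_of_mem hf hy, evalMap_tmul_of_mem hf (X.ρ_mem _ _ _ _ ha hy),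
        (homModule.val_mem hf).2 α a ha, smul_smul, ← uzpow_add, map_sign, mul_add,
        add_right_comm, CharTwo.add_self_eq_zero, zero_add]
    rw [LinearMap.comp_apply, LinearMap.comp_apply, leftAction_tmul, map_add, map_add,
      LinearMap.add_apply, LinearMap.add_apply, TensorProduct.add_tmul, map_add, key 0 b hb,
      key 1 c hc]
  exact LinearMap.congr_fun h t

theorem evalMap_mem_homGr :
    evalMap X V ∈ homGr (superTensor X (homModule X V)) V.overTensorEnd 0 := by
  have hdeg : ∀ i, ∀ y ∈ X.gr i, ∀ j, ∀ f ∈ (homModule X V).gr j,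
      evalMap X V (y ⊗ₜ f) ∈ V.gr (0 + (i + j)) := by
    intro i y hy j f hf
    rw [evalMap_tmul_of_mem hf hy, zero_add, add_comm]
    exact sign_smul_mem _ ((homModule.val_mem hf).1 i y hy)
  have hr : ∀ β, ∀ b ∈ V.superEndGr β, ∀ i, ∀ y ∈ X.gr i, ∀ j, ∀ f ∈ (homModule X V).gr j,
      (-1 : ℤˣ) ^ (β * i) • evalMap X V (y ⊗ₜ (homModule X V).ρ b f) =
        b.1 (evalMap X V (y ⊗ₜ f)) := by
    intro β b hb i y hy j f hf
    rw [evalMap_tmul_of_mem hf hy, map_sign,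
      evalMap_tmul_of_mem ((homModule X V).ρ_mem _ _ _ _ hb hf) hy, smul_smul, ← uzpow_add,
      add_mul, ← add_assoc, CharTwo.add_self_eq_zero, zero_add]
    rfl
  refine mem_homGr_superTensor hdeg (fun α a ha i y hy j f hf => ?_)
    (fun β b hb i y hy j f hf => (hr β b hb i y hy j f hf).trans ?_)
  · rw [zero_mul, uzpow_zero, one_smul]
    exact (evalMap_leftAction a (y ⊗ₜ f)).trans (overTensorEnd_left V a _).symm
  · rw [zero_mul, uzpow_zero, one_smul]
    exact (overTensorEnd_right V b _).symm

theorem range_evalMap : LinearMap.range (evalMap X V) = isotypic V X := by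
  apply le_antisymm
  · rintro _ ⟨t, rfl⟩
    induction t using TensorProduct.induction_on with
    | zero => rw [map_zero]; exact zero_mem _
    | add s t hs ht => rw [map_add]; exact add_mem hs ht
    | tmul y f =>
      have key : ∀ k, ∀ y ∈ X.gr k, ∀ i, ∀ f ∈ (homModule X V).gr i,
          evalMap X V (y ⊗ₜ f) ∈ isotypic V X := by
        intro k y hy i f hf
        rw [evalMap_tmul_of_mem hf hy]
        exact sign_smul_mem _ (range_le_isotypic (homModule.val_mem hf) ⟨y, rfl⟩)
      obtain ⟨y0, hy0, y1, hy1, rfl⟩ := exists_add X.isCompl y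
      obtain ⟨f0, hf0, f1, hf1, rfl⟩ := exists_add (homModule X V).isCompl f
      simp only [TensorProduct.add_tmul, TensorProduct.tmul_add, map_add]
      exact add_mem (add_mem (key _ _ hy0 _ _ hf0) (key _ _ hy1 _ _ hf0))
        (add_mem (key _ _ hy0 _ _ hf1) (key _ _ hy1 _ _ hf1))
  · refine isotypic_le fun i f hf => ?_
    rintro _ ⟨y, rfl⟩
    have key : ∀ k, ∀ y ∈ X.gr k, f y ∈ LinearMap.range (evalMap X V) := by
      intro k y hy
      refine ⟨(-1 : ℤˣ) ^ (i * k) • (y ⊗ₜ homModule.mk hf), ?_⟩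
      rw [map_sign, evalMap_tmul_of_mem (homModule.mk_mem hf) hy, homModule.val_mk, smul_smul,
        Int.units_mul_self, one_smul]
    obtain ⟨y0, hy0, y1, hy1, rfl⟩ := exists_add X.isCompl y
    rw [map_add]
    exact add_mem (key 0 y0 hy0) (key 1 y1 hy1)

/-- A tensor annihilated by evaluation after all endomorphisms of `X` vanishes. -/
theorem IsSimple.eq_zero_of_evalMap (hX : X.IsSimple)
    {t : X.carrier ⊗[ℂ] (homModule X V).carrier}
    (ht : ∀ i, ∀ j ∈ homGr X X i, evalMap X V (LinearMap.rTensor (homModule X V).carrier j t) = 0) :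
    t = 0 := by
  -- The set $K$ of tensors annihilated in this way is stable under
  -- $\operatorname{End}^{\cdot}_A(X)$ by composition, and under $A$ because endomorphisms commute
  -- with $A$ up to the parity automorphism and evaluation is $A$-linear. Since these generate all
  -- linear maps of $X$, it is stable under $g\otimes1$ for every linear $g$.
  let K : Submodule ℂ (X.carrier ⊗[ℂ] (homModule X V).carrier) :=
    ⨅ j : {j : Module.End ℂ X.carrier // ∃ i, j ∈ homGr X X i},
      LinearMap.ker (evalMap X V ∘ₗ LinearMap.rTensor (homModule X V).carrier j.1)
  have hK : ∀ t, t ∈ K ↔ ∀ i, ∀ j ∈ homGr X X i,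
      evalMap X V (LinearMap.rTensor (homModule X V).carrier j t) = 0 := by
    intro t
    simp only [K, Submodule.mem_iInf, LinearMap.mem_ker, LinearMap.comp_apply, Subtype.forall]
    exact ⟨fun h i j hj => h j ⟨i, hj⟩, fun h j ⟨i, hj⟩ => h i j hj⟩
  have hmm : ∀ (f g : Module.End ℂ X.carrier) (t : X.carrier ⊗[ℂ] (homModule X V).carrier),
      LinearMap.rTensor (homModule X V).carrier f (LinearMap.rTensor (homModule X V).carrier g t) =
        LinearMap.rTensor (homModule X V).carrier (f ∘ₗ g) t := by
    intro f g t
    rw [← LinearMap.comp_apply, LinearMap.rTensor_comp]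
  let St : Submodule ℂ (Module.End ℂ X.carrier) :=
    { carrier := {g | ∀ t ∈ K, LinearMap.rTensor (homModule X V).carrier g t ∈ K}
      zero_mem' := fun t _ => by simp
      add_mem' := fun {f g} hf hg t ht => by
        rw [LinearMap.rTensor_add, LinearMap.add_apply]
        exact add_mem (hf t ht) (hg t ht)
      smul_mem' := fun c f hf t ht => by
        rw [LinearMap.rTensor_smul, LinearMap.smul_apply]
        exact K.smul_mem c (hf t ht) }
  have hSt : ∀ g, g ∈ St ↔ ∀ t ∈ K, LinearMap.rTensor (homModule X V).carrier g t ∈ K := fun _ => Iff.rfl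
  have hb : ∀ i, ∀ b ∈ homGr X X i, b ∈ St := by
    intro i b hb
    rw [hSt]
    intro t ht
    rw [hK] at ht ⊢
    intro k j hj
    rw [hmm]
    exact ht _ _ (homGr_comp hj hb)
  have ha : ∀ a, X.ρ a ∈ St := by
    intro a
    rw [hSt]
    intro t ht
    rw [hK] at ht ⊢
    intro k j hj
    have e : j ∘ₗ X.ρ a = X.ρ (if k = 0 then a else parityAut 𝒜 a) ∘ₗ j :=
      LinearMap.ext fun x => homGr_ρ hj a x
    rw [hmm, e, ← hmm]
    refine (evalMap_leftAction _ _).trans ?_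
    rw [ht k j hj, map_zero]
  have hmul : ∀ f g, f ∈ St → g ∈ St → f ∘ₗ g ∈ St := by
    intro f g hf hg
    rw [hSt] at *
    intro t ht
    rw [← hmm]
    exact hf _ (hg t ht)
  have hall : ∀ g, g ∈ St := by
    intro g
    have hg : g ∈ X.overTensorEnd.ρ.range := by
      rw [hX.range_overTensorEnd]
      trivial
    obtain ⟨s, rfl⟩ := hg
    have key : ∀ s : A ⊗[ℂ] X.superEnd,
        X.overTensorEnd.ρ.toLinearMap (GradedTensorProduct.of ℂ 𝒜 X.superEndGr s) ∈ St := by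
      intro s
      induction s using TensorProduct.induction_on with
      | zero => rw [map_zero, map_zero]; exact zero_mem St
      | add s t hs ht => rw [map_add, map_add]; exact St.add_mem hs ht
      | tmul a b =>
        obtain ⟨b, hb'⟩ := b
        obtain ⟨b0, hb0, b1, hb1, rfl⟩ := Submodule.mem_sup.1 (show b ∈ superHom X X from hb')
        exact hmul _ _ (ha a) (add_mem (hb 0 b0 hb0) (hb 1 b1 hb1))
    exact key s
  have htK := (hK t).2 ht
  let b := Module.finBasis ℂ X.carrier
  obtain ⟨c, rfl⟩ := TensorProduct.eq_repr_basis_left b t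
  have hc : ∀ k, c k = 0 := by
    intro k
    refine untwist_injective ((LinearMap.ext fun x => ?_ : _ = (0 : _ →ₗ[ℂ] _)).trans
      (map_zero _).symm)
    -- Writing $t=\sum_k b_k\otimes c_k$ in a basis of $X$, the rank one map sending $b_k$ to $x$
    -- and the other basis vectors to $0$ isolates $x\otimes c_k$. Its evaluation vanishes for every
    -- $x$, hence $c_k=0$.
    have h1 := (hSt _).1 (hall ((b.coord k).smulRight x)) _ htK
    have h2 : LinearMap.rTensor (homModule X V).carrier ((b.coord k).smulRight x)
        (c.sum fun i m => b i ⊗ₜ[ℂ] m) = x ⊗ₜ c k := by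
      rw [Finsupp.sum, map_sum, Finset.sum_eq_single k]
      · simp
      · intro l _ hl
        simp [hl.symm]
      · intro hk
        simp [Finsupp.notMem_support_iff.1 hk]
    rw [h2, hK] at h1
    have h3 := h1 0 LinearMap.id X.homGr_one
    rwa [LinearMap.rTensor_tmul] at h3
  have : c = 0 := Finsupp.ext hc
  rw [this, Finsupp.sum_zero_index]

end HomModule

/-! ### Simple modules appearing in $V$ and their classes. -/

section Appearance

variable {V X Y : SuperModule.{u, v} 𝒜}

theorem simpleAppears_of_ne_zero (hX : X.IsSimple) {i : ZMod 2} {f : X.carrier →ₗ[ℂ] V.carrier}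
    (hf : f ∈ homGr X V i) (h0 : f ≠ 0) : V.SimpleAppears X := by
  have hr := isSubmodule_range hf
  let e : X.carrier ≃ₗ[ℂ] (V.restrict _ hr).carrier :=
    LinearEquiv.ofInjective f (injective_of_isSimple hX hf h0)
  have he : HomogeneousIso X (V.restrict _ hr) := ⟨i, e, mem_homGr_of_codRestrict hr hf⟩
  exact ⟨hX, _, hr, he.iso⟩

theorem SimpleAppears.exists_homogeneousIso (h : V.SimpleAppears X) :
    ∃ S, ∃ hS : V.IsSubmodule S, HomogeneousIso X (V.restrict S hS) := by
  obtain ⟨hX, S, hS, h⟩ := h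
  exact ⟨S, hS, h.homogeneousIso hX⟩

theorem SimpleAppears.exists_ne_zero (h : V.SimpleAppears X) :
    ∃ i, ∃ f ∈ homGr X V i, f ≠ 0 := by
  obtain ⟨S, hS, i, e, he⟩ := h.exists_homogeneousIso
  refine ⟨0 + i, _, homGr_comp (subtype_mem_homGr hS) he, fun h0 => ?_⟩
  have := h.1.1
  obtain ⟨x, hx⟩ := exists_ne (0 : X.carrier)
  refine hx (e.injective (Subtype.ext ?_))
  rw [map_zero]
  exact LinearMap.congr_fun h0 x

theorem simpleAppears_restrict {S : Submodule ℂ V.carrier} (hS : V.IsSubmodule S)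
    (hS' : (V.restrict S hS).IsSimple) : V.SimpleAppears (V.restrict S hS) :=
  ⟨hS', S, hS, (HomogeneousIso.refl _).iso⟩

/-- A `Quot` identifies along the equivalence relation generated by the given one. Being
homogeneously isomorphic to $X$ descends to the quotient, so equal classes really are isomorphic. -/
theorem irrClass_eq_iff (hX : V.SimpleAppears X) (hY : V.SimpleAppears Y) :
    V.irrClass X hX = V.irrClass Y hY ↔ HomogeneousIso X Y := by
  refine ⟨fun h => ?_, fun h => Quot.sound h.iso⟩
  let F : V.IrrIn → Prop := Quot.lift (fun Z => HomogeneousIso X Z.1) (fun Z Z' hZ =>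
    propext ⟨fun h => h.trans (hZ.homogeneousIso Z.2.1),
      fun h => h.trans (hZ.homogeneousIso Z.2.1).symm⟩)
  have h1 : F (V.irrClass X hX) := HomogeneousIso.refl X
  rw [h] at h1
  exact h1

end Appearance

/-! ### Evaluation in types $M$ and $Q$, and the passage from $X$ to
$\operatorname{Hom}^{\cdot}_A(X,V)$. -/

section HomModule

variable {V X Y : SuperModule.{u, v} 𝒜}

/-- Precomposition with a homogeneous map. -/
def precomp (V : SuperModule.{u, v} 𝒜) {γ : ZMod 2} {g : Y.carrier →ₗ[ℂ] X.carrier}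
    (hg : g ∈ homGr Y X γ) : (homModule X V).carrier →ₗ[ℂ] (homModule Y V).carrier where
  toFun f := ⟨f.1 ∘ₗ g, superHom_comp f.2 (mem_superHom_of_mem_homGr hg)⟩
  map_add' _ _ := Subtype.ext (LinearMap.add_comp _ _ _)
  map_smul' _ _ := Subtype.ext (LinearMap.smul_comp _ _ _)

theorem precomp_mem_gr {γ i : ZMod 2} {g : Y.carrier →ₗ[ℂ] X.carrier} (hg : g ∈ homGr Y X γ)
    {f : (homModule X V).carrier} (hf : f ∈ (homModule X V).gr i) :
    precomp V hg f ∈ (homModule Y V).gr (γ + i) := by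
  rw [add_comm]
  exact homGr_comp (homModule.val_mem hf) hg

theorem precomp_ρ {γ : ZMod 2} {g : Y.carrier →ₗ[ℂ] X.carrier} (hg : g ∈ homGr Y X γ)
    (b : V.superEnd) (f : (homModule X V).carrier) :
    precomp V hg ((homModule X V).ρ b f) = (homModule Y V).ρ b (precomp V hg f) := rfl

/-- A surjective homogeneous map `Y → X` induces a nonzero homogeneous map from `Hom·_A(X, V)` to
`Hom·_A(Y, V)`. -/
theorem exists_homModule_map {γ i : ZMod 2} {g : Y.carrier →ₗ[ℂ] X.carrier} (hg : g ∈ homGr Y X γ)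
    (hgs : Function.Surjective g) {s : X.carrier →ₗ[ℂ] V.carrier} (hs : s ∈ homGr X V i)
    (h0 : s ≠ 0) : ∃ P ∈ homGr (homModule X V) (homModule Y V) γ, P ≠ 0 := by
  have hne : precomp V hg (homModule.mk hs) ≠ 0 := by
    intro h
    refine h0 (LinearMap.ext fun x => ?_)
    obtain ⟨y, rfl⟩ := hgs x
    exact LinearMap.congr_fun (congrArg (homModule.val Y V) h) y
  rcases zmod2_cases γ with rfl | rfl
  · refine ⟨precomp V hg, ⟨fun β f hf => precomp_mem_gr hg hf, fun β b hb f => ?_⟩, fun h => ?_⟩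
    · rw [precomp_ρ, zero_mul, uzpow_zero, one_smul]
    · exact hne (LinearMap.congr_fun h _)
  -- Precomposition commutes with the $B$-action without sign; for odd $g$ the parity of the source
  -- module provides the sign that an odd homomorphism needs.
  · refine ⟨precomp V hg ∘ₗ parity (homModule X V).isCompl,
      ⟨fun β f hf => precomp_mem_gr hg (parity_mem _ hf), fun β b hb f => ?_⟩, fun h => ?_⟩
    · rw [LinearMap.comp_apply, LinearMap.comp_apply, ρ_parity, precomp_ρ,
        parityAut_of_mem _ hb, one_mul, Units.smul_def, Units.smul_def, map_zsmul,
        LinearMap.smul_apply]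
    · refine hne ?_
      have h1 := LinearMap.congr_fun h (parity (homModule X V).isCompl (homModule.mk hs))
      rwa [LinearMap.comp_apply, parity_parity] at h1

theorem IsSemisimple.homogeneousIso_homModule (hV : V.IsSemisimple) (hX : V.SimpleAppears X)
    (h : HomogeneousIso X Y) : HomogeneousIso (homModule X V) (homModule Y V) := by
  obtain ⟨i, s, hs, h0⟩ := hX.exists_ne_zero
  obtain ⟨γ, e, he⟩ := h
  obtain ⟨P, hP, hP0⟩ := exists_homModule_map (homGr_symm he) e.symm.surjective hs h0
  have hse := homGr_comp hs (homGr_symm he)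
  have hY : Y.IsSimple := HomogeneousIso.isSimple ⟨γ, e, he⟩ hX.1
  refine homogeneousIso_of_ne_zero (hV.isSimple_homModule hX.1 hs h0)
    (hV.isSimple_homModule hY hse fun h => h0 (LinearMap.ext fun x => ?_)) hP hP0
  have := LinearMap.congr_fun h (e x)
  simpa using this

theorem eq_zero_of_evalMap_of_isTypeM (hX : X.IsTypeM)
    {t : X.carrier ⊗[ℂ] (homModule X V).carrier} (ht : evalMap X V t = 0) : t = 0 := by
  refine hX.1.eq_zero_of_evalMap fun i j hj => ?_
  rcases zmod2_cases i with rfl | rfl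
  · obtain ⟨c, rfl⟩ := exists_eq_smul_one hX.1 hj
    rw [LinearMap.rTensor_smul, LinearMap.smul_apply, map_smul, Module.End.one_eq_id,
      LinearMap.rTensor_id, LinearMap.id_apply, ht, smul_zero]
  · rw [hX.eq_zero hj, LinearMap.rTensor_zero, LinearMap.zero_apply, map_zero]

theorem eq_zero_of_evalMap_of_odd (hX : X.IsSimple) {j : Module.End ℂ X.carrier}
    (hj : j ∈ homGr X X 1) (hjj : j * j = 1) {t : X.carrier ⊗[ℂ] (homModule X V).carrier}
    (ht : evalMap X V t = 0)
    (ht' : evalMap X V (LinearMap.rTensor (homModule X V).carrier j t) = 0) : t = 0 := by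
  refine hX.eq_zero_of_evalMap fun i k hk => ?_
  rcases zmod2_cases i with rfl | rfl
  · obtain ⟨c, rfl⟩ := exists_eq_smul_one hX hk
    rw [LinearMap.rTensor_smul, LinearMap.smul_apply, map_smul, Module.End.one_eq_id,
      LinearMap.rTensor_id, LinearMap.id_apply, ht, smul_zero]
  · obtain ⟨c, rfl⟩ := exists_eq_smul_of_mem_homGr_one hX hj hjj hk
    rw [LinearMap.rTensor_smul, LinearMap.smul_apply, map_smul, ht', smul_zero]

theorem evalMap_mem_isotypic (t : X.carrier ⊗[ℂ] (homModule X V).carrier) :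
    evalMap X V t ∈ isotypic V X :=
  range_evalMap (X := X) (V := V) ▸ LinearMap.mem_range_self _ t

/-- The evaluation map onto the isotypic submodule. -/
def evalIsotypic (X V : SuperModule.{u, v} 𝒜) :
    X.carrier ⊗[ℂ] (homModule X V).carrier →ₗ[ℂ] isotypic V X :=
  (evalMap X V).codRestrict _ evalMap_mem_isotypic

theorem evalIsotypic_mem_homGr (hC : V.overTensorEnd.IsSubmodule (isotypic V X)) :
    evalIsotypic X V ∈ homGr (superTensor X (homModule X V))
      (V.overTensorEnd.restrict (isotypic V X) hC) 0 :=
  codRestrict_mem_homGr hC evalMap_mem_homGr evalMap_mem_isotypic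

theorem evalIsotypic_surjective : Function.Surjective (evalIsotypic X V) := by
  rintro ⟨y, hy⟩
  rw [← range_evalMap] at hy
  obtain ⟨t, rfl⟩ := hy
  exact ⟨t, rfl⟩

theorem strictIso_isotypic_of_isTypeM (hX : X.IsTypeM)
    (hC : V.overTensorEnd.IsSubmodule (isotypic V X)) :
    StrictIso (superTensor X (homModule X V)) (V.overTensorEnd.restrict (isotypic V X) hC) := by
  refine ⟨LinearEquiv.ofBijective (evalIsotypic X V) ⟨?_, evalIsotypic_surjective⟩,
    evalIsotypic_mem_homGr hC⟩
  exact (injective_iff_map_eq_zero _).2 fun t ht =>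
    eq_zero_of_evalMap_of_isTypeM hX (congrArg Subtype.val ht)

/-- Evaluation alone loses half of the tensor product. Evaluating also after $j\otimes1$ recovers
it: the pair is injective because $1$ and $j$ span the endomorphisms of $X$, and surjective because
the component has type $M$. -/
theorem IsSemisimple.strictIso_isotypic_of_isTypeQ (hV : V.IsSemisimple) (hX : X.IsTypeQ)
    (hX' : V.SimpleAppears X) (hC : V.overTensorEnd.IsSubmodule (isotypic V X)) :
    StrictIso (superTensor X (homModule X V))
      (directSum (V.overTensorEnd.restrict (isotypic V X) hC)
        (V.overTensorEnd.restrict (isotypic V X) hC).shift) := by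
  obtain ⟨j, hj, hjj⟩ := hX.exists_odd
  obtain ⟨i, s, hs, h0⟩ := hX'.exists_ne_zero
  have hD := hV.isSimple_isotypic hX.1 hs h0 hC
  have hDM := hV.isTypeM_restrict_overTensorEnd hC hD
  let g := evalIsotypic X V ∘ₗ LinearMap.rTensor (homModule X V).carrier j
  have hf := evalIsotypic_mem_homGr hC
  have hg : g ∈ homGr (superTensor X (homModule X V))
      (V.overTensorEnd.restrict (isotypic V X) hC) 1 := by
    have h := homGr_comp hf (rTensor_mem_homGr (W := homModule X V) hj)
    rwa [zero_add] at h
  have hrr : ∀ t, LinearMap.rTensor (homModule X V).carrier j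
      (LinearMap.rTensor (homModule X V).carrier j t) = t := by
    intro t
    rw [← LinearMap.comp_apply, ← LinearMap.rTensor_comp, ← Module.End.mul_eq_comp, hjj,
      Module.End.one_eq_id, LinearMap.rTensor_id, LinearMap.id_apply]
  have hne : Nontrivial (isotypic V X) := hD.1
  obtain ⟨y, hy⟩ := exists_ne (0 : isotypic V X)
  obtain ⟨t, rfl⟩ := evalIsotypic_surjective y
  have hsurj := prod_surjective hD (fun h hh => hDM.eq_zero hh) hf hg
    (fun h => hy (LinearMap.congr_fun h t))
    (fun h => hy (by
      have h1 : g (LinearMap.rTensor (homModule X V).carrier j t) = 0 := LinearMap.congr_fun h _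
      rwa [LinearMap.comp_apply, hrr] at h1))
  have hinj : Function.Injective ((evalIsotypic X V).prod g) :=
    (injective_iff_map_eq_zero _).2 fun t ht =>
      eq_zero_of_evalMap_of_odd hX.1 hj hjj (congrArg (fun y => y.1.1) ht)
        (congrArg (fun y => y.2.1) ht)
  exact ⟨LinearEquiv.ofBijective ((evalIsotypic X V).prod g) ⟨hinj, hsurj⟩,
    prod_mem_homGr hf hg⟩

/-- Precomposition with the odd involution of $X$ yields a nonzero odd endomorphism. -/
theorem IsSemisimple.isTypeQ_homModule (hV : V.IsSemisimple) (hX : X.IsTypeQ)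
    (hX' : V.SimpleAppears X) : (homModule X V).IsTypeQ := by
  obtain ⟨j, hj, hjj⟩ := hX.exists_odd
  obtain ⟨i, s, hs, h0⟩ := hX'.exists_ne_zero
  obtain ⟨P, hP, hP0⟩ := exists_homModule_map hj (fun x => ⟨j x, LinearMap.congr_fun hjj x⟩) hs h0
  exact isTypeQ_of_homGr_one (hV.isSimple_homModule hX.1 hs h0) hP hP0

/-- An odd endomorphism $S$ of the $\operatorname{Hom}$ module gives the odd endomorphism
$\delta\otimes S$ of the tensor product, which is isomorphic to a component of type $M$. So
$\delta\otimes S=0$, and evaluating at $\delta x\otimes f$ gives $S=0$. -/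
theorem IsSemisimple.isTypeM_homModule (hV : V.IsSemisimple) (hX : X.IsTypeM)
    (hX' : V.SimpleAppears X) : (homModule X V).IsTypeM := by
  obtain ⟨i, s, hs, h0⟩ := hX'.exists_ne_zero
  refine isTypeM_of_homGr_one (hV.isSimple_homModule hX.1 hs h0) fun S hS => ?_
  have hC := isSubmodule_overTensorEnd_isotypic (V := V) (X := X)
  have hDM := hV.isTypeM_restrict_overTensorEnd hC (hV.isSimple_isotypic hX.1 hs h0 hC)
  obtain ⟨e, he⟩ := strictIso_isotypic_of_isTypeM (V := V) hX hC
  have h1 := homGr_comp he (homGr_comp (map_parity_mem_homGr (U := X) hS) (homGr_symm he))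
  rw [zero_add, add_zero] at h1
  have h2 := hDM.eq_zero h1
  have h3 : ∀ t, TensorProduct.map (parity X.isCompl) S t = 0 := by
    intro t
    refine e.injective ?_
    have h4 := LinearMap.congr_fun h2 (e t)
    refine Eq.trans ?_ (h4.trans (map_zero e).symm)
    exact congrArg (fun t => e (TensorProduct.map (parity X.isCompl) S t))
      (e.symm_apply_apply t).symm
  refine LinearMap.ext fun f => untwist_injective (LinearMap.ext fun x => ?_)
  have h5 := congrArg (evalMap X V) (h3 (parity X.isCompl x ⊗ₜ f))
  rw [TensorProduct.map_tmul, parity_parity, evalMap_tmul, map_zero] at h5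
  rw [h5, LinearMap.zero_apply, map_zero, LinearMap.zero_apply]

/-- Evaluation at a homogeneous vector is a homomorphism over the supercentralizer. -/
theorem untwist_flip_mem_homGr {k : ZMod 2} {x : X.carrier} (hx : x ∈ X.gr k) :
    (untwist X V).flip x ∈ homGr (homModule X V) V.overEnd k := by
  have hdeg : ∀ i, ∀ f ∈ (homModule X V).gr i, untwist X V f x ∈ V.gr (k + i) := by
    intro i f hf
    rw [untwist_apply hf hx, add_comm]
    exact sign_smul_mem _ ((homModule.val_mem hf).1 k x hx)
  have hmul : ∀ β, ∀ b ∈ V.superEndGr β, ∀ f, untwist X V ((homModule X V).ρ b f) x =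
      (-1 : ℤˣ) ^ (k * β) • b.1 (untwist X V f x) := by
    intro β b hb f
    have key : ∀ i, ∀ f ∈ (homModule X V).gr i, untwist X V ((homModule X V).ρ b f) x =
        (-1 : ℤˣ) ^ (k * β) • b.1 (untwist X V f x) := by
      intro i f hf
      rw [untwist_apply hf hx, untwist_apply ((homModule X V).ρ_mem _ _ _ _ hb hf) hx, map_sign,
        smul_smul, ← uzpow_add, add_mul, mul_comm k β]
      rfl
    obtain ⟨f0, hf0, f1, hf1, rfl⟩ := exists_add (homModule X V).isCompl f
    rw [map_add, map_add, map_add, LinearMap.add_apply, LinearMap.add_apply, map_add, smul_add,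
      key 0 f0 hf0, key 1 f1 hf1]
  exact ⟨hdeg, hmul⟩

/-- Evaluation at a nonzero homogeneous $x\in X$ maps the $\operatorname{Hom}$ module to $V$ over
$B$, and it does not kill an injective $s:X\to V$. -/
theorem IsSemisimple.simpleAppears_homModule (hV : V.IsSemisimple) (hX : V.SimpleAppears X) :
    V.overEnd.SimpleAppears (homModule X V) := by
  obtain ⟨i, s, hs, h0⟩ := hX.exists_ne_zero
  have hW := hV.isSimple_homModule hX.1 hs h0
  obtain ⟨k, x, -, hx, hx0⟩ := X.isSubmodule_top.exists_homogeneous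
    (fun h => h0 (LinearMap.ext fun x => by
      have : x ∈ (⊤ : Submodule ℂ X.carrier) := trivial
      rw [h, Submodule.mem_bot] at this
      rw [this, map_zero, map_zero]))
  refine simpleAppears_of_ne_zero hW (untwist_flip_mem_homGr hx) fun h => hx0 ?_
  have h1 : untwist X V (homModule.mk hs) x = 0 := LinearMap.congr_fun h (homModule.mk hs)
  rw [untwist_apply (homModule.mk_mem hs) hx, homModule.val_mk, ← map_sign] at h1
  have h2 := injective_of_isSimple hX.1 hs h0 (h1.trans (map_zero s).symm)
  have h3 := congrArg ((-1 : ℤˣ) ^ (i * k) • ·) h2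
  simpa [smul_smul, Int.units_mul_self] using h3

/-- For a retraction $r$ of $s:X\to V$, the element $s\circ r$ of $B$ fixes $s$. If $Y\not\cong X$,
Schur gives $r\circ f=0$ for all $f:Y\to V$, so the same element acts as $0$ on the other
$\operatorname{Hom}$ module. -/
theorem IsSemisimple.homogeneousIso_of_homModule (hV : V.IsSemisimple) (hX : V.SimpleAppears X)
    (hY : V.SimpleAppears Y) (h : HomogeneousIso (homModule X V) (homModule Y V)) :
    HomogeneousIso Y X := by
  obtain ⟨i, s, hs, h0⟩ := hX.exists_ne_zero
  obtain ⟨r, hr, hrs⟩ := hV.exists_retraction hs (injective_of_isSimple hX.1 hs h0)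
  obtain ⟨γ, e, he⟩ := h
  by_contra hXY
  have hzero : ∀ j, ∀ f ∈ homGr Y V j, r ∘ₗ f = 0 := fun j f hf => by
    by_contra hne
    exact hXY (homogeneousIso_of_ne_zero hY.1 hX.1 (homGr_comp hr hf) hne)
  have hb := homGr_comp hs hr
  let b : V.superEnd := ⟨s ∘ₗ r, mem_superHom_of_mem_homGr hb⟩
  have hbY : ∀ f, (homModule Y V).ρ b f = 0 := by
    intro f
    apply homModule.val_injective
    obtain ⟨f0, hf0, f1, hf1, e⟩ := exists_add (homModule Y V).isCompl f
    rw [map_zero, homModule.val_ρ, ← e, map_add]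
    change (s ∘ₗ r) ∘ₗ _ = 0
    rw [LinearMap.comp_assoc, LinearMap.comp_add, hzero _ _ (homModule.val_mem hf0),
      hzero _ _ (homModule.val_mem hf1), add_zero, LinearMap.comp_zero]
  have hbX : (homModule X V).ρ b (homModule.mk hs) = homModule.mk hs := by
    apply homModule.val_injective
    change (s ∘ₗ r) ∘ₗ s = s
    rw [LinearMap.comp_assoc, hrs, LinearMap.comp_id]
  have h1 := he.2 _ b hb (homModule.mk hs)
  rw [hbX, hbY, smul_zero] at h1
  have h2 : homModule.mk hs = 0 := e.injective (h1.trans (map_zero e).symm)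
  exact h0 ((congrArg (homModule.val X V) h2).trans (map_zero _))

/-- The simple modules over the supercentralizer appearing in `V` come from simple modules `X`
appearing in `V`. -/
theorem IsSemisimple.exists_homogeneousIso_homModule (hV : V.IsSemisimple) {ι : Type w}
    {X : ι → SuperModule.{u, v} 𝒜} (hX : ∀ i, V.SimpleAppears (X i))
    (htop : ⨆ i, isotypic V (X i) = ⊤) {S : SuperModule.{v, v} V.superEndGr}
    (hS : V.overEnd.SimpleAppears S) : ∃ i, HomogeneousIso (homModule (X i) V) S := by
  -- Evaluations at homogeneous vectors of the $X_i$ are $B$-homomorphisms from simple modules, and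
  -- their images cover $V$. Hence $V$ is semisimple over $B$, and every simple $B$-submodule is
  -- isomorphic to one of the sources.
  let κ := Σ i, {x : (X i).carrier // ∃ k, x ∈ (X i).gr k}
  have hW : ∀ i, (homModule (X i) V).IsSimple := fun i =>
    (hV.simpleAppears_homModule (hX i)).1
  have hmem : ∀ p : κ, (untwist (X p.1) V).flip p.2.1 ∈
      homGr (homModule (X p.1) V) V.overEnd p.2.2.choose := fun p =>
    untwist_flip_mem_homGr p.2.2.choose_spec
  have hle : (⊤ : Submodule ℂ V.carrier) ≤
      ⨆ p : κ, LinearMap.range ((untwist (X p.1) V).flip p.2.1) := by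
    rw [← htop]
    refine iSup_le fun i => isotypic_le fun j f hf => ?_
    rintro _ ⟨x, rfl⟩
    have key : ∀ k, ∀ x ∈ (X i).gr k,
        f x ∈ ⨆ p : κ, LinearMap.range ((untwist (X p.1) V).flip p.2.1) := by
      intro k x hx
      refine Submodule.mem_iSup_of_mem (⟨i, x, k, hx⟩ : κ)
        ⟨(-1 : ℤˣ) ^ (j * k) • homModule.mk hf, ?_⟩
      change untwist (X i) V _ x = f x
      rw [map_sign, Units.smul_def, LinearMap.smul_apply, ← Units.smul_def,
        untwist_apply (homModule.mk_mem hf) hx, homModule.val_mk, smul_smul,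
        Int.units_mul_self, one_smul]
    obtain ⟨y, hy, z, hz, rfl⟩ := exists_add (X i).isCompl x
    rw [map_add]
    exact add_mem (key 0 y hy) (key 1 z hz)
  have hss : V.overEnd.IsSemisimple := by
    refine top_le_iff.1 (hle.trans (iSup_le fun p => ?_))
    rintro _ ⟨f, rfl⟩
    exact (isSemisimple_of_isSimple (hW p.1)).map_mem (hmem p) f
  obtain ⟨T, hT, hST⟩ := hS.exists_homogeneousIso
  obtain ⟨p, hp⟩ := hss.exists_homogeneousIso_of_le_iSup (X := fun p : κ => homModule (X p.1) V)
    (fun p => hW p.1) hmem hT (hST.isSimple hS.1) (le_top.trans hle)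
  exact ⟨p.1, hp.trans hST.symm⟩

end HomModule

/-! ### Homogeneous components and the decomposition of $V$. -/

section Components

variable {V : SuperModule.{u, v} 𝒜}

/-- Any simple submodule inside a component determines it, since it must be isomorphic to the one
that defines the component; this permits an arbitrary choice of the $U_i$. -/
theorem IsSemisimple.eq_isotypic (hV : V.IsSemisimple) {N U : Submodule ℂ V.carrier}
    (hN : N ∈ V.homogeneousComponents) (hU : V.IsSubmodule U)
    (hU' : (V.restrict U hU).IsSimple) (hle : U ≤ N) : N = isotypic V (V.restrict U hU) := by
  obtain ⟨T, hT, hT', rfl⟩ := hN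
  rw [homogeneousComponent_eq_isotypic hT hT'] at hle ⊢
  exact (hV.homogeneousIso_of_le_isotypic hT' hU hU' hle).isotypic_eq

theorem le_homogeneousComponent {U : Submodule ℂ V.carrier} (hU : V.IsSubmodule U)
    (hU' : (V.restrict U hU).IsSimple) : U ≤ V.homogeneousComponent U hU := by
  rw [homogeneousComponent_eq_isotypic hU hU']
  exact le_isotypic_of_homogeneousIso hU (HomogeneousIso.refl _)

theorem exists_isSimple_le_of_mem_homogeneousComponents {N : Submodule ℂ V.carrier}
    (hN : N ∈ V.homogeneousComponents) :
    ∃ U, ∃ hU : V.IsSubmodule U, (V.restrict U hU).IsSimple ∧ U ≤ N := by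
  obtain ⟨U, hU, hU', rfl⟩ := hN
  exact ⟨U, hU, hU', le_homogeneousComponent hU hU'⟩

theorem IsSemisimple.iSup_homogeneousComponents (hV : V.IsSemisimple) :
    ⨆ N : V.homogeneousComponents, (N : Submodule ℂ V.carrier) = ⊤ := by
  refine top_le_iff.1 ?_
  rw [← show _ = ⊤ from hV]
  refine iSup₂_le fun S hS => ?_
  obtain ⟨hS, hS'⟩ := hS
  exact (le_homogeneousComponent hS hS').trans (le_iSup
    (fun N : V.homogeneousComponents => (N : Submodule ℂ V.carrier)) ⟨_, S, hS, hS', rfl⟩)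

variable {X : V.homogeneousComponents → SuperModule.{u, v} 𝒜}

theorem eq_of_homogeneousIso (hX : ∀ N, N.1 = isotypic V (X N)) {N N' : V.homogeneousComponents}
    (h : HomogeneousIso (X N) (X N')) : N = N' :=
  Subtype.ext (by rw [hX, hX, h.isotypic_eq])

theorem IsSemisimple.exists_homogeneousIso (hV : V.IsSemisimple) (hXs : ∀ N, (X N).IsSimple)
    (hX : ∀ N, N.1 = isotypic V (X N)) {Y : SuperModule.{u, v} 𝒜} (hY : V.SimpleAppears Y) :
    ∃ N, HomogeneousIso (X N) Y := by
  obtain ⟨S, hS, hYS⟩ := hY.exists_homogeneousIso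
  have hS' := hYS.isSimple hY.1
  let N : V.homogeneousComponents := ⟨_, S, hS, hS', rfl⟩
  have hle : S ≤ N.1 := le_homogeneousComponent hS hS'
  rw [hX N] at hle
  exact ⟨N, (hV.homogeneousIso_of_le_isotypic (hXs N) hS hS' hle).trans hYS.symm⟩

/-- A simple submodule common to $N$ and the sum of the other components would be isomorphic to the
simple modules of $N$ and of some $N'\ne N$, forcing $N=N'$. -/
theorem IsSemisimple.iSupIndep_homogeneousComponents (hV : V.IsSemisimple) :
    iSupIndep (fun N : V.homogeneousComponents => (N : Submodule ℂ V.carrier)) := by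
  choose U hU hU' hle using fun N : V.homogeneousComponents =>
    exists_isSimple_le_of_mem_homogeneousComponents N.2
  have hX : ∀ N, N.1 = isotypic V (V.restrict (U N) (hU N)) := fun N =>
    hV.eq_isotypic N.2 (hU N) (hU' N) (hle N)
  have hsub : ∀ N : V.homogeneousComponents, V.IsSubmodule N.1 := fun N =>
    hX N ▸ isSubmodule_isotypic
  intro N
  rw [disjoint_iff]
  by_contra hne
  obtain ⟨S, hSle, hS, hS'⟩ := ((hsub N).inf (isSubmodule_iSup fun N' =>
    isSubmodule_iSup fun _ : N' ≠ N => hsub N')).exists_simple hne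
  let κ := Σ N' : {N' // N' ≠ N},
    {f : (V.restrict (U N'.1) (hU N'.1)).carrier →ₗ[ℂ] V.carrier // ∃ i, f ∈ homGr _ V i}
  have hκ : S ≤ ⨆ p : κ, LinearMap.range p.2.1 := by
    refine (hSle.trans inf_le_right).trans (iSup₂_le fun N' hN' => ?_)
    rw [hX N']
    exact isotypic_le fun i f hf =>
      le_iSup (fun p : κ => LinearMap.range p.2.1) ⟨⟨N', hN'⟩, f, i, hf⟩
  obtain ⟨p, hp⟩ := hV.exists_homogeneousIso_of_le_iSup
    (X := fun p : κ => V.restrict (U p.1.1) (hU p.1.1)) (fun p => hU' p.1.1)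
    (fun p => p.2.2.choose_spec) hS hS' hκ
  have h1 := hSle.trans inf_le_left
  rw [hX N] at h1
  exact p.1.2 (eq_of_homogeneousIso (X := fun N => V.restrict (U N) (hU N)) hX
    (hp.trans (hV.homogeneousIso_of_le_isotypic (hU' N) hS hS' h1).symm))

/-- In a finite-dimensional space an independent family has only finitely many nonzero members, and
no component is zero. -/
theorem IsSemisimple.finite_homogeneousComponents (hV : V.IsSemisimple) :
    V.homogeneousComponents.Finite := by
  have h := WellFoundedGT.finite_ne_bot_of_iSupIndep hV.iSupIndep_homogeneousComponents
  have hne : ∀ N : V.homogeneousComponents, (N : Submodule ℂ V.carrier) ≠ ⊥ := by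
    intro N hN
    obtain ⟨U, hU, hU', hle⟩ := exists_isSimple_le_of_mem_homogeneousComponents N.2
    rw [hN, le_bot_iff] at hle
    exact (isSimpleSubmodule_iff.1 ⟨hU, hU'⟩).2.1 hle
  have h2 : (Set.univ : Set V.homogeneousComponents).Finite := h.subset fun N _ => hne N
  exact Set.finite_coe_iff.1 (Set.finite_univ_iff.1 h2)

end Components

/-! ### The bijection of isomorphism classes. -/

section Correspondence

variable {V : SuperModule.{u, v} 𝒜}

theorem isSubmodule_overTensorEnd_of_eq_isotypic {X : SuperModule.{u, v} 𝒜}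
    {C : Submodule ℂ V.carrier} (hC : C = isotypic V X) : V.overTensorEnd.IsSubmodule C :=
  hC ▸ isSubmodule_overTensorEnd_isotypic

theorem IsSemisimple.isTypeM_of_eq_isotypic (hV : V.IsSemisimple) {X : SuperModule.{u, v} 𝒜}
    (hX : V.SimpleAppears X) {C : Submodule ℂ V.carrier} (hC : C = isotypic V X)
    (hC' : V.overTensorEnd.IsSubmodule C) : (V.overTensorEnd.restrict C hC').IsTypeM := by
  subst hC
  obtain ⟨i, s, hs, h0⟩ := hX.exists_ne_zero
  exact hV.isTypeM_restrict_overTensorEnd hC' (hV.isSimple_isotypic hX.1 hs h0 hC')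

theorem strictIso_of_eq_isotypic_of_isTypeM {X : SuperModule.{u, v} 𝒜} (hX : X.IsTypeM)
    {C : Submodule ℂ V.carrier} (hC : C = isotypic V X) (hC' : V.overTensorEnd.IsSubmodule C) :
    StrictIso (superTensor X (homModule X V)) (V.overTensorEnd.restrict C hC') := by
  subst hC
  exact strictIso_isotypic_of_isTypeM hX hC'

theorem IsSemisimple.strictIso_of_eq_isotypic_of_isTypeQ (hV : V.IsSemisimple)
    {X : SuperModule.{u, v} 𝒜} (hX : X.IsTypeQ) (hX' : V.SimpleAppears X)
    {C : Submodule ℂ V.carrier} (hC : C = isotypic V X) (hC' : V.overTensorEnd.IsSubmodule C) :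
    StrictIso (superTensor X (homModule X V)) (directSum (V.overTensorEnd.restrict C hC')
      (V.overTensorEnd.restrict C hC').shift) := by
  subst hC
  exact hV.strictIso_isotypic_of_isTypeQ hX hX' hC'

variable {X : V.homogeneousComponents → SuperModule.{u, v} 𝒜}

theorem IsSemisimple.eq_of_homogeneousIso_homModule (hV : V.IsSemisimple)
    (hXs : ∀ N, V.SimpleAppears (X N)) (hX : ∀ N, N.1 = isotypic V (X N))
    {N N' : V.homogeneousComponents}
    (h : HomogeneousIso (homModule (X N) V) (homModule (X N') V)) : N = N' :=
  (eq_of_homogeneousIso hX (hV.homogeneousIso_of_homModule (hXs N) (hXs N') h)).symm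

theorem IsSemisimple.bijective_irrClass (hV : V.IsSemisimple) (hXs : ∀ N, V.SimpleAppears (X N))
    (hX : ∀ N, N.1 = isotypic V (X N)) :
    Function.Bijective fun N => V.irrClass (X N) (hXs N) := by
  refine ⟨fun N N' h => eq_of_homogeneousIso hX ((irrClass_eq_iff _ _).1 h), ?_⟩
  rintro ⟨Y, hY⟩
  obtain ⟨N, hN⟩ := hV.exists_homogeneousIso (fun N => (hXs N).1) hX hY
  exact ⟨N, (irrClass_eq_iff (hXs N) hY).2 hN⟩

theorem IsSemisimple.bijective_irrClass_homModule (hV : V.IsSemisimple)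
    (hXs : ∀ N, V.SimpleAppears (X N)) (hX : ∀ N, N.1 = isotypic V (X N)) :
    Function.Bijective fun N =>
      V.overEnd.irrClass (homModule (X N) V) (hV.simpleAppears_homModule (hXs N)) := by
  refine ⟨fun N N' h =>
    hV.eq_of_homogeneousIso_homModule hXs hX ((irrClass_eq_iff _ _).1 h), ?_⟩
  rintro ⟨S, hS⟩
  have htop : ⨆ N, isotypic V (X N) = ⊤ := by
    rw [← hV.iSup_homogeneousComponents]
    exact iSup_congr fun N => (hX N).symm
  obtain ⟨N, hN⟩ := hV.exists_homogeneousIso_homModule hXs htop hS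
  exact ⟨N, (irrClass_eq_iff (hV.simpleAppears_homModule (hXs N)) hS).2 hN⟩

/-- The classes of simple modules appearing in `V` over `A` and over its supercentralizer
correspond to each other by `X ↦ Hom·_A(X, V)`. -/
theorem IsSemisimple.exists_equiv_irrIn (hV : V.IsSemisimple) :
    ∃ Φ : V.IrrIn ≃ V.overEnd.IrrIn, ∀ Y (hY : V.SimpleAppears Y),
      Φ (V.irrClass Y hY) =
        V.overEnd.irrClass (homModule Y V) (hV.simpleAppears_homModule hY) := by
  choose U hU hU' hle using fun N : V.homogeneousComponents =>
    exists_isSimple_le_of_mem_homogeneousComponents N.2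
  have hX : ∀ N, N.1 = isotypic V (V.restrict (U N) (hU N)) := fun N =>
    hV.eq_isotypic N.2 (hU N) (hU' N) (hle N)
  have hXs : ∀ N, V.SimpleAppears (V.restrict (U N) (hU N)) := fun N =>
    simpleAppears_restrict (hU N) (hU' N)
  let e := Equiv.ofBijective _ (hV.bijective_irrClass hXs hX)
  let e' := Equiv.ofBijective _ (hV.bijective_irrClass_homModule hXs hX)
  -- Both sets of classes are indexed by the components. The formula for an arbitrary $Y$ follows
  -- since isomorphic $X$ and $Y$ have isomorphic $\operatorname{Hom}$ modules.
  refine ⟨e.symm.trans e', fun Y hY => ?_⟩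
  obtain ⟨N, hN⟩ := hV.exists_homogeneousIso (fun N => (hXs N).1) hX hY
  have h1 : V.irrClass Y hY = e N := ((irrClass_eq_iff (hXs N) hY).2 hN).symm
  rw [h1, Equiv.trans_apply, Equiv.symm_apply_apply]
  exact (irrClass_eq_iff _ _).2 (hV.homogeneousIso_homModule (hXs N) hN)

end Correspondence

end SuperModule

end Super

end

/-! ### The theorem assembled. -/

open Super SuperModule in
theorem theorem2p1 {A : Type u} [Ring A] [Algebra ℂ A] [FiniteDimensional ℂ A]
    (𝒜 : ZMod 2 → Submodule ℂ A) [GradedAlgebra 𝒜] (hA : IsSemisimpleSuperalgebra 𝒜)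
    (V : SuperModule.{u, v} 𝒜) :
    (V.homogeneousComponents.Finite ∧
      DirectSum.IsInternal (fun N : V.homogeneousComponents => (N : Submodule ℂ V.carrier))) ∧
    ∃ hsub : ∀ N : V.homogeneousComponents, V.overTensorEnd.IsSubmodule N.1,
      (∀ N : V.homogeneousComponents, (V.overTensorEnd.restrict N.1 (hsub N)).IsTypeM) ∧
      (∃ Φ : V.IrrIn ≃ V.overEnd.IrrIn,
        ∀ (U : V.homogeneousComponents → Submodule ℂ V.carrier)
          (hU : ∀ N, V.IsSubmodule (U N)),
          (∀ N, (V.restrict (U N) (hU N)).IsSimple) → (∀ N, U N ≤ N.1) →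
          ∃ W : V.homogeneousComponents → SuperModule.{v, v} V.superEndGr,
            (∀ N, (V.restrict (U N) (hU N)).IsTypeM →
              (W N).IsTypeM ∧
              StrictIso (superTensor (V.restrict (U N) (hU N)) (W N))
                (superTensor (V.restrict (U N) (hU N)).shift (W N).shift) ∧
              StrictIso (superTensor (V.restrict (U N) (hU N)).shift (W N).shift)
                (V.overTensorEnd.restrict N.1 (hsub N))) ∧
            (∀ N, (V.restrict (U N) (hU N)).IsTypeQ →
              (W N).IsTypeQ ∧
              StrictIso (superTensor (V.restrict (U N) (hU N)) (W N))
                (directSum (V.overTensorEnd.restrict N.1 (hsub N))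
                  (V.overTensorEnd.restrict N.1 (hsub N)).shift)) ∧
            (∀ N N', N ≠ N' →
              ¬ Iso (V.restrict (U N) (hU N)) (V.restrict (U N') (hU N')) ∧
              ¬ Iso (W N) (W N')) ∧
            (∀ c : V.IrrIn, ∃ N, ∃ hN : V.SimpleAppears (V.restrict (U N) (hU N)),
              c = V.irrClass _ hN) ∧
            (∀ N, ∃ (hN : V.SimpleAppears (V.restrict (U N) (hU N)))
              (hW : V.overEnd.SimpleAppears (W N)),
              Φ (V.irrClass _ hN) = V.overEnd.irrClass _ hW)) ∧
      V.overEnd.superEnd = V.ρ.range := by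
  have hV := isSemisimple_of_isSemisimpleSuperalgebra hA V
  have hcomp : ∀ N : V.homogeneousComponents, ∃ X, V.SimpleAppears X ∧ N.1 = isotypic V X := by
    intro N
    obtain ⟨S, hS, hS', hle⟩ := exists_isSimple_le_of_mem_homogeneousComponents N.2
    exact ⟨_, simpleAppears_restrict hS hS', hV.eq_isotypic N.2 hS hS' hle⟩
  choose X hX hNX using hcomp
  have hsub : ∀ N : V.homogeneousComponents, V.overTensorEnd.IsSubmodule N.1 := fun N =>
    isSubmodule_overTensorEnd_of_eq_isotypic (hNX N)
  refine ⟨⟨hV.finite_homogeneousComponents,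
    (DirectSum.isInternal_submodule_iff_iSupIndep_and_iSup_eq_top _).2
      ⟨hV.iSupIndep_homogeneousComponents, hV.iSup_homogeneousComponents⟩⟩, hsub,
    fun N => hV.isTypeM_of_eq_isotypic (hX N) (hNX N) (hsub N), ?_, hV.superEnd_overEnd⟩
  -- The bijection is fixed before the $U_i$ are chosen, which is the asserted independence of the
  -- choice; $W_i$ is then $\operatorname{Hom}^{\cdot}_A(U_i,V)$.
  obtain ⟨Φ, hΦ⟩ := hV.exists_equiv_irrIn
  refine ⟨Φ, fun U hU hU' hle => ?_⟩
  have hUX : ∀ N, N.1 = isotypic V (V.restrict (U N) (hU N)) := fun N =>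
    hV.eq_isotypic N.2 (hU N) (hU' N) (hle N)
  have hUs : ∀ N, V.SimpleAppears (V.restrict (U N) (hU N)) := fun N =>
    simpleAppears_restrict (hU N) (hU' N)
  refine ⟨fun N => homModule (V.restrict (U N) (hU N)) V, fun N hM => ?_, fun N hQ => ?_,
    fun N N' hne => ⟨fun h => ?_, fun h => ?_⟩, fun c => ?_, fun N => ?_⟩
  · exact ⟨hV.isTypeM_homModule hM (hUs N), (strictIso_superTensor_shift _ _).symm,
      (strictIso_superTensor_shift _ _).trans
        (strictIso_of_eq_isotypic_of_isTypeM hM (hUX N) (hsub N))⟩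
  · exact ⟨hV.isTypeQ_homModule hQ (hUs N),
      hV.strictIso_of_eq_isotypic_of_isTypeQ hQ (hUs N) (hUX N) (hsub N)⟩
  · exact hne (eq_of_homogeneousIso (X := fun N => V.restrict (U N) (hU N)) hUX
      (h.homogeneousIso (hU' N)))
  · exact hne (hV.eq_of_homogeneousIso_homModule (X := fun N => V.restrict (U N) (hU N)) hUs hUX
      (h.homogeneousIso (hV.simpleAppears_homModule (hUs N)).1))
  · obtain ⟨N, hN⟩ := (hV.bijective_irrClass hUs hUX).2 c
    exact ⟨N, hUs N, hN.symm⟩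
  · exact ⟨hUs N, hV.simpleAppears_homModule (hUs N), hΦ _ (hUs N)⟩
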